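/- Let $\tfrac12<\alpha\le 1$, $0<\epsilon<\tfrac14$, $a>0$ and $\gamma\ge\alpha+\tfrac12+\epsilon$, and put $\mu(\rho)=\rho^\alpha$, $P(\rho)=a\rho^\gamma$. Let $\bar\rho:\mathbb R\to\mathbb R$ be smooth and monotone with $\bar\rho(x)=\rho_-$ for $x\le -1$ and $\bar\rho(x)=\rho_+$ for $x\ge 1$, where $\rho_\pm>0$. Let the initial data satisfy $$0<\alpha_0\le\rho_0\le\beta_0<\infty,\qquad \rho_0-\bar\rho\in H^1(\mathbb R),\qquad u_0\in H^1(\mathbb R),\qquad \partial_x\rho_0\in L^\infty(\mathbb R)$$ for some constants $\alpha_0,\beta_0$. For $T_0>0$, a strong solution on $(0,T_0)$ is a pair $(\rho,u)$ (identified with its continuous representative on $[0,T_0)\times\mathbb R$) such that $(\rho,u)|_{t=0}=(\rho_0,u_0)$, $$\begin{cases}\partial_t\rho+\partial_x(\rho u)=0,\\ \partial_t(\rho u)+\partial_x(\rho u^2)-\partial_x(\mu(\rho)\partial_xu)+\partial_xP(\rho)=0\end{cases}\quad\text{in }\mathcal D'((0,T_0)\times\mathbb R),$$ and, for every $T_1\in(0,T_0)$: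 $\rho-\bar\rho,\,u\in L^\infty(0,T_1;H^1(\mathbb R))$; $u\in L^2(0,T_1;H^2(\mathbb R))$; $\partial_t\rho,\,\partial_tu\in L^2((0,T_1)\times\mathbb R)$; and there are constants $0<m\le M<\infty$, possibly depending on $T_1$ and on the solution, with $m\le\rho\le M$ on $(0,T_1)\times\mathbb R$. Let $\varphi$ satisfy $\varphi'(r)=\mu(r)/r^2$ for $r>0$. Then there is a continuous function $C$ of time, depending only on $\alpha,\gamma,\epsilon,a,\bar\rho,\varphi,\rho_0,u_0$ (in particular neither on $T_0$ nor on the solution), such that for every $T_0>0$ and every strong solution $(\rho,u)$ on $(0,T_0)$ the effective velocity $v=u+\partial_x\varphi(\rho)$ (with $\partial_x$ the weak derivative, which exists) satisfies $$\|v\|_{L^\infty((0,T)\times\mathbb R)}\le C(T)\qquad\text{for all }T\in(0,T_0).$$ -/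

import Mathlib

open MeasureTheory Set
open scoped ContDiff ENNReal NNReal

noncomputable section

namespace DegenerateNS

/-- `g` is the weak derivative of `f` on `ℝ`. -/
def HasWeakDeriv (f g : ℝ → ℝ) : Prop :=
  LocallyIntegrable f ∧ LocallyIntegrable g ∧
    ∀ ψ : ℝ → ℝ, ContDiff ℝ ∞ ψ → HasCompactSupport ψ →
      ∫ x, f x * deriv ψ x = -∫ x, g x * ψ x

/-- `f ∈ H¹(ℝ)`. -/
def MemH1 (f : ℝ → ℝ) : Prop :=
  MemLp f 2 ∧ ∃ g, HasWeakDeriv f g ∧ MemLp g 2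

/-- The space-time strip `(0, T) × ℝ`; points are written `(t, x)`. -/
def strip (T : ℝ) : Set (ℝ × ℝ) := Ioo 0 T ×ˢ univ

/-- Test functions: smooth with compact support inside the strip `(0, T) × ℝ`. -/
def IsTest (T : ℝ) (ψ : ℝ × ℝ → ℝ) : Prop :=
  ContDiff ℝ ∞ ψ ∧ HasCompactSupport ψ ∧ tsupport ψ ⊆ strip T

/-- Partial derivative in time of a test function. -/
def dt (ψ : ℝ × ℝ → ℝ) (z : ℝ × ℝ) : ℝ := fderiv ℝ ψ z (1, 0)

/-- Partial derivative in space of a test function. -/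
def dx (ψ : ℝ × ℝ → ℝ) (z : ℝ × ℝ) : ℝ := fderiv ℝ ψ z (0, 1)

/-- `g` is a measurable function on `(0, T) × ℝ` with `g(t, ·) = ∂ₓ f(t, ·)` weakly for a.e. `t`. -/
def IsWeakDx (T : ℝ) (f g : ℝ → ℝ → ℝ) : Prop :=
  AEStronglyMeasurable (Function.uncurry g) (volume.restrict (strip T)) ∧
    ∀ᵐ t ∂(volume.restrict (Ioo 0 T)), HasWeakDeriv (f t) (g t)

/-- `f ∈ L^∞(0, T₁; H¹(ℝ))` for every `T₁ < T₀`. -/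
def MemLinftyH1 (T₀ : ℝ) (f : ℝ → ℝ → ℝ) : Prop :=
  AEStronglyMeasurable (Function.uncurry f) (volume.restrict (strip T₀)) ∧
    ∃ g, IsWeakDx T₀ f g ∧ ∀ T₁ ∈ Ioo 0 T₀, ∃ M : ℝ≥0,
      ∀ᵐ t ∂(volume.restrict (Ioo 0 T₁)), eLpNorm (f t) 2 ≤ M ∧ eLpNorm (g t) 2 ≤ M

/-- `f ∈ L²(0, T₁; H²(ℝ))` for every `T₁ < T₀`. -/
def MemL2H2 (T₀ : ℝ) (f : ℝ → ℝ → ℝ) : Prop :=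
  ∃ g h, IsWeakDx T₀ f g ∧ IsWeakDx T₀ g h ∧ ∀ T₁ ∈ Ioo 0 T₀,
    MemLp (Function.uncurry f) 2 (volume.restrict (strip T₁)) ∧
    MemLp (Function.uncurry g) 2 (volume.restrict (strip T₁)) ∧
    MemLp (Function.uncurry h) 2 (volume.restrict (strip T₁))

/-- The weak time derivative of `f` exists and lies in `L²((0, T₁) × ℝ)` for every `T₁ < T₀`. -/
def HasL2TimeDeriv (T₀ : ℝ) (f : ℝ → ℝ → ℝ) : Prop :=
  ∃ g : ℝ → ℝ → ℝ,
    (∀ T₁ ∈ Ioo 0 T₀, MemLp (Function.uncurry g) 2 (volume.restrict (strip T₁))) ∧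
    ∀ ψ, IsTest T₀ ψ →
      ∫ z in strip T₀, f z.1 z.2 * dt ψ z = -∫ z in strip T₀, g z.1 z.2 * ψ z

/-- Background density: smooth, monotone, positive, constant on `x ≤ -1` and on `1 ≤ x`. -/
structure IsBackground (rbar : ℝ → ℝ) (rminus rplus : ℝ) : Prop where
  minus_pos : 0 < rminus
  plus_pos : 0 < rplus
  smooth : ContDiff ℝ ∞ rbar
  mono : Monotone rbar ∨ Antitone rbar
  left : ∀ x ≤ -1, rbar x = rminus
  right : ∀ x, 1 ≤ x → rbar x = rplus

/-- Admissible initial data relative to the background density `rbar`. -/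
structure IsInitialData (rbar ρ₀ u₀ : ℝ → ℝ) : Prop where
  bounds : ∃ m M : ℝ, 0 < m ∧ ∀ᵐ x, m ≤ ρ₀ x ∧ ρ₀ x ≤ M
  density : MemH1 (fun x => ρ₀ x - rbar x)
  velocity : MemH1 u₀
  lipschitz : ∃ g, HasWeakDeriv ρ₀ g ∧ MemLp g ∞

/-- Viscosity law `μ(r) = r ^ α`. -/
def visc (α r : ℝ) : ℝ := r ^ α

/-- Pressure law `P(r) = a r ^ γ`. -/
def pressure (a γ r : ℝ) : ℝ := a * r ^ γ

/-- `(ρ, u)` is a strong solution on `(0, T₀) × ℝ` of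
`∂ₜρ + ∂ₓ(ρu) = 0`, `∂ₜ(ρu) + ∂ₓ(ρu²) - ∂ₓ(μ(ρ) ∂ₓu) + ∂ₓP(ρ) = 0`
with initial data `(ρ₀, u₀)`. The regularity class embeds into the continuous functions on
`[0, T₀) × ℝ`, and `ρ`, `u` denote the continuous representatives. The equations hold in the sense
of distributions, hence almost everywhere in this class. -/
structure IsStrongSolution (a α γ : ℝ) (rbar ρ₀ u₀ : ℝ → ℝ) (T₀ : ℝ) (ρ u : ℝ → ℝ → ℝ) :
    Prop where
  continuous_density : ContinuousOn (Function.uncurry ρ) (Ico 0 T₀ ×ˢ univ)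
  continuous_velocity : ContinuousOn (Function.uncurry u) (Ico 0 T₀ ×ˢ univ)
  initial : ∀ᵐ x, ρ 0 x = ρ₀ x ∧ u 0 x = u₀ x
  bounds : ∀ T₁ ∈ Ioo 0 T₀, ∃ m M : ℝ, 0 < m ∧
    ∀ t ∈ Ioo 0 T₁, ∀ x, m ≤ ρ t x ∧ ρ t x ≤ M
  density_H1 : MemLinftyH1 T₀ (fun t x => ρ t x - rbar x)
  velocity_H1 : MemLinftyH1 T₀ u
  velocity_H2 : MemL2H2 T₀ u
  density_dt : HasL2TimeDeriv T₀ ρ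
  velocity_dt : HasL2TimeDeriv T₀ u
  mass : ∀ ψ, IsTest T₀ ψ →
    ∫ z in strip T₀, (ρ z.1 z.2 * dt ψ z + ρ z.1 z.2 * u z.1 z.2 * dx ψ z) = 0
  momentum : ∃ ux, IsWeakDx T₀ u ux ∧ ∀ ψ, IsTest T₀ ψ →
    ∫ z in strip T₀, (ρ z.1 z.2 * u z.1 z.2 * dt ψ z +
      (ρ z.1 z.2 * u z.1 z.2 ^ 2 - visc α (ρ z.1 z.2) * ux z.1 z.2 +
        pressure a γ (ρ z.1 z.2)) * dx ψ z) = 0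

/-- `v = u + ∂ₓ φ(ρ)` on `(0, T₀) × ℝ`. -/
def IsEffectiveVelocity (φ : ℝ → ℝ) (T₀ : ℝ) (ρ u v : ℝ → ℝ → ℝ) : Prop :=
  ∃ w, IsWeakDx T₀ (fun t x => φ (ρ t x)) w ∧
    ∀ᵐ z ∂(volume.restrict (strip T₀)), v z.1 z.2 = u z.1 z.2 + w z.1 z.2

end DegenerateNS

end

namespace DegenerateNS

open Filter Topology

/-! ### Absolutely continuous functions with a prescribed derivative -/

/-- `f` is absolutely continuous on `[a, b]` and has derivative `g` almost everywhere there. -/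
structure HasACDeriv (f g : ℝ → ℝ) (a b : ℝ) : Prop where
  ac : AbsolutelyContinuousOnInterval f a b
  ae : ∀ᵐ x, x ∈ uIoo a b → HasDerivAt f (g x) x

lemma ae_ne_real (a : ℝ) : ∀ᵐ x : ℝ, x ≠ a := by simp [ae_iff, measure_singleton]

lemma ae_mem_uIoo_of_mem_uIoc (a b : ℝ) : ∀ᵐ x : ℝ, x ∈ uIoc a b → x ∈ uIoo a b := by
  filter_upwards [ae_ne_real (max a b)] with x hx h
  exact ⟨h.1, lt_of_le_of_ne h.2 hx⟩

namespace HasACDeriv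

variable {f g f₁ f₂ g₁ g₂ : ℝ → ℝ} {a b c d : ℝ}

lemma deriv_ae (h : HasACDeriv f g a b) : ∀ᵐ x, x ∈ uIoc a b → deriv f x = g x := by
  filter_upwards [h.ae, ae_mem_uIoo_of_mem_uIoc a b] with x hx hm hx'
  exact (hx (hm hx')).deriv

lemma intervalIntegrable (h : HasACDeriv f g a b) : IntervalIntegrable g volume a b :=
  h.ac.intervalIntegrable_deriv.congr_ae <|
    (ae_restrict_iff' measurableSet_uIoc).2 h.deriv_ae

lemma integral_eq_sub (h : HasACDeriv f g a b) : ∫ x in a..b, g x = f b - f a := by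
  rw [← h.ac.integral_deriv_eq_sub]
  refine intervalIntegral.integral_congr_ae ?_
  filter_upwards [h.deriv_ae] with x hx hm using (hx hm).symm

lemma continuousOn (h : HasACDeriv f g a b) : ContinuousOn f (uIcc a b) := h.ac.continuousOn

lemma mono (h : HasACDeriv f g a b) (hcd : uIcc c d ⊆ uIcc a b) : HasACDeriv f g c d := by
  refine ⟨h.ac.mono hcd, ?_⟩
  filter_upwards [h.ae, ae_ne_real (min a b), ae_ne_real (max a b)] with x hx h1 h2 hm
  have := hcd (uIoo_subset_uIcc_self hm)
  exact hx ⟨lt_of_le_of_ne this.1 h1.symm, lt_of_le_of_ne this.2 h2⟩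

lemma of_integral (hg : IntervalIntegrable g volume a b)
    (hf : ∀ x ∈ uIcc a b, f x - f a = ∫ t in a..x, g t) : HasACDeriv f g a b := by
  have hac := hg.absolutelyContinuousOnInterval_intervalIntegral (c := a) (by simp)
  have heq : ∀ x ∈ uIcc a b, f x = (∫ t in a..x, g t) + f a := fun x hx => by
    rw [← hf x hx]; ring
  constructor
  · have hc : AbsolutelyContinuousOnInterval (fun _ : ℝ => f a) a b :=
      (contDiff_const.contDiffOn).absolutelyContinuousOnInterval
    have h2 := hac.add hc
    rw [absolutelyContinuousOnInterval_iff] at h2 ⊢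
    intro ε hε
    obtain ⟨δ, hδ, h⟩ := h2 ε hε
    refine ⟨δ, hδ, fun E hE hl => ?_⟩
    refine lt_of_eq_of_lt (Finset.sum_congr rfl fun i hi => ?_) (h E hE hl)
    rw [heq _ (hE.1 i hi).1, heq _ (hE.1 i hi).2]
    rfl
  · filter_upwards [hg.ae_hasDerivAt_integral] with x hx hm
    have h1 := (hx (uIoo_subset_uIcc_self hm) a (by simp)).add_const (f a)
    refine h1.congr_of_eventuallyEq ?_
    filter_upwards [(isOpen_Ioo.mem_nhds hm : uIoo a b ∈ 𝓝 x)] with y hy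
    exact heq y (uIoo_subset_uIcc_self hy)

lemma add (h₁ : HasACDeriv f₁ g₁ a b) (h₂ : HasACDeriv f₂ g₂ a b) :
    HasACDeriv (fun x => f₁ x + f₂ x) (fun x => g₁ x + g₂ x) a b := by
  refine ⟨h₁.ac.add h₂.ac, ?_⟩
  filter_upwards [h₁.ae, h₂.ae] with x hx₁ hx₂ hm using (hx₁ hm).add (hx₂ hm)

lemma sub (h₁ : HasACDeriv f₁ g₁ a b) (h₂ : HasACDeriv f₂ g₂ a b) :
    HasACDeriv (fun x => f₁ x - f₂ x) (fun x => g₁ x - g₂ x) a b := by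
  refine ⟨h₁.ac.sub h₂.ac, ?_⟩
  filter_upwards [h₁.ae, h₂.ae] with x hx₁ hx₂ hm using (hx₁ hm).sub (hx₂ hm)

lemma mul (h₁ : HasACDeriv f₁ g₁ a b) (h₂ : HasACDeriv f₂ g₂ a b) :
    HasACDeriv (fun x => f₁ x * f₂ x) (fun x => g₁ x * f₂ x + f₁ x * g₂ x) a b := by
  refine ⟨h₁.ac.mul h₂.ac, ?_⟩
  filter_upwards [h₁.ae, h₂.ae] with x hx₁ hx₂ hm using (hx₁ hm).mul (hx₂ hm)

lemma of_hasDerivAt (h : ∀ x, HasDerivAt f (g x) x) (hg : Continuous g) :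
    HasACDeriv f g a b := by
  refine ⟨?_, ae_of_all _ fun x _ => h x⟩
  have hd : deriv f = g := funext fun x => (h x).deriv
  have : ContDiff ℝ 1 f := contDiff_one_iff_deriv.2 ⟨fun x => (h x).differentiableAt, hd ▸ hg⟩
  exact this.contDiffOn.absolutelyContinuousOnInterval

lemma const_mul (k : ℝ) (h : HasACDeriv f g a b) :
    HasACDeriv (fun x => k * f x) (fun x => k * g x) a b := by
  refine ⟨h.ac.const_mul k, ?_⟩
  filter_upwards [h.ae] with x hx hm using (hx hm).const_mul k

lemma comp {Φ Φ' : ℝ → ℝ} {m M : ℝ} (h : HasACDeriv f g a b)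
    (hΦ : ∀ r ∈ Icc m M, HasDerivAt Φ (Φ' r) r) (hΦ' : ContinuousOn Φ' (Icc m M))
    (hf : ∀ x ∈ uIcc a b, f x ∈ Icc m M) :
    HasACDeriv (fun x => Φ (f x)) (fun x => Φ' (f x) * g x) a b := by
  obtain ⟨C, hC⟩ := isCompact_Icc.exists_bound_of_continuousOn hΦ'
  have hlip : LipschitzOnWith (Real.toNNReal C) Φ (Icc m M) := by
    refine (convex_Icc m M).lipschitzOnWith_of_nnnorm_hasDerivWithin_le
      (fun r hr => (hΦ r hr).hasDerivWithinAt) fun r hr => ?_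
    rw [← NNReal.coe_le_coe, coe_nnnorm]
    exact (hC r hr).trans (Real.le_coe_toNNReal C)
  constructor
  · refine squeeze_zero' (Eventually.of_forall fun _ => Finset.sum_nonneg fun _ _ => dist_nonneg)
      ?_ (by simpa using Tendsto.const_mul (Real.toNNReal C : ℝ) h.ac)
    filter_upwards [mem_inf_of_right (mem_principal_self _)] with E hE
    rw [Finset.mul_sum]
    exact Finset.sum_le_sum fun i hi =>
      hlip.dist_le_mul _ (hf _ (hE.1 i hi).1) _ (hf _ (hE.1 i hi).2)
  · filter_upwards [h.ae] with x hx hm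
    exact (hΦ _ (hf x (uIoo_subset_uIcc_self hm))).comp x (hx hm)

lemma congr_right {g' : ℝ → ℝ} (h : HasACDeriv f g a b)
    (hg : ∀ᵐ x, x ∈ uIoo a b → g x = g' x) : HasACDeriv f g' a b := by
  refine ⟨h.ac, ?_⟩
  filter_upwards [h.ae, hg] with x hx hx' hm using hx' hm ▸ hx hm

end HasACDeriv

/-- On the whole line, an integrable absolutely continuous function with integrable derivative
has derivative of integral zero. -/
lemma integral_eq_zero_of_hasACDeriv {f g : ℝ → ℝ} (h : ∀ a b, HasACDeriv f g a b)
    (hf : Integrable f) (hg : Integrable g) : ∫ x, g x = 0 := by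
  have key : ∀ x, f x = f 0 + ∫ t in (0 : ℝ)..x, g t := fun x => by
    rw [(h 0 x).integral_eq_sub]; ring
  have htop : Tendsto f atTop (𝓝 (f 0 + ∫ t in Ioi (0 : ℝ), g t)) := by
    exact ((intervalIntegral_tendsto_integral_Ioi 0 hg.integrableOn tendsto_id).const_add
      (f 0)).congr fun x => (key x).symm
  have hbot : Tendsto f atBot (𝓝 (f 0 - ∫ t in Iic (0 : ℝ), g t)) := by
    have := (intervalIntegral_tendsto_integral_Iic 0 hg.integrableOn tendsto_id).const_sub (f 0)
    refine this.congr fun x => ?_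
    rw [key x, id, intervalIntegral.integral_symm 0 x]; simp
  have h1 : f 0 + ∫ t in Ioi (0 : ℝ), g t = 0 := by
    by_contra hne
    have h2 : ∀ᶠ x in atTop, |f 0 + ∫ t in Ioi (0 : ℝ), g t| / 2 < ‖f x‖ :=
      htop.norm.eventually_const_lt (by rw [Real.norm_eq_abs]; linarith [abs_pos.2 hne])
    obtain ⟨R, hR⟩ := eventually_atTop.1 h2
    have hlt : ∫⁻ x in Ioi R, ‖f x‖ₑ < ⊤ := hf.integrableOn.2
    have hle : ∫⁻ _ in Ioi R, ENNReal.ofReal (|f 0 + ∫ t in Ioi (0 : ℝ), g t| / 2)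
        ≤ ∫⁻ x in Ioi R, ‖f x‖ₑ := by
      refine setLIntegral_mono' measurableSet_Ioi fun x hx => ?_
      rw [← ofReal_norm]
      exact ENNReal.ofReal_le_ofReal (hR x (le_of_lt hx)).le
    rw [setLIntegral_const, Real.volume_Ioi, ENNReal.mul_top] at hle
    · exact absurd hlt (not_lt.2 hle)
    · simpa using hne
  have h2 : f 0 - ∫ t in Iic (0 : ℝ), g t = 0 := by
    by_contra hne
    have h2 : ∀ᶠ x in atBot, |f 0 - ∫ t in Iic (0 : ℝ), g t| / 2 < ‖f x‖ :=
      hbot.norm.eventually_const_lt (by rw [Real.norm_eq_abs]; linarith [abs_pos.2 hne])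
    obtain ⟨R, hR⟩ := eventually_atBot.1 h2
    have hlt : ∫⁻ x in Iio R, ‖f x‖ₑ < ⊤ := hf.integrableOn.2
    have hle : ∫⁻ _ in Iio R, ENNReal.ofReal (|f 0 - ∫ t in Iic (0 : ℝ), g t| / 2)
        ≤ ∫⁻ x in Iio R, ‖f x‖ₑ := by
      refine setLIntegral_mono' measurableSet_Iio fun x hx => ?_
      rw [← ofReal_norm]
      exact ENNReal.ofReal_le_ofReal (hR x (le_of_lt hx)).le
    rw [setLIntegral_const, Real.volume_Iio, ENNReal.mul_top] at hle
    · exact absurd hlt (not_lt.2 hle)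
    · simpa using hne
  rw [← intervalIntegral.integral_Iic_add_Ioi (b := 0) hg.integrableOn hg.integrableOn]
  linarith

/-- An integrable absolutely continuous function with integrable derivative is bounded by the
`L¹` norm of its derivative. -/
lemma abs_le_integral_of_hasACDeriv {f g : ℝ → ℝ} (h : ∀ a b, HasACDeriv f g a b)
    (hf : Integrable f) (hg : Integrable g) (x : ℝ) : |f x| ≤ ∫ y, |g y| := by
  by_contra hlt
  push Not at hlt
  set δ := |f x| - ∫ y, |g y| with hδ
  have hδ0 : 0 < δ := by linarith
  have hb : ∀ y, δ ≤ ‖f y‖ := fun y => by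
    have h1 : |f x - f y| ≤ ∫ y, |g y| := by
      rw [← (h y x).integral_eq_sub]
      refine (intervalIntegral.norm_integral_le_integral_norm_uIoc (f := g)).trans ?_
      exact setIntegral_le_integral hg.abs (ae_of_all _ fun _ => abs_nonneg _)
    have h2 := abs_sub_abs_le_abs_sub (f x) (f y)
    rw [Real.norm_eq_abs]; linarith
  have hc : Integrable (fun _ : ℝ => δ) := hf.mono aestronglyMeasurable_const
    (ae_of_all _ fun y => by rw [Real.norm_of_nonneg hδ0.le]; exact hb y)
  rw [integrable_const_iff] at hc
  rcases hc with h0 | h0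
  · exact hδ0.ne' h0
  · have := h0.measure_univ_lt_top
    simp at this

/-! ### Weak derivatives of continuous functions -/

lemma exists_Icc_of_isCompact_subset {K I : Set ℝ} (hI : I.Nonempty) (hK : IsCompact K)
    (hs : K ⊆ I) : ∃ c ∈ I, ∃ d ∈ I, c ≤ d ∧ K ⊆ Icc c d := by
  rcases K.eq_empty_or_nonempty with rfl | hne
  · obtain ⟨x, hx⟩ := hI
    exact ⟨x, hx, x, hx, le_rfl, by simp⟩
  · obtain ⟨c, hc, hc'⟩ := hK.exists_isLeast hne
    obtain ⟨d, hd, hd'⟩ := hK.exists_isGreatest hne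
    exact ⟨c, hs hc, d, hs hd, hc' hd, fun x hx => ⟨hc' hx, hd' hx⟩⟩

lemma exists_test_primitive {I : Set ℝ} (hI : I.Nonempty) (hoc : I.OrdConnected) {w : ℝ → ℝ} (hw : ContDiff ℝ ∞ w)
    (hc : HasCompactSupport w) (hs : tsupport w ⊆ I) (h0 : ∫ x, w x = 0) :
    ∃ Ψ : ℝ → ℝ, ContDiff ℝ ∞ Ψ ∧ HasCompactSupport Ψ ∧ tsupport Ψ ⊆ I ∧ deriv Ψ = w := by
  obtain ⟨c, hcI, d, hdI, hcd, hsub⟩ := exists_Icc_of_isCompact_subset hI hc hs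
  have hz : ∀ x, x ∉ Icc c d → w x = 0 := fun x hx =>
    image_eq_zero_of_notMem_tsupport fun h => hx (hsub h)
  have hder : ∀ x, HasDerivAt (fun x => ∫ t in c..x, w t) (w x) x := fun x =>
    intervalIntegral.integral_hasDerivAt_right (hw.continuous.intervalIntegrable _ _)
      (hw.continuous.stronglyMeasurableAtFilter _ _) hw.continuous.continuousAt
  have hd : deriv (fun x => ∫ t in c..x, w t) = w := funext fun x => (hder x).deriv
  have hcd0 : ∫ t in c..d, w t = 0 := by
    rw [intervalIntegral.integral_of_le hcd, ← integral_Icc_eq_integral_Ioc,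
      setIntegral_eq_integral_of_forall_compl_eq_zero hz, h0]
  have hsupp : Function.support (fun x => ∫ t in c..x, w t) ⊆ Icc c d := by
    intro x hx
    by_contra hx'
    refine hx ?_
    rcases lt_or_ge x c with h | h
    · refine intervalIntegral.integral_zero_ae ?_
      filter_upwards [ae_ne_real c] with t htc ht
      rw [uIoc_of_ge h.le] at ht
      exact hz t fun h' => htc (le_antisymm ht.2 h'.1)
    · have hdx : d < x := by
        by_contra hle
        exact hx' ⟨h, not_lt.1 hle⟩
      have := intervalIntegral.integral_add_adjacent_intervals
        (hw.continuous.intervalIntegrable (μ := volume) c d)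
        (hw.continuous.intervalIntegrable (μ := volume) d x)
      change ∫ t in c..x, w t = 0
      rw [← this, hcd0, zero_add]
      refine intervalIntegral.integral_zero_ae (ae_of_all _ fun t ht => ?_)
      rw [uIoc_of_le hdx.le] at ht
      exact hz t fun h' => absurd h'.2 (not_le.2 ht.1)
  have hts : tsupport (fun x => ∫ t in c..x, w t) ⊆ Icc c d :=
    closure_minimal hsupp isClosed_Icc
  refine ⟨_, ?_, ?_, hts.trans (hoc.out hcI hdI), hd⟩
  · rw [contDiff_infty_iff_deriv]
    refine ⟨fun x => (hder x).differentiableAt, ?_⟩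
    rwa [hd]
  · exact isCompact_Icc.of_isClosed_subset (isClosed_tsupport _) hts

lemma intervalIntegrable_of_locallyIntegrableOn {g : ℝ → ℝ} {I : Set ℝ} {c d : ℝ}
    (hoc : I.OrdConnected) (hg : LocallyIntegrableOn g I) (hc : c ∈ I) (hd : d ∈ I) :
    IntervalIntegrable g volume c d := by
  rw [intervalIntegrable_iff]
  exact (hg.integrableOn_compact_subset (hoc.uIcc_subset hc hd)
    isCompact_uIcc).mono_set uIoc_subset_uIcc

/-- A locally integrable function with a locally integrable weak derivative on an open interval
agrees almost everywhere with a primitive of that weak derivative. -/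
theorem exists_ae_eq_integral_of_weakDeriv {I : Set ℝ} (hI : IsOpen I) (hoc : I.OrdConnected)
    {f g : ℝ → ℝ} (hf : LocallyIntegrableOn f I) (hg : LocallyIntegrableOn g I)
    (h : ∀ ψ : ℝ → ℝ, ContDiff ℝ ∞ ψ → HasCompactSupport ψ → tsupport ψ ⊆ I →
      ∫ x, f x * deriv ψ x = -∫ x, g x * ψ x) :
    ∀ x₀ ∈ I, ∃ c, ∀ᵐ x, x ∈ I → f x = c + ∫ t in x₀..x, g t := by
  intro x₀ hx₀
  set G : ℝ → ℝ := fun t => ∫ s in x₀..t, g s with hG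
  have hGac : ∀ c ∈ I, ∀ d ∈ I, HasACDeriv G g c d := fun c hc d hd =>
    HasACDeriv.of_integral (intervalIntegrable_of_locallyIntegrableOn hoc hg hc hd)
      fun x hx => by
        have hx' := hoc.uIcc_subset hc hd hx
        exact intervalIntegral.integral_interval_sub_left
          (intervalIntegrable_of_locallyIntegrableOn hoc hg hx₀ hx')
          (intervalIntegrable_of_locallyIntegrableOn hoc hg hx₀ hc)
  have hGc : ContinuousOn G (I) := fun x hx => by
    obtain ⟨c, d, hcd, hsub⟩ := mem_nhds_iff_exists_Ioo_subset.1 (hI.mem_nhds hx)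
    obtain ⟨c', hc, hcx⟩ := exists_between hcd.1
    obtain ⟨d', hxd, hd⟩ := exists_between hcd.2
    have := (hGac c' (hsub ⟨hc, hcx.trans hcd.2⟩) d' (hsub ⟨hcd.1.trans hxd, hd⟩)).continuousOn
    rw [uIcc_of_le (hcx.trans hxd).le] at this
    exact (this.continuousAt (Icc_mem_nhds hcx hxd)).continuousWithinAt
  have hGi : LocallyIntegrableOn G I := hGc.locallyIntegrableOn hI.measurableSet
  have hmul : ∀ {k ψ : ℝ → ℝ}, LocallyIntegrableOn k (I) → Continuous ψ →
      HasCompactSupport ψ → tsupport ψ ⊆ I → Integrable fun x => k x * ψ x := by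
    intro k ψ hk hψ hψc hψs
    have h1 : IntegrableOn (fun x => k x * ψ x) (tsupport ψ) :=
      (hk.integrableOn_compact_subset hψs hψc).mul_continuousOn hψ.continuousOn hψc
    exact (integrableOn_iff_integrable_of_support_subset fun x hx =>
      subset_tsupport ψ fun h0 => hx (by simp [h0])).1 h1
  -- integration by parts against the primitive
  have hibp : ∀ ψ : ℝ → ℝ, ContDiff ℝ ∞ ψ → HasCompactSupport ψ → tsupport ψ ⊆ I →
      ∫ x, G x * deriv ψ x = -∫ x, g x * ψ x := by
    intro ψ hψ hψc hψs
    obtain ⟨c, hcI, d, hdI, hcd, hsub⟩ := exists_Icc_of_isCompact_subset ⟨x₀, hx₀⟩ hψc hψs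
    obtain ⟨c₁, c₂, hc₁, hc₂⟩ := mem_nhds_iff_exists_Ioo_subset.1 (hI.mem_nhds hcI)
    obtain ⟨d₁, d₂, hd₁, hd₂⟩ := mem_nhds_iff_exists_Ioo_subset.1 (hI.mem_nhds hdI)
    obtain ⟨c', hc', hcc'⟩ := exists_between hc₁.1
    obtain ⟨d', hdd', hd'⟩ := exists_between hd₁.2
    have hle : c' ≤ d' := by linarith
    have hz : ∀ x, x ∉ Ioo c' d' → x ∉ tsupport ψ := fun x hx h' =>
      hx ⟨hcc'.trans_le (hsub h').1, (hsub h').2.trans_lt hdd'⟩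
    have hψ' : ContDiff ℝ ∞ (deriv ψ) := (contDiff_infty_iff_deriv.1 hψ).2
    have hp := (hGac c' (hc₂ ⟨hc', hcc'.trans hc₁.2⟩) d' (hd₂ ⟨hd₁.1.trans hdd', hd'⟩)).mul
      (HasACDeriv.of_hasDerivAt (a := c') (b := d')
        (fun x => (hψ.differentiable (by simp) x).hasDerivAt) hψ'.continuous)
    have h1 := hp.integral_eq_sub
    rw [image_eq_zero_of_notMem_tsupport (hz c' (by simp)),
      image_eq_zero_of_notMem_tsupport (hz d' (by simp)), mul_zero, mul_zero, sub_zero,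
      intervalIntegral.integral_of_le hle, integral_Ioc_eq_integral_Ioo,
      setIntegral_eq_integral_of_forall_compl_eq_zero, integral_add] at h1
    · linarith
    · exact hmul hg hψ.continuous hψc hψs
    · exact hmul hGi hψ'.continuous hψc.deriv
        (tsupport_deriv_subset.trans hψs)
    · intro x hx
      rw [image_eq_zero_of_notMem_tsupport (hz x hx), image_eq_zero_of_notMem_tsupport
        fun h' => hz x hx (tsupport_deriv_subset h')]
      ring
  have hH0 : ∀ ψ : ℝ → ℝ, ContDiff ℝ ∞ ψ → HasCompactSupport ψ → tsupport ψ ⊆ I →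
      ∫ x, (f x - G x) * deriv ψ x = 0 := by
    intro ψ hψ hψc hψs
    have hψ' : ContDiff ℝ ∞ (deriv ψ) := (contDiff_infty_iff_deriv.1 hψ).2
    have hs' := (tsupport_deriv_subset (f := ψ)).trans hψs
    simp_rw [sub_mul]
    rw [integral_sub (hmul hf hψ'.continuous hψc.deriv hs')
      (hmul hGi hψ'.continuous hψc.deriv hs'),
      h ψ hψ hψc hψs, hibp ψ hψ hψc hψs, sub_self]
  obtain ⟨r, hr, hball⟩ := Metric.isOpen_iff.1 hI x₀ hx₀
  let η₀ : ContDiffBump x₀ := ⟨r / 4, r / 2, by linarith, by linarith⟩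
  let η : ℝ → ℝ := η₀.normed volume
  have hη : ContDiff ℝ ∞ η := η₀.contDiff_normed
  have hηc : HasCompactSupport η := η₀.hasCompactSupport_normed
  have hηs : tsupport η ⊆ I := by
    rw [η₀.tsupport_normed_eq]
    exact (Metric.closedBall_subset_ball (by simp only [η₀]; linarith)).trans hball
  have hη1 : ∫ x, η x = 1 := η₀.integral_normed
  set c := ∫ x, (f x - G x) * η x with hcdef
  have hHi : LocallyIntegrableOn (fun t => f t - G t) (I) :=
    hf.sub hGi
  have hae : ∀ᵐ x, x ∈ I → f x - G x - c = 0 := by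
    refine hI.ae_eq_zero_of_integral_contDiff_smul_eq_zero
      (hHi.sub (continuousOn_const.locallyIntegrableOn hI.measurableSet)) fun ψ hψ hψc hψs => ?_
    set k := ∫ x, ψ x with hk
    have hwc : ContDiff ℝ ∞ (fun x => ψ x - k * η x) := hψ.sub (contDiff_const.mul hη)
    have hcs : HasCompactSupport (fun x => ψ x - k * η x) :=
      hψc.sub (hηc.mul_left (f := fun _ => k))
    have hss : tsupport (fun x => ψ x - k * η x) ⊆ I := by
      refine (tsupport_sub _ _).trans (union_subset hψs ?_)
      refine (closure_mono ?_).trans hηs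
      intro x hx h0
      exact hx (by simp only [h0, mul_zero])
    have h0 : ∫ x, (ψ x - k * η x) = 0 := by
      rw [integral_sub (hψ.continuous.integrable_of_hasCompactSupport hψc)
        ((hη.continuous.integrable_of_hasCompactSupport hηc).const_mul k),
        integral_const_mul, hη1, mul_one, sub_self]
    obtain ⟨Ψ, h1, h2, h3, h4⟩ := exists_test_primitive ⟨x₀, hx₀⟩ hoc hwc hcs hss h0
    have h5 := hH0 Ψ h1 h2 h3
    rw [h4] at h5
    have e1 : ∀ x, (f x - G x) * (ψ x - k * η x) =
        (f x - G x) * ψ x - k * ((f x - G x) * η x) := fun x => by ring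
    simp_rw [e1] at h5
    have i1 := hmul hHi hψ.continuous hψc hψs
    rw [integral_sub i1 ((hmul hHi hη.continuous hηc hηs).const_mul k), integral_const_mul,
      ← hcdef] at h5
    have e2 : ∀ x, ψ x • (f x - G x - c) = (f x - G x) * ψ x - c * ψ x := fun x => by
      rw [smul_eq_mul]; ring
    simp_rw [e2]
    rw [integral_sub i1 ((hψ.continuous.integrable_of_hasCompactSupport hψc).const_mul c),
      integral_const_mul, ← hk]
    linarith
  refine ⟨c, ?_⟩
  filter_upwards [hae] with x hx hxI
  linarith [hx hxI]

/-- A continuous function with a locally integrable weak derivative on an open interval is a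
primitive of that weak derivative. -/
theorem sub_eq_integral_of_weakDeriv {I : Set ℝ} (hI : IsOpen I) (hoc : I.OrdConnected)
    {f g : ℝ → ℝ} (hf : ContinuousOn f I) (hg : LocallyIntegrableOn g I)
    (h : ∀ ψ : ℝ → ℝ, ContDiff ℝ ∞ ψ → HasCompactSupport ψ → tsupport ψ ⊆ I →
      ∫ x, f x * deriv ψ x = -∫ x, g x * ψ x) {x y : ℝ} (hx : x ∈ I) (hy : y ∈ I) :
    f y - f x = ∫ t in x..y, g t := by
  obtain ⟨c, hc⟩ := exists_ae_eq_integral_of_weakDeriv hI hoc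
    (hf.locallyIntegrableOn hI.measurableSet) hg h x hx
  have hGc : ContinuousOn (fun z => c + ∫ t in x..z, g t) I := fun z hz => by
    obtain ⟨p, q, hpq, hsub⟩ := mem_nhds_iff_exists_Ioo_subset.1 (hI.mem_nhds hz)
    obtain ⟨p', hp, hpz⟩ := exists_between hpq.1
    obtain ⟨q', hzq, hq⟩ := exists_between hpq.2
    have hi : IntervalIntegrable g volume (min p' x) (max q' x) := by
      refine intervalIntegrable_of_locallyIntegrableOn hoc hg ?_ ?_
      · rcases min_choice p' x with h | h <;> rw [h]
        exacts [hsub ⟨hp, hpz.trans hpq.2⟩, hx]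
      · rcases max_choice q' x with h | h <;> rw [h]
        exacts [hsub ⟨hpq.1.trans hzq, hq⟩, hx]
    have hmm : min p' x ≤ max q' x := (min_le_right _ _).trans (le_max_right _ _)
    have := intervalIntegral.continuousOn_primitive_interval' hi (a := x)
      (by rw [uIcc_of_le hmm]; exact ⟨min_le_right _ _, le_max_right _ _⟩)
    rw [uIcc_of_le hmm] at this
    exact (continuousAt_const.add (this.continuousAt (Icc_mem_nhds
      ((min_le_left _ _).trans_lt hpz) (hzq.trans_le (le_max_left _ _))))).continuousWithinAt
  have hall : EqOn f (fun z => c + ∫ t in x..z, g t) I :=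
    Measure.eqOn_open_of_ae_eq (μ := volume) ((ae_restrict_iff' hI.measurableSet).2 hc) hI hf hGc
  have e1 := hall hx
  have e2 := hall hy
  simp only [intervalIntegral.integral_same] at e1 e2
  linarith

/-- A continuous function on the line is a primitive of its weak derivative. -/
theorem HasWeakDeriv.sub_eq_integral {f g : ℝ → ℝ} (h : HasWeakDeriv f g) (hf : Continuous f)
    (x y : ℝ) : f y - f x = ∫ t in x..y, g t :=
  sub_eq_integral_of_weakDeriv isOpen_univ ordConnected_univ hf.continuousOn
    (h.2.1.locallyIntegrableOn _) (fun ψ h1 h2 _ => h.2.2 ψ h1 h2) (mem_univ x) (mem_univ y)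

lemma _root_.MeasureTheory.LocallyIntegrable.intervalIntegrable_real {g : ℝ → ℝ}
    (h : LocallyIntegrable g) (a b : ℝ) : IntervalIntegrable g volume a b :=
  intervalIntegrable_iff.2
    ((h.integrableOn_isCompact isCompact_uIcc).mono_set uIoc_subset_uIcc)

theorem HasWeakDeriv.hasACDeriv {f g : ℝ → ℝ} (h : HasWeakDeriv f g) (hf : Continuous f)
    (a b : ℝ) : HasACDeriv f g a b :=
  HasACDeriv.of_integral (h.2.1.intervalIntegrable_real _ _) fun _ _ => h.sub_eq_integral hf _ _

/-- A continuous function whose weak derivative has itself a weak derivative is continuously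
differentiable, and its derivative is absolutely continuous. -/
theorem HasWeakDeriv.deriv_hasACDeriv {f g h : ℝ → ℝ} (hfg : HasWeakDeriv f g)
    (hgh : HasWeakDeriv g h) (hf : Continuous f) :
    (∀ x, HasDerivAt f (deriv f x) x) ∧ Continuous (deriv f) ∧ g =ᵐ[volume] deriv f ∧
      ∀ a b, HasACDeriv (deriv f) h a b := by
  obtain ⟨c, hc⟩ := exists_ae_eq_integral_of_weakDeriv isOpen_univ ordConnected_univ
    (hgh.1.locallyIntegrableOn _) (hgh.2.1.locallyIntegrableOn _)
    (fun ψ h1 h2 _ => hgh.2.2 ψ h1 h2) 0 (mem_univ 0)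
  simp only [mem_univ, true_implies] at hc
  have hh := hgh.2.1.intervalIntegrable_real
  have hcont : Continuous (fun x => c + ∫ t in (0 : ℝ)..x, h t) :=
    continuous_const.add (intervalIntegral.continuous_primitive hh 0)
  have hder : ∀ x, HasDerivAt f (c + ∫ t in (0 : ℝ)..x, h t) x := fun x => by
    have h1 : HasDerivAt (fun x => f 0 + ∫ s in (0 : ℝ)..x, (c + ∫ t in (0 : ℝ)..s, h t))
        (c + ∫ t in (0 : ℝ)..x, h t) x :=
      (intervalIntegral.integral_hasDerivAt_right (hcont.intervalIntegrable _ _)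
        (hcont.stronglyMeasurableAtFilter _ _) hcont.continuousAt).const_add _
    refine h1.congr_of_eventuallyEq (Eventually.of_forall fun y => ?_)
    dsimp only
    rw [← intervalIntegral.integral_congr_ae (hc.mono fun t ht _ => ht),
      ← hfg.sub_eq_integral hf]
    ring
  have hd : deriv f = fun x => c + ∫ t in (0 : ℝ)..x, h t := funext fun x => (hder x).deriv
  refine ⟨fun x => (hder x).differentiableAt.hasDerivAt, hd ▸ hcont, by rw [hd]; exact hc,
    fun a b => HasACDeriv.of_integral (hh a b) fun x _ => ?_⟩
  rw [hd]
  simp only [add_sub_add_left_eq_sub]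
  exact intervalIntegral.integral_interval_sub_left (hh _ _) (hh _ _)

/-- Weak derivatives are unique. -/
theorem HasWeakDeriv.ae_eq {f g₁ g₂ : ℝ → ℝ} (h₁ : HasWeakDeriv f g₁) (h₂ : HasWeakDeriv f g₂) :
    g₁ =ᵐ[volume] g₂ := by
  refine ae_eq_of_integral_contDiff_smul_eq h₁.2.1 h₂.2.1 fun ψ hψ hc => ?_
  simp_rw [smul_eq_mul, mul_comm (ψ _)]
  linarith [h₁.2.2 ψ hψ hc, h₂.2.2 ψ hψ hc]

/-! ### Functions on a space-time strip -/

/-- Lebesgue measure on `(0, T] × ℝ`. -/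
noncomputable abbrev stripMeasure (T : ℝ) : Measure (ℝ × ℝ) := (volume.restrict (Ioc 0 T)).prod volume

lemma volume_restrict_strip (T : ℝ) :
    (volume : Measure (ℝ × ℝ)).restrict (strip T) = stripMeasure T := by
  rw [strip, stripMeasure, Measure.volume_eq_prod, ← Measure.prod_restrict, Measure.restrict_univ,
    restrict_Ioo_eq_restrict_Ioc]

/-- `F` is integrable on `(0, T] × [-N, N]` for every `N`. -/
def LocInt (T : ℝ) (F : ℝ → ℝ → ℝ) : Prop :=
  ∀ N : ℝ, Integrable (Function.uncurry F)
    ((volume.restrict (Ioc 0 T)).prod (volume.restrict (Icc (-N) N)))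

lemma boxMeasure_eq (T N : ℝ) : (volume.restrict (Ioc 0 T)).prod (volume.restrict (Icc (-N) N)) =
    (stripMeasure T).restrict (univ ×ˢ Icc (-N) N) := by
  rw [stripMeasure, ← Measure.prod_restrict, Measure.restrict_univ]

lemma boxMeasure_eq' (T N : ℝ) :
    (volume.restrict (Ioc 0 T)).prod (volume.restrict (Icc (-N) N)) =
    (volume : Measure (ℝ × ℝ)).restrict (Ioc 0 T ×ˢ Icc (-N) N) := by
  rw [Measure.prod_restrict, Measure.volume_eq_prod]

namespace LocInt

variable {T : ℝ} {F G k : ℝ → ℝ → ℝ}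

lemma of_integrable (h : Integrable (Function.uncurry F) (stripMeasure T)) : LocInt T F :=
  fun N => by rw [boxMeasure_eq]; exact h.restrict

lemma of_memLp (h : MemLp (Function.uncurry F) 2 (stripMeasure T)) : LocInt T F := fun N => by
  refine MemLp.integrable one_le_two (MemLp.mono_measure ?_ h)
  rw [boxMeasure_eq]; exact Measure.restrict_le_self

lemma add (hF : LocInt T F) (hG : LocInt T G) : LocInt T fun t x => F t x + G t x :=
  fun N => (hF N).add (hG N)

lemma sub (hF : LocInt T F) (hG : LocInt T G) : LocInt T fun t x => F t x - G t x :=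
  fun N => (hF N).sub (hG N)

lemma neg (hF : LocInt T F) : LocInt T fun t x => -F t x := fun N => (hF N).neg

lemma continuous_mul (hk : Continuous (Function.uncurry k)) (hF : LocInt T F) :
    LocInt T fun t x => k t x * F t x := fun N => by
  obtain ⟨C, hC⟩ := ((isCompact_Icc (a := (0 : ℝ)) (b := T)).prod
    (isCompact_Icc (a := -N) (b := N))).exists_bound_of_continuousOn hk.continuousOn
  refine (hF N).bdd_mul (c := C) (f := Function.uncurry k) hk.aestronglyMeasurable ?_
  rw [boxMeasure_eq']
  refine (ae_restrict_iff' (measurableSet_Ioc.prod measurableSet_Icc)).2 (ae_of_all _ ?_)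
  exact fun z hz => hC z ⟨Ioc_subset_Icc_self hz.1, hz.2⟩

lemma of_continuous (hk : Continuous (Function.uncurry k)) : LocInt T k := by
  have h1 : LocInt T fun _ _ => 1 := fun N => by
    change Integrable (fun _ => (1 : ℝ)) _
    exact integrable_const _
  simpa using continuous_mul hk h1

lemma congr (hF : LocInt T F) (h : ∀ᵐ z ∂stripMeasure T, F z.1 z.2 = G z.1 z.2) :
    LocInt T G := fun N => by
  refine (hF N).congr ?_
  rw [boxMeasure_eq]
  exact ae_restrict_of_ae h

lemma integrable_mul_test {ψ : ℝ × ℝ → ℝ} (hF : LocInt T F) (hψ : Continuous ψ)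
    (hc : HasCompactSupport ψ) : Integrable (fun z => F z.1 z.2 * ψ z) (stripMeasure T) := by
  obtain ⟨R, hR⟩ := hc.isCompact.isBounded.subset_closedBall 0
  have hz : ∀ z : ℝ × ℝ, z ∉ (univ ×ˢ Icc (-R) R : Set (ℝ × ℝ)) → ψ z = 0 := fun z hz =>
    image_eq_zero_of_notMem_tsupport fun h => hz ⟨mem_univ _, by
      have := hR h
      rw [mem_closedBall_zero_iff] at this
      have h2 := (norm_snd_le z).trans this
      rw [Real.norm_eq_abs, abs_le] at h2
      exact h2⟩
  have h1 : IntegrableOn (fun z => F z.1 z.2 * ψ z) (univ ×ˢ Icc (-R) R) (stripMeasure T) := by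
    rw [IntegrableOn, ← boxMeasure_eq]
    refine ((LocInt.continuous_mul (k := fun t x => ψ (t, x)) hψ hF) R).congr
      (ae_of_all _ fun z => ?_)
    exact mul_comm _ _
  exact (integrableOn_iff_integrable_of_support_subset fun z hz' => by
    by_contra h
    exact hz' (by simp [hz z h])).1 h1

lemma ae_time (hF : LocInt T F) : ∀ᵐ x, IntegrableOn (fun t => F t x) (Ioc 0 T) := by
  have h1 : ∀ᵐ x, ∀ n : ℕ, x ∈ Icc (-(n : ℝ)) n → IntegrableOn (fun t => F t x) (Ioc 0 T) :=
    ae_all_iff.2 fun n => (ae_restrict_iff' measurableSet_Icc).1 (hF n).prod_left_ae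
  filter_upwards [h1] with x hx
  obtain ⟨n, hn⟩ := exists_nat_ge |x|
  exact hx n (abs_le.1 hn)

lemma ae_space (hF : LocInt T F) :
    ∀ᵐ t ∂volume.restrict (Ioc 0 T), ∀ N : ℝ, IntegrableOn (F t) (Icc (-N) N) := by
  have h1 : ∀ᵐ t ∂volume.restrict (Ioc 0 T), ∀ n : ℕ, IntegrableOn (F t) (Icc (-(n : ℝ)) n) :=
    ae_all_iff.2 fun n => (hF n).prod_right_ae
  filter_upwards [h1] with t ht N
  obtain ⟨n, hn⟩ := exists_nat_ge N
  exact (ht n).mono_set (Icc_subset_Icc (by linarith) hn)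

lemma integrable_uIoc (hF : LocInt T F) {t : ℝ} (ht : t ∈ Icc 0 T) (a b : ℝ) :
    IntegrableOn (Function.uncurry F) (Ioc 0 t ×ˢ uIoc a b) := by
  have h := hF (max |a| |b|)
  rw [boxMeasure_eq'] at h
  refine IntegrableOn.mono_set h (prod_mono (Ioc_subset_Ioc_right ht.2) ?_)
  refine uIoc_subset_uIcc.trans (uIcc_subset_Icc ?_ ?_)
  · exact abs_le.1 (le_max_left _ _)
  · exact abs_le.1 (le_max_right _ _)

end LocInt

lemma hasDerivAt_slice_dx {ψ : ℝ × ℝ → ℝ} (hψ : ContDiff ℝ ∞ ψ) (t x : ℝ) :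
    HasDerivAt (fun x => ψ (t, x)) (dx ψ (t, x)) x := by
  have h1 := (hψ.differentiable (by simp) (t, x)).hasFDerivAt
  exact h1.comp_hasDerivAt x ((hasDerivAt_const x t).prodMk (hasDerivAt_id x))

lemma hasDerivAt_slice_dt {ψ : ℝ × ℝ → ℝ} (hψ : ContDiff ℝ ∞ ψ) (t x : ℝ) :
    HasDerivAt (fun t => ψ (t, x)) (dt ψ (t, x)) t := by
  have h1 := (hψ.differentiable (by simp) (t, x)).hasFDerivAt
  exact h1.comp_hasDerivAt t ((hasDerivAt_id t).prodMk (hasDerivAt_const t x))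

lemma continuous_dx {ψ : ℝ × ℝ → ℝ} (hψ : ContDiff ℝ ∞ ψ) : Continuous (dx ψ) :=
  (hψ.continuous_fderiv (by simp)).clm_apply continuous_const

lemma continuous_dt {ψ : ℝ × ℝ → ℝ} (hψ : ContDiff ℝ ∞ ψ) : Continuous (dt ψ) :=
  (hψ.continuous_fderiv (by simp)).clm_apply continuous_const

lemma hasCompactSupport_dx {ψ : ℝ × ℝ → ℝ} (h : HasCompactSupport ψ) :
    HasCompactSupport (dx ψ) := h.fderiv_apply ℝ _

lemma hasCompactSupport_dt {ψ : ℝ × ℝ → ℝ} (h : HasCompactSupport ψ) :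
    HasCompactSupport (dt ψ) := h.fderiv_apply ℝ _

section IBP

variable {T : ℝ} {F F' : ℝ → ℝ → ℝ} {ψ : ℝ × ℝ → ℝ}

lemma integral_mul_dx (h : ∀ᵐ t ∂volume.restrict (Ioc 0 T), ∀ a b, HasACDeriv (F t) (F' t) a b)
    (hF : LocInt T F) (hF' : LocInt T F') (hψ : ContDiff ℝ ∞ ψ) (hc : HasCompactSupport ψ) :
    ∫ z, F z.1 z.2 * dx ψ z ∂stripMeasure T = -∫ z, F' z.1 z.2 * ψ z ∂stripMeasure T := by
  have i0 := hF.integrable_mul_test hψ.continuous hc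
  have i1 := hF.integrable_mul_test (continuous_dx hψ) (hasCompactSupport_dx hc)
  have i2 := hF'.integrable_mul_test hψ.continuous hc
  rw [integral_prod _ i1, integral_prod _ i2, ← integral_neg]
  refine integral_congr_ae ?_
  filter_upwards [h, i0.prod_right_ae, i1.prod_right_ae, i2.prod_right_ae] with t ht j0 j1 j2
  have := integral_eq_zero_of_hasACDeriv
    (fun a b => (ht a b).mul (HasACDeriv.of_hasDerivAt (hasDerivAt_slice_dx hψ t)
      ((continuous_dx hψ).comp (by fun_prop)))) j0 (j2.add j1)
  rw [integral_add j2 j1] at this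
  linarith

lemma integral_mul_dt (h : ∀ᵐ x, HasACDeriv (fun t => F t x) (fun t => F' t x) 0 T) (hT : 0 < T)
    (hF : LocInt T F) (hF' : LocInt T F') (hψ : IsTest T ψ) :
    ∫ z, F z.1 z.2 * dt ψ z ∂stripMeasure T = -∫ z, F' z.1 z.2 * ψ z ∂stripMeasure T := by
  obtain ⟨hψ, hc, hs⟩ := hψ
  have i1 := hF.integrable_mul_test (continuous_dt hψ) (hasCompactSupport_dt hc)
  have i2 := hF'.integrable_mul_test hψ.continuous hc
  rw [integral_prod_symm _ i1, integral_prod_symm _ i2, ← integral_neg]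
  refine integral_congr_ae ?_
  filter_upwards [h, i1.prod_left_ae, i2.prod_left_ae] with x hx j1 j2
  have := (hx.mul (HasACDeriv.of_hasDerivAt (fun t => hasDerivAt_slice_dt hψ t x)
      ((continuous_dt hψ).comp (by fun_prop)))).integral_eq_sub
  rw [image_eq_zero_of_notMem_tsupport (x := (T, x)) fun h' => lt_irrefl _ (hs h').1.2,
    image_eq_zero_of_notMem_tsupport (x := ((0 : ℝ), x)) fun h' => lt_irrefl _ (hs h').1.1,
    intervalIntegral.integral_of_le hT.le, integral_add j2 j1] at this
  linarith

lemma ae_eq_zero_of_test {F : ℝ → ℝ → ℝ} (hF : LocInt T F)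
    (h : ∀ ψ, IsTest T ψ → ∫ z, F z.1 z.2 * ψ z ∂stripMeasure T = 0) :
    ∀ᵐ z ∂stripMeasure T, F z.1 z.2 = 0 := by
  have hopen : IsOpen (strip T) := isOpen_Ioo.prod isOpen_univ
  rw [← volume_restrict_strip, ae_restrict_iff' hopen.measurableSet]
  refine hopen.ae_eq_zero_of_integral_contDiff_smul_eq_zero ?_ fun ψ h1 h2 h3 => ?_
  · intro z hz
    refine ⟨Ioc 0 T ×ˢ Icc (-(|z.2| + 1)) (|z.2| + 1), ?_, ?_⟩
    · refine mem_nhdsWithin_of_mem_nhds (prod_mem_nhds (Ioc_mem_nhds hz.1.1 hz.1.2) ?_)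
      exact Icc_mem_nhds (by linarith [neg_abs_le z.2]) (by linarith [le_abs_self z.2])
    · rw [IntegrableOn, ← boxMeasure_eq']
      exact hF _
  · have := h ψ ⟨h1, h2, h3⟩
    rw [← volume_restrict_strip] at this
    rw [← this, ← setIntegral_eq_integral_of_forall_compl_eq_zero (s := strip T)]
    · simp_rw [smul_eq_mul, mul_comm]
    · intro z hz
      rw [image_eq_zero_of_notMem_tsupport fun h' => hz (h3 h'), zero_smul]

end IBP

/-- A continuous function with a locally integrable weak time derivative on the strip is absolutely
continuous in time on almost every vertical line. -/
theorem ae_hasACDeriv_time {T : ℝ} (hT : 0 < T) {f g : ℝ → ℝ → ℝ}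
    (hf : Continuous (Function.uncurry f)) (hg : LocInt T g)
    (h : ∀ ψ, IsTest T ψ →
      ∫ z, f z.1 z.2 * dt ψ z ∂stripMeasure T = -∫ z, g z.1 z.2 * ψ z ∂stripMeasure T) :
    ∀ᵐ x, HasACDeriv (fun t => f t x) (fun t => g t x) 0 T := by
  have hfl : LocInt T f := .of_continuous hf
  -- products with a test function of the space variable
  have hχint : ∀ χ : ℝ → ℝ, ContDiff ℝ ∞ χ → HasCompactSupport χ →
      Integrable (fun z : ℝ × ℝ => g z.1 z.2 * χ z.2) (stripMeasure T) := by
    intro χ hχ hχc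
    obtain ⟨R, hR⟩ := hχc.isCompact.isBounded.subset_closedBall 0
    have h1 : IntegrableOn (fun z : ℝ × ℝ => g z.1 z.2 * χ z.2) (univ ×ˢ Icc (-R) R)
        (stripMeasure T) := by
      rw [IntegrableOn, ← boxMeasure_eq]
      refine ((LocInt.continuous_mul (k := fun _ x => χ x) (by
        exact hχ.continuous.comp continuous_snd) hg) R).congr (ae_of_all _ fun z => ?_)
      exact mul_comm _ _
    refine (integrableOn_iff_integrable_of_support_subset fun z hz' => ?_).1 h1
    by_contra hz
    refine hz' ?_
    dsimp only
    rw [image_eq_zero_of_notMem_tsupport (f := χ), mul_zero]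
    intro h'
    have := hR h'
    rw [mem_closedBall_zero_iff, Real.norm_eq_abs, abs_le] at this
    exact hz ⟨mem_univ _, this⟩
  have hstep : ∀ χ : ℝ → ℝ, ContDiff ℝ ∞ χ → HasCompactSupport χ → ∀ s ∈ Ioo 0 T, ∀ t ∈ Ioo 0 T,
      (∫ x, f t x * χ x) - ∫ x, f s x * χ x = ∫ r in s..t, ∫ x, g r x * χ x := by
    intro χ hχ hχc s hs t ht
    have hcont : Continuous fun t => ∫ x, f t x * χ x := by
      rw [← continuousOn_univ]
      refine continuousOn_integral_of_compact_support (k := tsupport χ) hχc.isCompact ?_ ?_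
      · exact (hf.mul (hχ.continuous.comp continuous_snd)).continuousOn
      · intro p x _ hx
        rw [image_eq_zero_of_notMem_tsupport hx, mul_zero]
    have hGi : IntegrableOn (fun r => ∫ x, g r x * χ x) (Ioc 0 T) :=
      (hχint χ hχ hχc).integral_prod_left
    refine sub_eq_integral_of_weakDeriv isOpen_Ioo ordConnected_Ioo (f := fun t => ∫ x, f t x * χ x)
      (g := fun r => ∫ x, g r x * χ x) hcont.continuousOn
      (hGi.mono_set Ioo_subset_Ioc_self).locallyIntegrableOn ?_ hs ht
    intro θ hθ hθc hθs
    have htest : IsTest T fun z => θ z.1 * χ z.2 := by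
      have hsub : tsupport (fun z : ℝ × ℝ => θ z.1 * χ z.2) ⊆ tsupport θ ×ˢ tsupport χ := by
        refine closure_minimal ?_ ((isClosed_tsupport θ).prod (isClosed_tsupport χ))
        intro z hz
        have hz' : θ z.1 * χ z.2 ≠ 0 := hz
        exact ⟨subset_tsupport _ (left_ne_zero_of_mul hz'),
          subset_tsupport _ (right_ne_zero_of_mul hz')⟩
      refine ⟨(hθ.comp contDiff_fst).mul (hχ.comp contDiff_snd), ?_, ?_⟩
      · exact (hθc.isCompact.prod hχc.isCompact).of_isClosed_subset (isClosed_tsupport _) hsub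
      · exact hsub.trans (prod_mono hθs (subset_univ _))
    have hdt : ∀ z, dt (fun z : ℝ × ℝ => θ z.1 * χ z.2) z = deriv θ z.1 * χ z.2 := fun z => by
      have h1 := hasDerivAt_slice_dt htest.1 z.1 z.2
      have h2 := (hθ.differentiable (by simp) z.1).hasDerivAt.mul_const (χ z.2)
      exact HasDerivAt.unique (f := fun t => θ t * χ z.2) h1 h2
    have e := h _ htest
    have i1 := hfl.integrable_mul_test (continuous_dt htest.1) (hasCompactSupport_dt htest.2.1)
    have i2 := hg.integrable_mul_test htest.1.continuous htest.2.1
    rw [integral_prod _ i1, integral_prod _ i2] at e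
    simp only [hdt] at e
    have e1 : ∀ t, ∫ x, f t x * (deriv θ t * χ x) = (∫ x, f t x * χ x) * deriv θ t := fun t => by
      rw [← integral_mul_const]; congr 1; ext x; ring
    have e2 : ∀ t, ∫ x, g t x * (θ t * χ x) = (∫ x, g t x * χ x) * θ t := fun t => by
      rw [← integral_mul_const]; congr 1; ext x; ring
    simp only [e1, e2] at e
    rwa [setIntegral_eq_integral_of_forall_compl_eq_zero,
      setIntegral_eq_integral_of_forall_compl_eq_zero] at e
    · intro t ht
      rw [image_eq_zero_of_notMem_tsupport fun h' => ht (Ioo_subset_Ioc_self (hθs h')), mul_zero]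
    · intro t ht
      rw [image_eq_zero_of_notMem_tsupport fun h' => ht (Ioo_subset_Ioc_self
        (hθs (tsupport_deriv_subset h'))), mul_zero]
  have hpair : ∀ s ∈ Ioo 0 T, ∀ t ∈ Ioo 0 T, s ≤ t →
      ∀ᵐ x, f t x - f s x - ∫ r in s..t, g r x = 0 := by
    intro s hs t ht hst
    have hsub : Ioc s t ⊆ Ioc 0 T := Ioc_subset_Ioc hs.1.le ht.2.le
    have hct : Continuous (f t) := hf.comp (by fun_prop : Continuous fun x => (t, x))
    have hcs : Continuous (f s) := hf.comp (by fun_prop : Continuous fun x => (s, x))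
    have hli : LocallyIntegrable fun x => ∫ r in s..t, g r x := by
      intro x
      refine ⟨Icc (-(|x| + 1)) (|x| + 1), Icc_mem_nhds (by linarith [neg_abs_le x])
        (by linarith [le_abs_self x]), ?_⟩
      simp_rw [intervalIntegral.integral_of_le hst]
      have h1 := hg (|x| + 1)
      rw [boxMeasure_eq'] at h1
      have h2 : Integrable (Function.uncurry g)
          ((volume.restrict (Ioc s t)).prod (volume.restrict (Icc (-(|x| + 1)) (|x| + 1)))) := by
        rw [Measure.prod_restrict, ← Measure.volume_eq_prod]
        exact IntegrableOn.mono_set h1 (prod_mono hsub subset_rfl)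
      exact h2.integral_prod_right
    refine ae_eq_zero_of_integral_contDiff_smul_eq_zero
      ((hct.locallyIntegrable.sub hcs.locallyIntegrable).sub hli) fun χ hχ hχc => ?_
    have it : Integrable fun x => f t x * χ x := (hct.mul hχ.continuous).integrable_of_hasCompactSupport (μ := volume)
      (hχc.mul_left (f := f t))
    have is : Integrable fun x => f s x * χ x := (hcs.mul hχ.continuous).integrable_of_hasCompactSupport (μ := volume)
      (hχc.mul_left (f := f s))
    have ig : Integrable (Function.uncurry fun r x => g r x * χ x)
        ((volume.restrict (uIoc s t)).prod volume) := by
      rw [uIoc_of_le hst]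
      refine (hχint χ hχ hχc).mono_measure ?_
      exact Measure.prod_mono (Measure.restrict_mono hsub le_rfl) le_rfl
    have e1 : ∀ x, χ x • (f t x - f s x - ∫ r in s..t, g r x) =
        f t x * χ x - f s x * χ x - ∫ r in s..t, g r x * χ x := fun x => by
      rw [intervalIntegral.integral_mul_const, smul_eq_mul]; ring
    simp_rw [e1]
    have ig2 : Integrable fun x => ∫ r in s..t, g r x * χ x := by
      have := ig.integral_prod_right
      rw [uIoc_of_le hst] at this
      simp_rw [intervalIntegral.integral_of_le hst]
      exact this
    rw [integral_sub (f := fun x => f t x * χ x - f s x * χ x) (it.sub is) ig2,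
      integral_sub it is, ← intervalIntegral_integral_swap ig,
      hstep χ hχ hχc s hs t ht, sub_self]
  have hrat : ∀ᵐ x, ∀ p q : ℚ, (p : ℝ) ∈ Ioo 0 T → (q : ℝ) ∈ Ioo 0 T → (p : ℝ) ≤ q →
      f q x - f p x - ∫ r in (p : ℝ)..q, g r x = 0 := by
    rw [ae_all_iff]; intro p
    rw [ae_all_iff]; intro q
    by_cases hp : (p : ℝ) ∈ Ioo 0 T
    · by_cases hq : (q : ℝ) ∈ Ioo 0 T
      · by_cases hpq : (p : ℝ) ≤ q
        · filter_upwards [hpair p hp q hq hpq] with x hx _ _ _ using hx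
        · exact ae_of_all _ fun x _ _ h => absurd h hpq
      · exact ae_of_all _ fun x _ h => absurd h hq
    · exact ae_of_all _ fun x h => absurd h hp
  filter_upwards [hrat, hg.ae_time] with x hx hgx
  have hgi : IntervalIntegrable (fun t => g t x) volume 0 T :=
    (intervalIntegrable_iff_integrableOn_Ioc_of_le hT.le).2 hgx
  have hcx : Continuous fun t => f t x := hf.comp (by fun_prop : Continuous fun t => (t, x))
  have hkc : ContinuousOn (fun t => f t x - ∫ r in (0 : ℝ)..t, g r x) (Icc 0 T) := by
    refine hcx.continuousOn.sub ?_
    have := intervalIntegral.continuousOn_primitive_interval' hgi (a := 0) (by simp)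
    rwa [uIcc_of_le hT.le] at this
  obtain ⟨q₀, hq₀, hq₀T⟩ := exists_rat_btwn hT
  have hii : ∀ p ∈ Icc 0 T, ∀ q ∈ Icc 0 T, IntervalIntegrable (fun t => g t x) volume p q :=
    fun p hp q hq => hgi.mono_set (by
      rw [uIcc_of_le hT.le]; exact ordConnected_Icc.uIcc_subset hp hq)
  have h0 : (0 : ℝ) ∈ Icc 0 T := ⟨le_rfl, hT.le⟩
  have hconst : EqOn (fun t => f t x - ∫ r in (0 : ℝ)..t, g r x)
      (fun _ => f q₀ x - ∫ r in (0 : ℝ)..q₀, g r x) (Icc 0 T) := by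
    refine Set.EqOn.of_subset_closure (s := Ioo 0 T ∩ range ((↑) : ℚ → ℝ)) ?_ hkc
      continuousOn_const (inter_subset_left.trans Ioo_subset_Icc_self) ?_
    · rintro _ ⟨hq, ⟨q, rfl⟩⟩
      have hqI := Ioo_subset_Icc_self hq
      have hq₀I : (q₀ : ℝ) ∈ Icc 0 T := ⟨hq₀.le, hq₀T.le⟩
      dsimp only
      rcases le_total (q₀ : ℝ) q with hle | hle
      · have := hx q₀ q ⟨hq₀, hq₀T⟩ hq hle
        rw [← intervalIntegral.integral_interval_sub_left (hii 0 h0 q hqI)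
          (hii 0 h0 q₀ hq₀I)] at this
        linarith
      · have := hx q q₀ hq ⟨hq₀, hq₀T⟩ hle
        rw [← intervalIntegral.integral_interval_sub_left (hii 0 h0 q₀ hq₀I)
          (hii 0 h0 q hqI)] at this
        linarith
    · have := (Rat.denseRange_cast (𝕜 := ℝ)).open_subset_closure_inter (isOpen_Ioo (a := 0) (b := T))
      have h2 := closure_mono this
      rwa [closure_closure, closure_Ioo hT.ne] at h2
  refine HasACDeriv.of_integral hgi fun t ht => ?_
  rw [uIcc_of_le hT.le] at ht
  have e1 := hconst ht
  have e2 := hconst h0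
  simp only [intervalIntegral.integral_same] at e1 e2
  linarith

/-! ### From strong solutions to almost everywhere equations -/

lemma ae_eq_strip_of_ae_ae {T : ℝ} {F G : ℝ → ℝ → ℝ}
    (hF : AEStronglyMeasurable (Function.uncurry F) (stripMeasure T))
    (hG : AEStronglyMeasurable (Function.uncurry G) (stripMeasure T))
    (h : ∀ᵐ t ∂volume.restrict (Ioc 0 T), F t =ᵐ[volume] G t) :
    ∀ᵐ z ∂stripMeasure T, F z.1 z.2 = G z.1 z.2 := by
  have h1 := hF.ae_eq_mk
  have h2 := hG.ae_eq_mk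
  have h3 : ∀ᵐ z ∂stripMeasure T, hF.mk _ z = hG.mk _ z := by
    rw [Measure.ae_prod_iff_ae_ae (measurableSet_eq_fun hF.stronglyMeasurable_mk.measurable
      hG.stronglyMeasurable_mk.measurable)]
    filter_upwards [Measure.ae_ae_of_ae_prod h1, Measure.ae_ae_of_ae_prod h2, h] with t a1 a2 a3
    filter_upwards [a1, a2, a3] with x b1 b2 b3
    rw [← b1, ← b2]; exact b3
  filter_upwards [h1, h2, h3] with z a1 a2 a3
  exact a1.trans (a3.trans a2.symm)

lemma lintegral_sq_eq {X : Type*} [MeasurableSpace X] (μ : Measure X) (f : X → ℝ) :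
    ∫⁻ x, ‖f x‖ₑ ^ (2 : ℝ) ∂μ = eLpNorm f 2 μ ^ (2 : ℝ) := by
  have := eLpNorm_nnreal_pow_eq_lintegral (f := f) (μ := μ) (p := 2) (by norm_num)
  simpa using this.symm

lemma memLp_strip_of_ae {T : ℝ} {F : ℝ → ℝ → ℝ} {M : ℝ≥0}
    (hF : AEStronglyMeasurable (Function.uncurry F) (stripMeasure T))
    (h : ∀ᵐ t ∂volume.restrict (Ioc 0 T), eLpNorm (F t) 2 volume ≤ M) :
    MemLp (Function.uncurry F) 2 (stripMeasure T) := by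
  refine ⟨hF, ?_⟩
  rw [eLpNorm_lt_top_iff_lintegral_rpow_enorm_lt_top (by norm_num) (by norm_num),
    lintegral_prod _ (hF.enorm.pow_const _)]
  have h2 : ∫⁻ t in Ioc 0 T, ∫⁻ x, ‖F t x‖ₑ ^ (2 : ℝ) ≤
      ∫⁻ _ in Ioc 0 T, (M : ℝ≥0∞) ^ (2 : ℝ) := by
    refine lintegral_mono_ae (h.mono fun t ht => ?_)
    rw [lintegral_sq_eq]
    gcongr
  refine lt_of_le_of_lt (by simpa using h2) ?_
  exact ENNReal.mul_lt_top (by simp) (by simp)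

lemma integral_sq_le {X : Type*} [MeasurableSpace X] {μ : Measure X} {f : X → ℝ} {M : ℝ≥0}
    (hf : AEStronglyMeasurable f μ) (h : eLpNorm f 2 μ ≤ M) : ∫ x, f x ^ 2 ∂μ ≤ (M : ℝ) ^ 2 := by
  rw [integral_eq_lintegral_of_nonneg_ae (ae_of_all _ fun x => sq_nonneg _) (hf.pow 2)]
  have h1 : ∀ x, ENNReal.ofReal (f x ^ 2) = ‖f x‖ₑ ^ (2 : ℝ) := fun x => by
    rw [← ofReal_norm, ENNReal.ofReal_rpow_of_nonneg (norm_nonneg _) (by norm_num)]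
    simp
  simp_rw [h1, lintegral_sq_eq]
  have h2 : eLpNorm f 2 μ ^ (2 : ℝ) ≤ (M : ℝ≥0∞) ^ (2 : ℝ) := by gcongr
  refine (ENNReal.toReal_mono (by simp) h2).trans ?_
  simp

lemma abs_le_of_H1 {f g : ℝ → ℝ} {M : ℝ≥0} (h : HasWeakDeriv f g) (hf : Continuous f)
    (h1 : eLpNorm f 2 volume ≤ M) (h2 : eLpNorm g 2 volume ≤ M) (x : ℝ) : |f x| ≤ 2 * M := by
  have m1 : MemLp f 2 volume := ⟨hf.aestronglyMeasurable, h1.trans_lt (by simp)⟩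
  have m2 : MemLp g 2 volume := ⟨h.2.1.aestronglyMeasurable, h2.trans_lt (by simp)⟩
  have hfg : Integrable fun x => f x * g x := m1.integrable_mul m2
  have hff : Integrable fun x => f x * f x := m1.integrable_mul m1
  have hac : ∀ a b, HasACDeriv (fun x => f x * f x) (fun x => 2 * (f x * g x)) a b := fun a b =>
    ((h.hasACDeriv hf a b).mul (h.hasACDeriv hf a b)).congr_right (ae_of_all _ fun x _ => by ring)
  have key := abs_le_integral_of_hasACDeriv hac hff (hfg.const_mul 2) x
  have h3 : ∫ y, |2 * (f y * g y)| ≤ ∫ y, (f y ^ 2 + g y ^ 2) := by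
    refine integral_mono (hfg.const_mul 2).abs (m1.integrable_sq.add m2.integrable_sq) fun y => ?_
    exact abs_le.2 ⟨by nlinarith [sq_nonneg (f y + g y)], by nlinarith [sq_nonneg (f y - g y)]⟩
  rw [integral_add m1.integrable_sq m2.integrable_sq] at h3
  have h4 := integral_sq_le m1.1 h1
  have h5 := integral_sq_le m2.1 h2
  rw [abs_mul_self] at key
  refine abs_le_of_sq_le_sq ?_ (by positivity)
  nlinarith [NNReal.coe_nonneg M]

lemma locallyIntegrable_of_intervalIntegrable {g : ℝ → ℝ}
    (h : ∀ a b, IntervalIntegrable g volume a b) : LocallyIntegrable g := fun x =>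
  ⟨Ioc (x - 1) (x + 1), Ioc_mem_nhds (by linarith) (by linarith),
    (intervalIntegrable_iff_integrableOn_Ioc_of_le (by linarith)).1 (h _ _)⟩

lemma hasWeakDeriv_of_hasACDeriv {f g : ℝ → ℝ} (hf : Continuous f)
    (h : ∀ a b, HasACDeriv f g a b) : HasWeakDeriv f g := by
  have hg := locallyIntegrable_of_intervalIntegrable fun a b => (h a b).intervalIntegrable
  refine ⟨hf.locallyIntegrable, hg, fun ψ hψ hc => ?_⟩
  have hψ' : ContDiff ℝ ∞ (deriv ψ) := (contDiff_infty_iff_deriv.1 hψ).2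
  have i0 : Integrable fun x => f x * ψ x :=
    (hf.mul hψ.continuous).integrable_of_hasCompactSupport (hc.mul_left (f := f))
  have i1 : Integrable fun x => f x * deriv ψ x :=
    (hf.mul hψ'.continuous).integrable_of_hasCompactSupport (hc.deriv.mul_left (f := f))
  have i2 : Integrable fun x => g x * ψ x := by
    simpa [mul_comm] using hg.integrable_smul_left_of_hasCompactSupport hψ.continuous hc
  have := integral_eq_zero_of_hasACDeriv (fun a b => (h a b).mul (HasACDeriv.of_hasDerivAt
    (fun x => (hψ.differentiable (by simp) x).hasDerivAt) hψ'.continuous)) i0 (i2.add i1)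
  rw [integral_add i2 i1] at this
  linarith

lemma Icc_subset_of_ae_mem {T : ℝ} (hT : 0 < T) {S : Set ℝ} (hS : IsClosed S)
    (h : ∀ᵐ t ∂volume.restrict (Ioc 0 T), t ∈ S) : Icc 0 T ⊆ S := by
  have h1 : Ioo 0 T ⊆ S := by
    rw [← restrict_Ioo_eq_restrict_Ioc, ae_restrict_iff' measurableSet_Ioo] at h
    have h2 : volume (Ioo 0 T ∩ Sᶜ) = 0 := by
      rw [measure_eq_zero_iff_ae_notMem]
      filter_upwards [h] with t ht h' using h'.2 (ht h'.1)
    rw [(isOpen_Ioo.inter hS.isOpen_compl).measure_eq_zero_iff (μ := volume)] at h2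
    intro t ht
    by_contra h'
    exact (h2 ▸ (⟨ht, h'⟩ : t ∈ Ioo 0 T ∩ Sᶜ) : t ∈ (∅ : Set ℝ))
  rw [← closure_Ioo hT.ne]
  exact closure_minimal h1 hS

/-- A pair `(ρ, u)` on `[0, T] × ℝ`, extended continuously to all times, with its derivatives,
satisfying the degenerate Navier–Stokes equations almost everywhere. -/
structure RegularFlow (a α γ T : ℝ) (rbar : ℝ → ℝ) (ρ u ρt ut ρx ux uxx : ℝ → ℝ → ℝ) : Prop where
  T_pos : 0 < T
  cont_density : Continuous (Function.uncurry ρ)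
  cont_velocity : Continuous (Function.uncurry u)
  density_bounds : ∃ m M : ℝ, 0 < m ∧ ∀ t x, m ≤ ρ t x ∧ ρ t x ≤ M
  velocity_bound : ∃ U : ℝ, ∀ t x, |u t x| ≤ U
  time_density : ∀ᵐ x, HasACDeriv (fun t => ρ t x) (fun t => ρt t x) 0 T
  time_velocity : ∀ᵐ x, HasACDeriv (fun t => u t x) (fun t => ut t x) 0 T
  space_density : ∀ᵐ t ∂volume.restrict (Ioc 0 T), ∀ a b, HasACDeriv (ρ t) (ρx t) a b
  space_velocity : ∀ᵐ t ∂volume.restrict (Ioc 0 T), ∀ a b, HasACDeriv (u t) (ux t) a b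
  space_gradient : ∀ᵐ t ∂volume.restrict (Ioc 0 T), ∀ a b, HasACDeriv (ux t) (uxx t) a b
  memLp_density : MemLp (Function.uncurry fun t x => ρ t x - rbar x) 2 (stripMeasure T)
  memLp_velocity : MemLp (Function.uncurry u) 2 (stripMeasure T)
  memLp_ρt : MemLp (Function.uncurry ρt) 2 (stripMeasure T)
  memLp_ut : MemLp (Function.uncurry ut) 2 (stripMeasure T)
  memLp_ρx : MemLp (Function.uncurry ρx) 2 (stripMeasure T)
  memLp_ux : MemLp (Function.uncurry ux) 2 (stripMeasure T)
  memLp_uxx : MemLp (Function.uncurry uxx) 2 (stripMeasure T)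
  mass : ∀ᵐ z ∂stripMeasure T,
    ρt z.1 z.2 + (ρx z.1 z.2 * u z.1 z.2 + ρ z.1 z.2 * ux z.1 z.2) = 0
  momentum : ∀ᵐ z ∂stripMeasure T,
    ρ z.1 z.2 * (ut z.1 z.2 + u z.1 z.2 * ux z.1 z.2) + a * γ * ρ z.1 z.2 ^ (γ - 1) * ρx z.1 z.2 =
      α * ρ z.1 z.2 ^ (α - 1) * ρx z.1 z.2 * ux z.1 z.2 + ρ z.1 z.2 ^ α * uxx z.1 z.2

/-- Time truncated to `[0, T]`. -/
noncomputable def clampTime (T t : ℝ) : ℝ := max 0 (min t T)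

lemma continuous_clampTime (T : ℝ) : Continuous (clampTime T) := by
  unfold clampTime; fun_prop

lemma clampTime_mem {T : ℝ} (hT : 0 < T) (t : ℝ) : clampTime T t ∈ Icc 0 T :=
  ⟨le_max_left _ _, max_le hT.le (min_le_right _ _)⟩

lemma clampTime_of_mem {T t : ℝ} (ht : t ∈ Icc 0 T) : clampTime T t = t := by
  rw [clampTime, min_eq_left ht.2, max_eq_right ht.1]

lemma IsTest.mono {T T₀ : ℝ} (h : T ≤ T₀) {ψ : ℝ × ℝ → ℝ} (hψ : IsTest T ψ) : IsTest T₀ ψ :=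
  ⟨hψ.1, hψ.2.1, hψ.2.2.trans (prod_mono (Ioo_subset_Ioo_right h) subset_rfl)⟩

lemma setIntegral_strip_eq {T T₀ : ℝ} (h : T ≤ T₀) {F : ℝ × ℝ → ℝ}
    (hF : ∀ z, z ∉ strip T → F z = 0) :
    ∫ z in strip T₀, F z = ∫ z, F z ∂stripMeasure T := by
  rw [← volume_restrict_strip]
  refine setIntegral_eq_of_subset_of_forall_sdiff_eq_zero
    (isOpen_Ioo.prod isOpen_univ).measurableSet (prod_mono (Ioo_subset_Ioo_right h) subset_rfl) ?_
  exact fun z hz => hF z hz.2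

lemma IsTest.eq_zero {T : ℝ} {ψ : ℝ × ℝ → ℝ} (hψ : IsTest T ψ) {z : ℝ × ℝ} (hz : z ∉ strip T) :
    ψ z = 0 := image_eq_zero_of_notMem_tsupport fun h => hz (hψ.2.2 h)

lemma IsTest.dt_eq_zero {T : ℝ} {ψ : ℝ × ℝ → ℝ} (hψ : IsTest T ψ) {z : ℝ × ℝ}
    (hz : z ∉ strip T) : dt ψ z = 0 := by
  have : fderiv ℝ ψ z = 0 :=
    image_eq_zero_of_notMem_tsupport fun h => hz (hψ.2.2 (tsupport_fderiv_subset ℝ h))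
  rw [dt, this]; rfl

lemma IsTest.dx_eq_zero {T : ℝ} {ψ : ℝ × ℝ → ℝ} (hψ : IsTest T ψ) {z : ℝ × ℝ}
    (hz : z ∉ strip T) : dx ψ z = 0 := by
  have : fderiv ℝ ψ z = 0 :=
    image_eq_zero_of_notMem_tsupport fun h => hz (hψ.2.2 (tsupport_fderiv_subset ℝ h))
  rw [dx, this]; rfl

lemma ae_Ioc_of_ae_Ioo {T T₀ : ℝ} (hT : T < T₀) {p : ℝ → Prop}
    (h : ∀ᵐ t ∂volume.restrict (Ioo 0 T₀), p t) : ∀ᵐ t ∂volume.restrict (Ioc 0 T), p t := by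
  rw [← restrict_Ioo_eq_restrict_Ioc]
  exact ae_restrict_of_ae_restrict_of_subset (Ioo_subset_Ioo_right hT.le) h

lemma aestronglyMeasurable_stripMeasure {T T₀ : ℝ} (hT : T < T₀) {f : ℝ × ℝ → ℝ}
    (h : AEStronglyMeasurable f (volume.restrict (strip T₀))) :
    AEStronglyMeasurable f (stripMeasure T) := by
  rw [← volume_restrict_strip]
  exact h.mono_measure (Measure.restrict_mono
    (prod_mono (Ioo_subset_Ioo_right hT.le) subset_rfl) le_rfl)

lemma continuous_clamp {T T₀ : ℝ} (hT : T ∈ Ioo 0 T₀) {f : ℝ → ℝ → ℝ}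
    (h : ContinuousOn (Function.uncurry f) (Ico 0 T₀ ×ˢ univ)) :
    Continuous (Function.uncurry fun t x => f (clampTime T t) x) := by
  have hc : Continuous fun z : ℝ × ℝ => (clampTime T z.1, z.2) :=
    ((continuous_clampTime T).comp continuous_fst).prodMk continuous_snd
  refine h.comp_continuous hc fun z => ⟨?_, mem_univ _⟩
  have := clampTime_mem hT.1 z.1
  exact ⟨this.1, this.2.trans_lt hT.2⟩

lemma ae_clamp_eq {T : ℝ} (f : ℝ → ℝ → ℝ) :
    ∀ᵐ t ∂volume.restrict (Ioc 0 T), (fun x => f (clampTime T t) x) = f t := by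
  filter_upwards [ae_restrict_mem measurableSet_Ioc] with t ht
  rw [clampTime_of_mem (Ioc_subset_Icc_self ht)]

lemma ae_clamp_eq_strip {T : ℝ} (f : ℝ → ℝ → ℝ) :
    ∀ᵐ z ∂stripMeasure T, f (clampTime T z.1) z.2 = f z.1 z.2 := by
  rw [← volume_restrict_strip]
  filter_upwards [ae_restrict_mem (isOpen_Ioo.prod isOpen_univ).measurableSet] with z hz
  rw [clampTime_of_mem (Ioo_subset_Icc_self hz.1)]

lemma HasL2TimeDeriv.ae_hasACDeriv {T T₀ : ℝ} (hT : T ∈ Ioo 0 T₀) {f : ℝ → ℝ → ℝ}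
    (hf : ContinuousOn (Function.uncurry f) (Ico 0 T₀ ×ˢ univ)) (h : HasL2TimeDeriv T₀ f) :
    ∃ g : ℝ → ℝ → ℝ, MemLp (Function.uncurry g) 2 (stripMeasure T) ∧
      ∀ᵐ x, HasACDeriv (fun t => f (clampTime T t) x) (fun t => g t x) 0 T := by
  obtain ⟨g, hg, hgw⟩ := h
  have hg2 := hg T hT
  rw [volume_restrict_strip] at hg2
  refine ⟨g, hg2, ?_⟩
  refine ae_hasACDeriv_time hT.1 (continuous_clamp hT hf) (.of_memLp hg2) fun ψ hψ => ?_
  have e := hgw ψ (hψ.mono hT.2.le)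
  rw [setIntegral_strip_eq hT.2.le (fun z hz => by rw [hψ.dt_eq_zero hz, mul_zero]),
    setIntegral_strip_eq hT.2.le (fun z hz => by rw [hψ.eq_zero hz, mul_zero])] at e
  rw [← e]
  refine integral_congr_ae ?_
  filter_upwards [ae_clamp_eq_strip (T := T) f] with z hz
  rw [hz]

lemma IsBackground.memLp_deriv {rbar : ℝ → ℝ} {rm rp : ℝ} (h : IsBackground rbar rm rp) :
    Continuous (deriv rbar) ∧ (∀ x, x ∉ Icc (-1 : ℝ) 1 → deriv rbar x = 0) ∧
      MemLp (deriv rbar) 2 := by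
  have hc : Continuous (deriv rbar) := (contDiff_infty_iff_deriv.1 h.smooth).2.continuous
  have hz : ∀ x, x ∉ Icc (-1 : ℝ) 1 → deriv rbar x = 0 := fun x hx => by
    rcases lt_or_ge x (-1) with h1 | h1
    · have : rbar =ᶠ[𝓝 x] fun _ => rm := by
        filter_upwards [Iio_mem_nhds h1] with y hy using h.left y (le_of_lt hy)
      rw [this.deriv_eq, deriv_const]
    · have h2 : 1 < x := by
        by_contra h3
        exact hx ⟨h1, not_lt.1 h3⟩
      have : rbar =ᶠ[𝓝 x] fun _ => rp := by
        filter_upwards [Ioi_mem_nhds h2] with y hy using h.right y (le_of_lt hy)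
      rw [this.deriv_eq, deriv_const]
  refine ⟨hc, hz, hc.memLp_of_hasCompactSupport (HasCompactSupport.intro isCompact_Icc hz)⟩

lemma hasDerivAt_rpow_of_pos {s : ℝ} (p : ℝ) (hs : 0 < s) :
    HasDerivAt (fun r : ℝ => r ^ p) (p * s ^ (p - 1)) s :=
  Real.hasDerivAt_rpow_const (Or.inl hs.ne')

lemma continuousOn_rpow_Icc {m M : ℝ} (hm : 0 < m) (p : ℝ) :
    ContinuousOn (fun r : ℝ => r ^ p) (Icc m M) :=
  continuousOn_id.rpow_const fun _ hr => Or.inl (hm.trans_le hr.1).ne'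

lemma HasACDeriv.rpow {f g : ℝ → ℝ} {a b m M : ℝ} (h : HasACDeriv f g a b) (hm : 0 < m)
    (hf : ∀ x, m ≤ f x ∧ f x ≤ M) (p : ℝ) :
    HasACDeriv (fun x => f x ^ p) (fun x => p * f x ^ (p - 1) * g x) a b :=
  h.comp (m := m) (M := M) (Φ := fun r => r ^ p) (Φ' := fun r => p * r ^ (p - 1))
    (fun _ hr => hasDerivAt_rpow_of_pos p (hm.trans_le hr.1))
    (continuousOn_const.mul (continuousOn_rpow_Icc hm _)) fun x _ => hf x

lemma HasACDeriv.pow {f g : ℝ → ℝ} {a b : ℝ} (h : HasACDeriv f g a b) (n : ℕ) :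
    HasACDeriv (fun x => f x ^ n) (fun x => n * f x ^ (n - 1) * g x) a b := by
  obtain ⟨C, hC⟩ := h.ac.exists_bound
  exact h.comp (m := -C) (M := C) (Φ := fun r => r ^ n) (Φ' := fun r => n * r ^ (n - 1))
    (fun r _ => hasDerivAt_pow n r) (by fun_prop)
    fun x hx => abs_le.1 (hC x hx)

/-- A strong solution satisfies the equations almost everywhere on every shorter strip. -/
theorem IsStrongSolution.exists_regularFlow {a α γ T₀ T rm rp : ℝ} {rbar ρ₀ u₀ : ℝ → ℝ}
    {ρ u : ℝ → ℝ → ℝ} (hb : IsBackground rbar rm rp)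
    (hs : IsStrongSolution a α γ rbar ρ₀ u₀ T₀ ρ u) (hT : T ∈ Ioo 0 T₀) :
    ∃ ρt ut ρx ux uxx, RegularFlow a α γ T rbar (fun t x => ρ (clampTime T t) x)
      (fun t x => u (clampTime T t) x) ρt ut ρx ux uxx := by
  set r : ℝ → ℝ → ℝ := fun t x => ρ (clampTime T t) x with hr
  set w : ℝ → ℝ → ℝ := fun t x => u (clampTime T t) x with hw
  have hrc : Continuous (Function.uncurry r) := continuous_clamp hT hs.continuous_density
  have hwc : Continuous (Function.uncurry w) := continuous_clamp hT hs.continuous_velocity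
  have hrs : ∀ t, Continuous (r t) := fun t => hrc.comp (by fun_prop : Continuous fun x => (t, x))
  have hws : ∀ t, Continuous (w t) := fun t => hwc.comp (by fun_prop : Continuous fun x => (t, x))
  have hrx : ∀ x, Continuous fun t => r t x := fun x =>
    hrc.comp (by fun_prop : Continuous fun t => (t, x))
  have hwx : ∀ x, Continuous fun t => w t x := fun x =>
    hwc.comp (by fun_prop : Continuous fun t => (t, x))
  have hcl : ∀ {p : (ℝ → ℝ) → Prop} {f : ℝ → ℝ → ℝ},
      (∀ t ∈ Icc 0 T, p fun x => f (clampTime T t) x) → ∀ t, p fun x => f (clampTime T t) x := by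
    intro p f h t
    have := h _ (clampTime_mem hT.1 t)
    rwa [clampTime_of_mem (clampTime_mem hT.1 t)] at this
  have hbounds : ∃ m M : ℝ, 0 < m ∧ ∀ t x, m ≤ r t x ∧ r t x ≤ M := by
    obtain ⟨m, M, hm, h⟩ := hs.bounds T hT
    refine ⟨m, M, hm, hcl (p := fun f => ∀ x, m ≤ f x ∧ f x ≤ M) ?_⟩
    have hcl : IsClosed {t | ∀ x, m ≤ r t x ∧ r t x ≤ M} := by
      simp only [Set.ofPred_forall]
      exact isClosed_iInter fun x => (isClosed_le continuous_const (hrx x)).inter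
        (isClosed_le (hrx x) continuous_const)
    refine Icc_subset_of_ae_mem hT.1 hcl ?_
    rw [← restrict_Ioo_eq_restrict_Ioc]
    filter_upwards [ae_restrict_mem measurableSet_Ioo] with t ht x
    simp only [clampTime_of_mem (Ioo_subset_Icc_self ht)]
    exact h t ht x
  obtain ⟨m, M, hm, hmM⟩ := hbounds
  have hrpos : ∀ t x, 0 < r t x := fun t x => hm.trans_le (hmM t x).1
  have hrpow : ∀ p : ℝ, Continuous (Function.uncurry fun t x => r t x ^ p) := fun p =>
    hrc.rpow_const fun z => Or.inl (hrpos z.1 z.2).ne'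
  have hubound : ∃ U : ℝ, ∀ t x, |w t x| ≤ U := by
    obtain ⟨_, g, ⟨_, hgw⟩, hg⟩ := hs.velocity_H1
    obtain ⟨K, hK⟩ := hg T hT
    refine ⟨2 * K, hcl (p := fun f => ∀ x, |f x| ≤ 2 * K) ?_⟩
    have hcl : IsClosed {t | ∀ x, |w t x| ≤ 2 * K} := by
      simp only [Set.ofPred_forall]
      exact isClosed_iInter fun x => isClosed_le (hwx x).abs continuous_const
    refine Icc_subset_of_ae_mem hT.1 hcl ?_
    rw [restrict_Ioo_eq_restrict_Ioc] at hK
    filter_upwards [hK, ae_Ioc_of_ae_Ioo hT.2 hgw, ae_clamp_eq (T := T) u] with t h1 h2 h3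
    change w t = u t at h3
    change ∀ x, |w t x| ≤ 2 * K
    rw [h3]
    exact abs_le_of_H1 h2 (h3 ▸ hws t) h1.1 h1.2
  -- the time derivatives
  obtain ⟨ρt, hρt2, hρt⟩ := hs.density_dt.ae_hasACDeriv hT hs.continuous_density
  obtain ⟨ut, hut2, hut⟩ := hs.velocity_dt.ae_hasACDeriv hT hs.continuous_velocity
  -- the space derivative of the density
  obtain ⟨hdm, g, ⟨hgm, hgw⟩, hg⟩ := hs.density_H1
  obtain ⟨K, hK⟩ := hg T hT
  rw [restrict_Ioo_eq_restrict_Ioc] at hK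
  obtain ⟨hb1, hb2, hb3⟩ := hb.memLp_deriv
  have hrbc : Continuous rbar := hb.smooth.continuous
  set ρx : ℝ → ℝ → ℝ := fun t x => g t x + deriv rbar x with hρxdef
  have hρx : ∀ᵐ t ∂volume.restrict (Ioc 0 T), ∀ a b, HasACDeriv (r t) (ρx t) a b := by
    filter_upwards [ae_Ioc_of_ae_Ioo hT.2 hgw, ae_clamp_eq (T := T) ρ] with t h1 h2 a b
    change r t = ρ t at h2
    have h3 := (h1.hasACDeriv ((h2 ▸ hrs t).sub hrbc) a b).add
      (HasACDeriv.of_hasDerivAt (a := a) (b := b)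
        (fun x => (hb.smooth.differentiable (by simp) x).hasDerivAt) hb1)
    rw [h2]
    simpa using h3
  have hgM : MemLp (Function.uncurry g) 2 (stripMeasure T) :=
    memLp_strip_of_ae (aestronglyMeasurable_stripMeasure hT.2 hgm) (hK.mono fun t h => h.2)
  have hrb' : MemLp (Function.uncurry fun (_ : ℝ) x => deriv rbar x) 2 (stripMeasure T) := by
    refine memLp_strip_of_ae (M := (eLpNorm (deriv rbar) 2 volume).toNNReal) ?_ ?_
    · exact (hb1.comp continuous_snd).aestronglyMeasurable
    · exact ae_of_all _ fun t => by rw [ENNReal.coe_toNNReal hb3.2.ne]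
  have hρx2 : MemLp (Function.uncurry ρx) 2 (stripMeasure T) := hgM.add hrb'
  have hd2 : MemLp (Function.uncurry fun t x => r t x - rbar x) 2 (stripMeasure T) := by
    have h1 : MemLp (Function.uncurry fun t x => ρ t x - rbar x) 2 (stripMeasure T) :=
      memLp_strip_of_ae (aestronglyMeasurable_stripMeasure hT.2 hdm) (hK.mono fun t h => h.1)
    refine h1.ae_eq ?_
    filter_upwards [ae_clamp_eq_strip (T := T) ρ] with z hz
    change ρ z.1 z.2 - rbar z.2 = ρ (clampTime T z.1) z.2 - rbar z.2
    rw [hz]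
  -- the space derivatives of the velocity
  obtain ⟨g1, uxx, ⟨hg1m, hg1w⟩, ⟨hhm, hhw⟩, hL⟩ := hs.velocity_H2
  obtain ⟨hu2, hg12, huxx2⟩ := hL T hT
  rw [volume_restrict_strip] at hu2 hg12 huxx2
  set ux : ℝ → ℝ → ℝ := fun t x => deriv (w t) x with hux
  have hall : ∀ᵐ t ∂volume.restrict (Ioc 0 T), (∀ x, HasDerivAt (w t) (ux t x) x) ∧
      Continuous (ux t) ∧ g1 t =ᵐ[volume] ux t ∧ (∀ a b, HasACDeriv (ux t) (uxx t) a b) ∧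
      HasWeakDeriv (u t) (g1 t) := by
    filter_upwards [ae_Ioc_of_ae_Ioo hT.2 hg1w, ae_Ioc_of_ae_Ioo hT.2 hhw,
      ae_clamp_eq (T := T) u] with t h1 h2 h3
    change w t = u t at h3
    obtain ⟨a1, a2, a3, a4⟩ := h1.deriv_hasACDeriv h2 (h3 ▸ hws t)
    rw [← h3] at a1 a2 a3 a4
    exact ⟨a1, a2, a3, a4, h1⟩
  have huxm : AEStronglyMeasurable (Function.uncurry ux) (stripMeasure T) :=
    (measurable_deriv_with_param hwc).aestronglyMeasurable
  have hux2 : MemLp (Function.uncurry ux) 2 (stripMeasure T) :=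
    hg12.ae_eq (ae_eq_strip_of_ae_ae hg12.1 huxm (hall.mono fun t h => h.2.2.1))
  have hw2 : MemLp (Function.uncurry w) 2 (stripMeasure T) := by
    refine hu2.ae_eq ?_
    filter_upwards [ae_clamp_eq_strip (T := T) u] with z hz using hz.symm
  have hwux : ∀ᵐ t ∂volume.restrict (Ioc 0 T), ∀ a b, HasACDeriv (w t) (ux t) a b :=
    hall.mono fun t h a b => HasACDeriv.of_hasDerivAt h.1 h.2.1
  have huxxA : ∀ᵐ t ∂volume.restrict (Ioc 0 T), ∀ a b, HasACDeriv (ux t) (uxx t) a b :=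
    hall.mono fun t h => h.2.2.2.1
  have lρt := LocInt.of_memLp hρt2
  have lut := LocInt.of_memLp hut2
  have lρx := LocInt.of_memLp hρx2
  have lux := LocInt.of_memLp hux2
  have luxx := LocInt.of_memLp huxx2
  have lr : LocInt T r := .of_continuous hrc
  have lru : LocInt T fun t x => r t x * w t x := .of_continuous (hrc.mul hwc)
  -- the mass equation
  have hmass : ∀ᵐ z ∂stripMeasure T,
      ρt z.1 z.2 + (ρx z.1 z.2 * w z.1 z.2 + r z.1 z.2 * ux z.1 z.2) = 0 := by
    have lJ : LocInt T fun t x => ρx t x * w t x + r t x * ux t x := by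
      refine LocInt.add ?_ (LocInt.continuous_mul hrc lux)
      simpa only [mul_comm] using LocInt.continuous_mul hwc lρx
    refine ae_eq_zero_of_test (F := fun t x => ρt t x + (ρx t x * w t x + r t x * ux t x))
      (lρt.add lJ) fun ψ hψ => ?_
    have e := hs.mass ψ (hψ.mono hT.2.le)
    rw [setIntegral_strip_eq hT.2.le (fun z hz => by
      rw [hψ.dt_eq_zero hz, hψ.dx_eq_zero hz]; ring)] at e
    have i1 := lr.integrable_mul_test (continuous_dt hψ.1) (hasCompactSupport_dt hψ.2.1)
    have i2 := lru.integrable_mul_test (continuous_dx hψ.1) (hasCompactSupport_dx hψ.2.1)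
    have e1 : ∫ z, (r z.1 z.2 * dt ψ z + r z.1 z.2 * w z.1 z.2 * dx ψ z) ∂stripMeasure T = 0 := by
      rw [← e]
      refine integral_congr_ae ?_
      filter_upwards [ae_clamp_eq_strip (T := T) ρ, ae_clamp_eq_strip (T := T) u] with z h1 h2
      simp only [hr, hw, h1, h2]
    have e2 := integral_mul_dt hρt hT.1 lr lρt hψ
    have e3 := integral_mul_dx (F := fun t x => r t x * w t x)
      (F' := fun t x => ρx t x * w t x + r t x * ux t x) (by
        filter_upwards [hρx, hwux] with t h1 h2 a b using (h1 a b).mul (h2 a b)) lru lJ hψ.1 hψ.2.1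
    rw [integral_add i1 i2, e2, e3] at e1
    simp_rw [add_mul (ρt _ _)]
    rw [integral_add (lρt.integrable_mul_test hψ.1.continuous hψ.2.1)
      (lJ.integrable_mul_test hψ.1.continuous hψ.2.1)]
    linarith
  -- the momentum equation
  have hmom : ∀ᵐ z ∂stripMeasure T,
      (ρt z.1 z.2 * w z.1 z.2 + r z.1 z.2 * ut z.1 z.2) +
      (((ρx z.1 z.2 * w z.1 z.2 + r z.1 z.2 * ux z.1 z.2) * w z.1 z.2 +
        (r z.1 z.2 * w z.1 z.2) * ux z.1 z.2) -
        (α * r z.1 z.2 ^ (α - 1) * ρx z.1 z.2 * ux z.1 z.2 + r z.1 z.2 ^ α * uxx z.1 z.2) +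
        a * (γ * r z.1 z.2 ^ (γ - 1) * ρx z.1 z.2)) = 0 := by
    have hρu : Integrable (Function.uncurry fun t x => ρx t x * ux t x) (stripMeasure T) :=
      hρx2.integrable_mul hux2
    have lFt : LocInt T fun t x => ρt t x * w t x + r t x * ut t x := by
      refine LocInt.add ?_ (LocInt.continuous_mul hrc lut)
      simpa only [mul_comm] using LocInt.continuous_mul hwc lρt
    have crw : Continuous (Function.uncurry fun t x => r t x * w t x) := hrc.mul hwc
    have crww : Continuous (Function.uncurry fun t x => r t x * w t x * w t x) := crw.mul hwc
    have cww : Continuous (Function.uncurry fun t x => w t x * w t x) := hwc.mul hwc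
    have ck : ∀ k p : ℝ, Continuous (Function.uncurry fun t x => k * r t x ^ p) := fun k p =>
      continuous_const.mul (hrpow p)
    have lG : LocInt T fun t x => r t x * w t x * w t x - r t x ^ α * ux t x + a * r t x ^ γ :=
      ((LocInt.of_continuous crww).sub
        (LocInt.continuous_mul (hrpow α) lux)).add
        (LocInt.of_continuous (ck a γ))
    have lG' : LocInt T fun t x => ((ρx t x * w t x + r t x * ux t x) * w t x +
        (r t x * w t x) * ux t x) -
        (α * r t x ^ (α - 1) * ρx t x * ux t x + r t x ^ α * uxx t x) +
        a * (γ * r t x ^ (γ - 1) * ρx t x) := by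
      have k1 := LocInt.continuous_mul cww lρx
      have k2 := LocInt.continuous_mul crw lux
      have k3 := LocInt.continuous_mul (ck α (α - 1))
        (LocInt.of_integrable hρu)
      have k4 := LocInt.continuous_mul (hrpow α) luxx
      have k5 := LocInt.continuous_mul (ck (a * γ) (γ - 1)) lρx
      refine (((k1.add (k2.add k2)).sub (k3.add k4)).add k5).congr (ae_of_all _ fun z => ?_)
      ring
    refine ae_eq_zero_of_test (F := fun t x => (ρt t x * w t x + r t x * ut t x) +
      (((ρx t x * w t x + r t x * ux t x) * w t x +
        (r t x * w t x) * ux t x) -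
        (α * r t x ^ (α - 1) * ρx t x * ux t x + r t x ^ α * uxx t x) +
        a * (γ * r t x ^ (γ - 1) * ρx t x))) (lFt.add lG') fun ψ hψ => ?_
    obtain ⟨ux', ⟨hux'm, hux'w⟩, hmo⟩ := hs.momentum
    have hux' : ∀ᵐ z ∂stripMeasure T, ux' z.1 z.2 = ux z.1 z.2 := by
      refine ae_eq_strip_of_ae_ae (aestronglyMeasurable_stripMeasure hT.2 hux'm) huxm ?_
      filter_upwards [ae_Ioc_of_ae_Ioo hT.2 hux'w, hall] with t h1 h2
      exact (h1.ae_eq h2.2.2.2.2).trans h2.2.2.1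
    have e := hmo ψ (hψ.mono hT.2.le)
    rw [setIntegral_strip_eq hT.2.le (fun z hz => by
      rw [hψ.dt_eq_zero hz, hψ.dx_eq_zero hz]; ring)] at e
    have i1 := lru.integrable_mul_test (continuous_dt hψ.1) (hasCompactSupport_dt hψ.2.1)
    have i2 := lG.integrable_mul_test (continuous_dx hψ.1) (hasCompactSupport_dx hψ.2.1)
    have e1 : ∫ z, (r z.1 z.2 * w z.1 z.2 * dt ψ z + (r z.1 z.2 * w z.1 z.2 * w z.1 z.2 -
        r z.1 z.2 ^ α * ux z.1 z.2 + a * r z.1 z.2 ^ γ) * dx ψ z) ∂stripMeasure T = 0 := by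
      rw [← e]
      refine integral_congr_ae ?_
      filter_upwards [ae_clamp_eq_strip (T := T) ρ, ae_clamp_eq_strip (T := T) u, hux']
        with z h1 h2 h3
      simp only [hr, hw, h1, h2, h3, visc, pressure]
      ring
    have e2 := integral_mul_dt (F := fun t x => r t x * w t x)
      (F' := fun t x => ρt t x * w t x + r t x * ut t x) (by
        filter_upwards [hρt, hut] with x h1 h2 using h1.mul h2) hT.1 lru lFt hψ
    have e3 := integral_mul_dx
      (F := fun t x => r t x * w t x * w t x - r t x ^ α * ux t x + a * r t x ^ γ) (by
        filter_upwards [hρx, hwux, huxxA] with t h1 h2 h3 p q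
        exact ((((h1 p q).mul (h2 p q)).mul (h2 p q)).sub
          (((h1 p q).rpow hm (hmM t) α).mul (h3 p q))).add
            (((h1 p q).rpow hm (hmM t) γ).const_mul a)) lG lG' hψ.1 hψ.2.1
    rw [integral_add i1 i2, e2, e3] at e1
    simp_rw [add_mul (ρt _ _ * w _ _ + r _ _ * ut _ _)]
    rw [integral_add (lFt.integrable_mul_test hψ.1.continuous hψ.2.1)
      (lG'.integrable_mul_test hψ.1.continuous hψ.2.1)]
    linarith
  refine ⟨ρt, ut, ρx, ux, uxx, ⟨hT.1, hrc, hwc, ⟨m, M, hm, hmM⟩, hubound, hρt, hut, hρx, hwux,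
    huxxA, hd2, hw2, hρt2, hut2, hρx2, hux2, huxx2, hmass, ?_⟩⟩
  filter_upwards [hmass, hmom] with z h1 h2
  linear_combination h2 - w z.1 z.2 * h1

/-! ### Balance laws -/

lemma uIoc_subset_of_mem_Icc {T t : ℝ} (ht : t ∈ Icc 0 T) : uIoc 0 t ⊆ Ioc 0 T := by
  rw [uIoc_of_le ht.1]; exact Ioc_subset_Ioc_right ht.2

lemma ae_mem_uIoc {T t : ℝ} (ht : t ∈ Icc 0 T) {p : ℝ → Prop}
    (h : ∀ᵐ s ∂volume.restrict (Ioc 0 T), p s) : ∀ᵐ s, s ∈ uIoc 0 t → p s := by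
  rw [ae_restrict_iff' measurableSet_Ioc] at h
  filter_upwards [h] with s hs hm using hs (uIoc_subset_of_mem_Icc ht hm)

lemma HasACDeriv.sub_eq_integral {f g : ℝ → ℝ} {T t : ℝ} (h : HasACDeriv f g 0 T)
    (ht : t ∈ Icc 0 T) : f t - f 0 = ∫ s in (0 : ℝ)..t, g s := by
  refine (h.mono ?_).integral_eq_sub.symm
  rw [uIcc_of_le ht.1, uIcc_of_le (ht.1.trans ht.2)]
  exact Icc_subset_Icc_right ht.2

/-- Integrated conservation law `∂ₜe + ∂ₓJ = R` on the whole line. -/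
theorem balance {T : ℝ} {e et R J : ℝ → ℝ → ℝ}
    (het : Integrable (Function.uncurry et) (stripMeasure T))
    (htime : ∀ᵐ x, HasACDeriv (fun t => e t x) (fun t => et t x) 0 T)
    (hR : Integrable (Function.uncurry R) (stripMeasure T))
    (hJi : ∀ᵐ t ∂volume.restrict (Ioc 0 T), Integrable (J t))
    (hJ : ∀ᵐ t ∂volume.restrict (Ioc 0 T),
      ∀ a b, HasACDeriv (J t) (fun x => R t x - et t x) a b) {t : ℝ} (ht : t ∈ Icc 0 T) :
    Integrable (fun x => e t x - e 0 x) ∧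
      ∫ x, (e t x - e 0 x) = ∫ s in (0 : ℝ)..t, ∫ x, R s x := by
  have hae : ∀ᵐ x, ∫ s in (0 : ℝ)..t, et s x = e t x - e 0 x := by
    filter_upwards [htime] with x hx using (hx.sub_eq_integral ht).symm
  have het' : Integrable (Function.uncurry et) ((volume.restrict (uIoc 0 t)).prod volume) :=
    het.mono_measure (Measure.prod_mono (Measure.restrict_mono (uIoc_subset_of_mem_Icc ht) le_rfl)
      le_rfl)
  constructor
  · refine Integrable.congr ?_ hae
    simp_rw [intervalIntegral.integral_of_le ht.1]
    rw [uIoc_of_le ht.1] at het'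
    exact het'.integral_prod_right
  · rw [← integral_congr_ae hae, ← intervalIntegral_integral_swap het']
    refine intervalIntegral.integral_congr_ae (ae_mem_uIoc ht ?_)
    filter_upwards [hJi, hJ, het.prod_right_ae, hR.prod_right_ae] with s h1 h2 h3 h4
    have h3' : Integrable (et s) := h3
    have h4' : Integrable (R s) := h4
    have := integral_eq_zero_of_hasACDeriv h2 h1 (h4'.sub h3')
    rw [integral_sub h4' h3'] at this
    change ∫ x, et s x = ∫ x, R s x
    linarith

/-- Integrated conservation law `∂ₜe + ∂ₓJ = R` on a bounded interval. -/
theorem local_balance {T : ℝ} {e et R J : ℝ → ℝ → ℝ} (het : LocInt T et)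
    (htime : ∀ᵐ x, HasACDeriv (fun t => e t x) (fun t => et t x) 0 T)
    (hR : LocInt T R)
    (hJ : ∀ᵐ t ∂volume.restrict (Ioc 0 T),
      ∀ a b, HasACDeriv (J t) (fun x => R t x - et t x) a b) {t : ℝ} (ht : t ∈ Icc 0 T)
    (a b : ℝ) :
    ∫ x in a..b, (e t x - e 0 x) =
      ∫ s in (0 : ℝ)..t, ((∫ x in a..b, R s x) - (J s b - J s a)) := by
  have hae : ∀ᵐ x, ∫ s in (0 : ℝ)..t, et s x = e t x - e 0 x := by
    filter_upwards [htime] with x hx using (hx.sub_eq_integral ht).symm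
  have het_box := het.integrable_uIoc ht a b
  rw [← uIoc_of_le ht.1] at het_box
  rw [← intervalIntegral.integral_congr_ae (hae.mono fun x hx _ => hx),
    ← intervalIntegral_intervalIntegral_swap het_box]
  refine intervalIntegral.integral_congr_ae (ae_mem_uIoc ht ?_)
  have hloc : ∀ {F : ℝ → ℝ}, (∀ N : ℝ, IntegrableOn F (Icc (-N) N)) →
      IntervalIntegrable F volume a b := fun {F} hF => by
    rw [intervalIntegrable_iff]
    refine (hF (max |a| |b|)).mono_set (uIoc_subset_uIcc.trans (uIcc_subset_Icc ?_ ?_))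
    · exact abs_le.1 (le_max_left _ _)
    · exact abs_le.1 (le_max_right _ _)
  filter_upwards [hJ, het.ae_space, hR.ae_space] with s h1 h2 h3
  have := (h1 a b).integral_eq_sub
  rw [intervalIntegral.integral_sub (hloc h3) (hloc h2)] at this
  linarith

/-- Bounded continuous functions of time and space. -/
def BddCont (k : ℝ → ℝ → ℝ) : Prop :=
  Continuous (Function.uncurry k) ∧ ∃ C, ∀ t x, |k t x| ≤ C

namespace BddCont

variable {k l : ℝ → ℝ → ℝ} {T : ℝ} {f g : ℝ → ℝ → ℝ}

lemma mul (hk : BddCont k) (hl : BddCont l) : BddCont fun t x => k t x * l t x := by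
  obtain ⟨h1, C, hC⟩ := hk
  obtain ⟨h2, D, hD⟩ := hl
  refine ⟨h1.mul h2, C * D, fun t x => ?_⟩
  rw [abs_mul]
  exact mul_le_mul (hC t x) (hD t x) (abs_nonneg _) ((abs_nonneg _).trans (hC t x))

lemma const (c : ℝ) : BddCont fun _ _ => c := ⟨continuous_const, |c|, fun _ _ => le_rfl⟩

lemma pow (hk : BddCont k) : ∀ n : ℕ, BddCont fun t x => k t x ^ n
  | 0 => by simpa using const 1
  | n + 1 => by simpa only [pow_succ] using (pow hk n).mul hk

lemma integrable_mul (hk : BddCont k) (hf : MemLp (Function.uncurry f) 2 (stripMeasure T))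
    (hg : MemLp (Function.uncurry g) 2 (stripMeasure T)) :
    Integrable (Function.uncurry fun t x => k t x * (f t x * g t x)) (stripMeasure T) := by
  obtain ⟨h1, C, hC⟩ := hk
  exact (hf.integrable_mul hg).bdd_mul (c := C) h1.aestronglyMeasurable
    (ae_of_all _ fun z => hC z.1 z.2)

lemma memLp_mul (hk : BddCont k) (hf : MemLp (Function.uncurry f) 2 (stripMeasure T)) :
    MemLp (Function.uncurry fun t x => k t x * f t x) 2 (stripMeasure T) := by
  obtain ⟨h1, C, hC⟩ := hk
  refine hf.of_le_mul (c := C) (h1.aestronglyMeasurable.mul hf.1) (ae_of_all _ fun z => ?_)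
  change |k z.1 z.2 * f z.1 z.2| ≤ C * |f z.1 z.2|
  rw [abs_mul]
  exact mul_le_mul_of_nonneg_right (hC _ _) (abs_nonneg _)

end BddCont

lemma bddCont_rpow {ρ : ℝ → ℝ → ℝ} {m M : ℝ} (hρ : Continuous (Function.uncurry ρ)) (hm : 0 < m)
    (h : ∀ t x, m ≤ ρ t x ∧ ρ t x ≤ M) (p : ℝ) : BddCont fun t x => ρ t x ^ p := by
  obtain ⟨C, hC⟩ := isCompact_Icc.exists_bound_of_continuousOn (continuousOn_rpow_Icc hm p (M := M))
  exact ⟨hρ.rpow_const fun z => Or.inl (hm.trans_le (h z.1 z.2).1).ne', C,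
    fun t x => hC _ (h t x)⟩

section Flow

variable {a α γ T : ℝ} {rbar : ℝ → ℝ} {ρ u ρt ut ρx ux uxx : ℝ → ℝ → ℝ}

namespace RegularFlow

lemma density_pos (hF : RegularFlow a α γ T rbar ρ u ρt ut ρx ux uxx) (t x : ℝ) : 0 < ρ t x := by
  obtain ⟨m, M, hm, h⟩ := hF.density_bounds
  exact hm.trans_le (h t x).1

lemma bdd_rpow (hF : RegularFlow a α γ T rbar ρ u ρt ut ρx ux uxx) (p : ℝ) :
    BddCont fun t x => ρ t x ^ p := by
  obtain ⟨m, M, hm, h⟩ := hF.density_bounds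
  exact bddCont_rpow hF.cont_density hm h p

lemma bdd_density (hF : RegularFlow a α γ T rbar ρ u ρt ut ρx ux uxx) : BddCont ρ := by
  simpa using hF.bdd_rpow 1

lemma bdd_velocity (hF : RegularFlow a α γ T rbar ρ u ρt ut ρx ux uxx) : BddCont u :=
  ⟨hF.cont_velocity, hF.velocity_bound⟩

lemma cont_density_space (hF : RegularFlow a α γ T rbar ρ u ρt ut ρx ux uxx) (t : ℝ) :
    Continuous (ρ t) := hF.cont_density.comp (by fun_prop : Continuous fun x => (t, x))

lemma integrable_dissipation (hF : RegularFlow a α γ T rbar ρ u ρt ut ρx ux uxx) (k : ℕ) :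
    Integrable (Function.uncurry fun t x => u t x ^ k * ρ t x ^ α * ux t x ^ 2)
      (stripMeasure T) := by
  have := ((hF.bdd_velocity.pow k).mul (hF.bdd_rpow α)).integrable_mul hF.memLp_ux hF.memLp_ux
  simpa only [pow_two] using this

lemma integrable_work (hF : RegularFlow a α γ T rbar ρ u ρt ut ρx ux uxx) (k : ℕ) :
    Integrable (Function.uncurry fun t x =>
      u t x ^ (k + 1) * (a * γ * ρ t x ^ (γ - 1) * ρx t x)) (stripMeasure T) := by
  refine (((hF.bdd_velocity.pow k).mul ((BddCont.const (a * γ)).mul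
    (hF.bdd_rpow (γ - 1)))).integrable_mul hF.memLp_velocity hF.memLp_ρx).congr
    (ae_of_all _ fun z => ?_)
  simp only [Function.uncurry]
  ring

/-- Balance law for the moments `∫ ρ u^(k+2)`. -/
theorem balance_moment (hF : RegularFlow a α γ T rbar ρ u ρt ut ρx ux uxx) (k : ℕ) {t : ℝ}
    (ht : t ∈ Icc 0 T) :
    Integrable (fun x => ρ t x * u t x ^ (k + 2) - ρ 0 x * u 0 x ^ (k + 2)) ∧
      ∫ x, (ρ t x * u t x ^ (k + 2) - ρ 0 x * u 0 x ^ (k + 2)) =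
        ∫ s in (0 : ℝ)..t, ∫ x, (-((k + 2) * (k + 1)) * (u s x ^ k * ρ s x ^ α * ux s x ^ 2) -
          (k + 2) * (u s x ^ (k + 1) * (a * γ * ρ s x ^ (γ - 1) * ρx s x))) := by
  obtain ⟨m, M, hm, hmM⟩ := hF.density_bounds
  have bu := hF.bdd_velocity
  have br := hF.bdd_density
  refine balance (e := fun t x => ρ t x * u t x ^ (k + 2))
    (et := fun t x => ρt t x * u t x ^ (k + 2) +
      ρ t x * (((k + 2 : ℕ) : ℝ) * u t x ^ (k + 2 - 1) * ut t x))
    (J := fun t x => ρ t x * u t x * u t x ^ (k + 2) -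
      (k + 2) * (u t x ^ (k + 1) * (ρ t x ^ α * ux t x)))
    ?_ ?_ ?_ ?_ ?_ ht
  · refine (((bu.pow (k + 1)).integrable_mul hF.memLp_ρt hF.memLp_velocity).add
      (((BddCont.const (k + 2 : ℝ)).mul (br.mul (bu.pow k))).integrable_mul hF.memLp_velocity
        hF.memLp_ut)).congr (ae_of_all _ fun z => ?_)
    simp only [Function.uncurry, Pi.add_apply, Nat.cast_add, Nat.cast_ofNat,
      show k + 2 - 1 = k + 1 by omega]
    ring
  · filter_upwards [hF.time_density, hF.time_velocity] with x h1 h2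
    exact h1.mul (h2.pow (k + 2))
  · refine (((hF.integrable_dissipation k).const_mul (-((k + 2) * (k + 1) : ℝ))).sub
      ((hF.integrable_work k).const_mul (k + 2 : ℝ))).congr (ae_of_all _ fun z => ?_)
    rfl
  · have h1 := (br.mul (bu.pow (k + 1))).integrable_mul hF.memLp_velocity hF.memLp_velocity
    have h2 := ((BddCont.const (k + 2 : ℝ)).mul ((bu.pow k).mul (hF.bdd_rpow α))).integrable_mul
      hF.memLp_velocity hF.memLp_ux
    filter_upwards [(h1.sub h2).prod_right_ae] with t ht
    refine ht.congr (ae_of_all _ fun x => ?_)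
    simp only [Function.uncurry, Pi.sub_apply]
    ring
  · filter_upwards [hF.space_density, hF.space_velocity, hF.space_gradient,
      Measure.ae_ae_of_ae_prod hF.mass, Measure.ae_ae_of_ae_prod hF.momentum]
      with t h1 h2 h3 h4 h5 p q
    refine ((((h1 p q).mul (h2 p q)).mul ((h2 p q).pow (k + 2))).sub
      ((((h2 p q).pow (k + 1)).mul (((h1 p q).rpow hm (hmM t) α).mul (h3 p q))).const_mul
        ((k : ℝ) + 2))).congr_right ?_
    filter_upwards [h4, h5] with x h4 h5 _
    simp only [Nat.add_one_sub_one, Nat.cast_add, Nat.cast_ofNat, Nat.cast_one,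
      show k + 2 - 1 = k + 1 by omega]
    linear_combination (u t x ^ (k + 2)) * h4 + (k + 2) * u t x ^ (k + 1) * h5

end RegularFlow

/-! ### The potential energy -/

/-- The internal energy density `a r ^ γ / (γ - 1)`. -/
noncomputable def potential (a γ r : ℝ) : ℝ := a / (γ - 1) * r ^ γ

/-- The derivative of the internal energy density. -/
noncomputable def enthalpy (a γ r : ℝ) : ℝ := a * γ / (γ - 1) * r ^ (γ - 1)

/-- The internal energy density of `r` relative to `s`. -/
noncomputable def relPotential (a γ r s : ℝ) : ℝ :=
  potential a γ r - potential a γ s - enthalpy a γ s * (r - s)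

lemma hasDerivAt_potential (a γ : ℝ) {r : ℝ} (hr : 0 < r) :
    HasDerivAt (potential a γ) (enthalpy a γ r) r := by
  refine ((hasDerivAt_rpow_of_pos γ hr).const_mul (a / (γ - 1))).congr_deriv ?_
  rw [enthalpy]; ring

lemma hasDerivAt_enthalpy (a : ℝ) {γ r : ℝ} (hγ : 1 < γ) (hr : 0 < r) :
    HasDerivAt (enthalpy a γ) (a * γ * r ^ (γ - 2)) r := by
  refine ((hasDerivAt_rpow_of_pos (γ - 1) hr).const_mul (a * γ / (γ - 1))).congr_deriv ?_
  have : γ - 1 ≠ 0 := by linarith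
  rw [show γ - 1 - 1 = γ - 2 by ring]
  field_simp

lemma exists_lipschitz_enthalpy (a : ℝ) {γ m M : ℝ} (hγ : 1 < γ) (hm : 0 < m) :
    ∃ C, ∀ r ∈ Icc m M, ∀ s ∈ Icc m M,
      |enthalpy a γ r - enthalpy a γ s| ≤ C * |r - s| ∧
      |relPotential a γ r s| ≤ C * (r - s) ^ 2 := by
  obtain ⟨C, hC⟩ := isCompact_Icc.exists_bound_of_continuousOn
    ((continuousOn_rpow_Icc hm (γ - 2) (M := M)).const_smul (a * γ))
  have h1 : ∀ r ∈ Icc m M, ∀ s ∈ Icc m M,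
      |enthalpy a γ r - enthalpy a γ s| ≤ C * |r - s| := fun r hr s hs =>
    (convex_Icc m M).norm_image_sub_le_of_norm_hasDerivWithin_le (f := enthalpy a γ)
      (f' := fun r => a * γ * r ^ (γ - 2))
      (fun x hx => (hasDerivAt_enthalpy a hγ (hm.trans_le hx.1)).hasDerivWithinAt)
      (fun x hx => by simpa using hC x hx) hs hr
  refine ⟨C, fun r hr s hs => ⟨h1 r hr s hs, ?_⟩⟩
  have hC0 : 0 ≤ C := (norm_nonneg _).trans (hC r hr)
  have hsub : uIcc s r ⊆ Icc m M := ordConnected_Icc.uIcc_subset hs hr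
  have h2 := (convex_uIcc s r).norm_image_sub_le_of_norm_hasDerivWithin_le
    (f := fun y => potential a γ y - enthalpy a γ s * y)
    (f' := fun y => enthalpy a γ y - enthalpy a γ s) (C := C * |r - s|) (x := s) (y := r)
    (fun x hx => ((hasDerivAt_potential a γ (hm.trans_le (hsub hx).1)).sub
      (by simpa using (hasDerivAt_id x).const_mul (enthalpy a γ s))).hasDerivWithinAt)
    (fun x hx => (h1 x (hsub hx) s hs).trans (mul_le_mul_of_nonneg_left
      (abs_sub_left_of_mem_uIcc hx) hC0)) left_mem_uIcc right_mem_uIcc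
  rw [Real.norm_eq_abs, Real.norm_eq_abs] at h2
  have h3 : relPotential a γ r s = potential a γ r - enthalpy a γ s * r -
      (potential a γ s - enthalpy a γ s * s) := by rw [relPotential]; ring
  rw [h3]
  refine h2.trans (le_of_eq ?_)
  rw [mul_assoc, ← pow_two, sq_abs]

lemma IsBackground.bounds {rbar : ℝ → ℝ} {rm rp : ℝ} (h : IsBackground rbar rm rp) :
    ∃ m M, 0 < m ∧ ∀ x, m ≤ rbar x ∧ rbar x ≤ M := by
  refine ⟨min rm rp, max rm rp, lt_min h.minus_pos h.plus_pos, fun x => ?_⟩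
  have h1 := h.left (min x (-1)) (min_le_right _ _)
  have h2 := h.right (max x 1) (le_max_right _ _)
  rcases h.mono with hm | hm
  · have a1 := hm (min_le_left x (-1))
    have a2 := hm (le_max_left x 1)
    rw [h1] at a1; rw [h2] at a2
    exact ⟨(min_le_left _ _).trans a1, a2.trans (le_max_right _ _)⟩
  · have a1 := hm (min_le_left x (-1))
    have a2 := hm (le_max_left x 1)
    rw [h1] at a1; rw [h2] at a2
    exact ⟨(min_le_right _ _).trans a2, a1.trans (le_max_left _ _)⟩

lemma IsBackground.memLp_strip {rbar : ℝ → ℝ} {rm rp : ℝ} (h : IsBackground rbar rm rp) (T : ℝ) :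
    MemLp (Function.uncurry fun (_ : ℝ) x => deriv rbar x) 2 (stripMeasure T) := by
  obtain ⟨h1, -, h3⟩ := h.memLp_deriv
  refine memLp_strip_of_ae (M := (eLpNorm (deriv rbar) 2 volume).toNNReal) ?_ ?_
  · exact (h1.comp continuous_snd).aestronglyMeasurable
  · exact ae_of_all _ fun t => by rw [ENNReal.coe_toNNReal h3.2.ne]

namespace RegularFlow

variable {rm rp : ℝ}

lemma exists_common_bounds (hF : RegularFlow a α γ T rbar ρ u ρt ut ρx ux uxx)
    (hb : IsBackground rbar rm rp) :
    ∃ m M, 0 < m ∧ (∀ t x, ρ t x ∈ Icc m M) ∧ ∀ x, rbar x ∈ Icc m M := by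
  obtain ⟨m, M, hm, h⟩ := hF.density_bounds
  obtain ⟨m', M', hm', h'⟩ := hb.bounds
  exact ⟨min m m', max M M', lt_min hm hm',
    fun t x => ⟨(min_le_left _ _).trans (h t x).1, (h t x).2.trans (le_max_left _ _)⟩,
    fun x => ⟨(min_le_right _ _).trans (h' x).1, (h' x).2.trans (le_max_right _ _)⟩⟩

lemma integrable_source (hF : RegularFlow a α γ T rbar ρ u ρt ut ρx ux uxx)
    (hb : IsBackground rbar rm rp) :
    Integrable (Function.uncurry fun t x =>
      ρ t x * u t x * (a * γ * rbar x ^ (γ - 2) * deriv rbar x)) (stripMeasure T) := by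
  obtain ⟨m, M, hm, h1, h2⟩ := hF.exists_common_bounds hb
  have hb2 : BddCont fun (_ : ℝ) x => rbar x ^ (γ - 2) :=
    bddCont_rpow (ρ := fun _ x => rbar x) (hb.smooth.continuous.comp continuous_snd) hm
      (fun _ x => h2 x) _
  refine ((hF.bdd_density.mul ((BddCont.const (a * γ)).mul hb2)).integrable_mul
    hF.memLp_velocity (hb.memLp_strip T)).congr (ae_of_all _ fun z => ?_)
  simp only [Function.uncurry]
  ring

/-- Balance law for the relative potential energy. -/
theorem balance_potential (hF : RegularFlow a α γ T rbar ρ u ρt ut ρx ux uxx) (hγ : 1 < γ)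
    (hb : IsBackground rbar rm rp) {t : ℝ} (ht : t ∈ Icc 0 T) :
    Integrable (fun x => relPotential a γ (ρ t x) (rbar x) - relPotential a γ (ρ 0 x) (rbar x)) ∧
      ∫ x, (relPotential a γ (ρ t x) (rbar x) - relPotential a γ (ρ 0 x) (rbar x)) =
        ∫ s in (0 : ℝ)..t, ∫ x, (u s x * (a * γ * ρ s x ^ (γ - 1) * ρx s x) -
          ρ s x * u s x * (a * γ * rbar x ^ (γ - 2) * deriv rbar x)) := by
  obtain ⟨m, M, hm, h1, h2⟩ := hF.exists_common_bounds hb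
  obtain ⟨C, hC⟩ := exists_lipschitz_enthalpy a (M := M) hγ hm
  have hentc : Continuous (Function.uncurry fun t x =>
      enthalpy a γ (ρ t x) - enthalpy a γ (rbar x)) := by
    refine Continuous.sub (continuous_const.mul (hF.bdd_rpow (γ - 1)).1) ?_
    refine continuous_const.mul ((hb.smooth.continuous.comp continuous_snd).rpow_const
      fun z => Or.inl (hm.trans_le (h2 z.2).1).ne')
  have hent : MemLp (Function.uncurry fun t x => enthalpy a γ (ρ t x) - enthalpy a γ (rbar x)) 2
      (stripMeasure T) :=
    hF.memLp_density.of_le_mul (c := C) hentc.aestronglyMeasurable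
      (ae_of_all _ fun z => (hC _ (h1 z.1 z.2) _ (h2 z.2)).1)
  refine balance (e := fun t x => relPotential a γ (ρ t x) (rbar x))
    (et := fun t x => (enthalpy a γ (ρ t x) - enthalpy a γ (rbar x)) * ρt t x)
    (J := fun t x => (enthalpy a γ (ρ t x) - enthalpy a γ (rbar x)) * (ρ t x * u t x))
    ?_ ?_ ?_ ?_ ?_ ht
  · exact hent.integrable_mul hF.memLp_ρt
  · filter_upwards [hF.time_density] with x hx
    have := hx.comp (m := m) (M := M) (Φ := fun r => relPotential a γ r (rbar x))
      (Φ' := fun r => enthalpy a γ r - enthalpy a γ (rbar x)) (fun r hr => ?_) ?_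
      (fun t _ => h1 t x)
    · exact this
    · have := ((hasDerivAt_potential a γ (hm.trans_le hr.1)).sub_const
        (potential a γ (rbar x))).sub (((hasDerivAt_id r).sub_const (rbar x)).const_mul
          (enthalpy a γ (rbar x)))
      simpa [relPotential] using! this
    · exact ((continuousOn_rpow_Icc hm (γ - 1)).const_smul (a * γ / (γ - 1))).sub
        continuousOn_const
  · refine ((hF.integrable_work 0).sub (hF.integrable_source hb)).congr (ae_of_all _ fun z => ?_)
    simp [Function.uncurry]
  · have := hF.bdd_density.integrable_mul hent hF.memLp_velocity
    filter_upwards [this.prod_right_ae] with t ht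
    refine ht.congr (ae_of_all _ fun x => ?_)
    simp only [Function.uncurry]
    ring
  · filter_upwards [hF.space_density, hF.space_velocity, Measure.ae_ae_of_ae_prod hF.mass]
      with t k1 k2 k3 p q
    have hbar : HasACDeriv rbar (deriv rbar) p q := HasACDeriv.of_hasDerivAt
      (fun x => (hb.smooth.differentiable (by simp) x).hasDerivAt) hb.memLp_deriv.1
    have hΦ : ∀ r ∈ Icc m M, HasDerivAt (enthalpy a γ) (a * γ * r ^ (γ - 2)) r :=
      fun r hr => hasDerivAt_enthalpy a hγ (hm.trans_le hr.1)
    have hΦc : ContinuousOn (fun r => a * γ * r ^ (γ - 2)) (Icc m M) :=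
      (continuousOn_rpow_Icc hm (γ - 2)).const_smul (a * γ)
    refine ((((k1 p q).comp hΦ hΦc fun x _ => h1 t x).sub
      (hbar.comp hΦ hΦc fun x _ => h2 x)).mul ((k1 p q).mul (k2 p q))).congr_right ?_
    filter_upwards [k3] with x k3 _
    have e1 : ρ t x ^ (γ - 1) = ρ t x ^ (γ - 2) * ρ t x := by
      rw [← Real.rpow_add_one (hF.density_pos t x).ne']; ring_nf
    rw [e1]
    linear_combination (enthalpy a γ (ρ t x) - enthalpy a γ (rbar x)) * k3

/-- Integration by parts in the pressure term of the fourth moment. -/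
lemma integral_work_cube (hF : RegularFlow a α γ T rbar ρ u ρt ut ρx ux uxx) :
    Integrable (Function.uncurry fun t x => a * ρ t x ^ γ * u t x ^ 2 * ux t x)
      (stripMeasure T) ∧
    ∀ᵐ t ∂volume.restrict (Ioc 0 T), ∫ x, u t x ^ 3 * (a * γ * ρ t x ^ (γ - 1) * ρx t x) =
      -3 * ∫ x, a * ρ t x ^ γ * u t x ^ 2 * ux t x := by
  obtain ⟨m, M, hm, hmM⟩ := hF.density_bounds
  have i1 : Integrable (Function.uncurry fun t x => a * ρ t x ^ γ * u t x ^ 2 * ux t x)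
      (stripMeasure T) := by
    refine (((BddCont.const a).mul ((hF.bdd_rpow γ).mul hF.bdd_velocity)).integrable_mul
      hF.memLp_velocity hF.memLp_ux).congr (ae_of_all _ fun z => ?_)
    simp only [Function.uncurry]
    ring
  refine ⟨i1, ?_⟩
  have i2 := ((BddCont.const a).mul ((hF.bdd_rpow γ).mul hF.bdd_velocity)).integrable_mul
      hF.memLp_velocity hF.memLp_velocity
  filter_upwards [hF.space_density, hF.space_velocity, i1.prod_right_ae, i2.prod_right_ae,
    (hF.integrable_work 2).prod_right_ae] with t h1 h2 j1 j2 j3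
  have hac : ∀ p q, HasACDeriv (fun x => a * ρ t x ^ γ * u t x ^ 3) (fun x =>
      u t x ^ 3 * (a * γ * ρ t x ^ (γ - 1) * ρx t x) + 3 * (a * ρ t x ^ γ * u t x ^ 2 * ux t x))
      p q := fun p q => by
    refine ((((h1 p q).rpow hm (hmM t) γ).const_mul a).mul ((h2 p q).pow 3)).congr_right
      (ae_of_all _ fun x _ => ?_)
    push_cast
    ring
  have j4 : Integrable fun x => a * ρ t x ^ γ * u t x ^ 3 := by
    refine j2.congr (ae_of_all _ fun x => ?_)
    simp only [Function.uncurry]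
    ring
  have := integral_eq_zero_of_hasACDeriv hac j4 (j3.add (j1.const_mul 3))
  have e := integral_add j3 (j1.const_mul 3)
  simp only [Function.uncurry] at e
  rw [e, integral_const_mul] at this
  linarith

end RegularFlow

end Flow

/-! ### Integrals with a moving endpoint -/

lemma continuous_integral_segment {f : ℝ → ℝ → ℝ} (hf : Continuous (Function.uncurry f))
    {X : ℝ → ℝ} {s : ℝ} (hX : ContinuousAt X s) (c : ℝ) :
    ContinuousAt (fun r => ∫ θ in (0 : ℝ)..1, f r (c + θ * (X r - c))) s := by
  have h : Continuous fun p : ℝ × ℝ => ∫ θ in (0 : ℝ)..1, f p.1 (c + θ * (p.2 - c)) := by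
    refine intervalIntegral.continuous_parametric_intervalIntegral_of_continuous'
      (f := fun p : ℝ × ℝ => fun θ => f p.1 (c + θ * (p.2 - c))) ?_ 0 1
    exact hf.comp (by fun_prop : Continuous fun q : (ℝ × ℝ) × ℝ =>
      (q.1.1, c + q.2 * (q.1.2 - c)))
  exact h.continuousAt.comp (f := fun r => (r, X r)) (continuousAt_id.prodMk hX)

lemma integral_segment (f : ℝ → ℝ) (c d : ℝ) :
    ∫ x in c..d, f x = (d - c) * ∫ θ in (0 : ℝ)..1, f (c + θ * (d - c)) := by
  have := intervalIntegral.mul_integral_comp_add_mul (f := f) (a := 0) (b := 1) (d - c) c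
  simp only [mul_comm] at this ⊢
  rw [this]; simp

lemma hasDerivAt_mul_of_eq_zero {f g : ℝ → ℝ} {f' s : ℝ} (hf : HasDerivAt f f' s) (h0 : f s = 0)
    (hg : ContinuousAt g s) : HasDerivAt (fun r => f r * g r) (f' * g s) s := by
  rw [hasDerivAt_iff_tendsto_slope] at hf ⊢
  refine (hf.mul (hg.tendsto.mono_left nhdsWithin_le_nhds)).congr fun r => ?_
  simp only [slope_def_field, h0]
  ring

/-- Derivative of an integral with a moving endpoint and a moving integrand. -/
lemma hasDerivAt_integral_moving {f : ℝ → ℝ → ℝ} (hf : Continuous (Function.uncurry f))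
    {X : ℝ → ℝ} {X' s : ℝ} (hX : HasDerivAt X X' s) :
    HasDerivAt (fun r => ∫ x in X s..X r, f r x) (X' * f s (X s)) s := by
  have h1 := hasDerivAt_mul_of_eq_zero (hX.sub_const (X s)) (sub_self _)
    (continuous_integral_segment hf hX.continuousAt (X s))
  simp only [sub_self, mul_zero, add_zero, intervalIntegral.integral_const, sub_zero, one_smul]
    at h1
  exact h1.congr_of_eventuallyEq (Eventually.of_forall fun r => integral_segment _ _ _)

/-! ### The mass coordinate and the flow map -/

section Flow

variable {a α γ T : ℝ} {rbar : ℝ → ℝ} {ρ u ρt ut ρx ux uxx : ℝ → ℝ → ℝ}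

/-- The Lagrangian mass coordinate. -/
noncomputable def massCoord (ρ u : ℝ → ℝ → ℝ) (t x : ℝ) : ℝ :=
  (∫ r in (0 : ℝ)..x, ρ t r) - ∫ s in (0 : ℝ)..t, ρ s 0 * u s 0

lemma continuous_primitive_space {f : ℝ → ℝ → ℝ} (hf : Continuous (Function.uncurry f)) (c : ℝ) :
    Continuous (Function.uncurry fun t x => ∫ r in c..x, f t r) := by
  have : ∀ t x, ∫ r in c..x, f t r = (x - c) * ∫ θ in (0 : ℝ)..1, f t (c + θ * (x - c)) :=
    fun t x => integral_segment _ _ _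
  simp only [this]
  refine Continuous.mul (f := fun p : ℝ × ℝ => p.2 - c) (by fun_prop) ?_
  refine intervalIntegral.continuous_parametric_intervalIntegral_of_continuous'
    (f := fun p : ℝ × ℝ => fun θ => f p.1 (c + θ * (p.2 - c))) ?_ 0 1
  exact hf.comp (by fun_prop : Continuous fun q : (ℝ × ℝ) × ℝ =>
    (q.1.1, c + q.2 * (q.1.2 - c)))

lemma continuous_massCoord (hρ : Continuous (Function.uncurry ρ))
    (hu : Continuous (Function.uncurry u)) : Continuous (Function.uncurry (massCoord ρ u)) := by
  refine (continuous_primitive_space hρ 0).sub ?_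
  have h1 : Continuous fun s => ρ s 0 * u s 0 :=
    (hρ.comp (by fun_prop : Continuous fun s : ℝ => (s, (0 : ℝ)))).mul
      (hu.comp (by fun_prop : Continuous fun s : ℝ => (s, (0 : ℝ))))
  exact (intervalIntegral.continuous_primitive (fun _ _ => h1.intervalIntegrable _ _) 0).comp
    continuous_fst

lemma hasDerivAt_massCoord (hρ : Continuous (Function.uncurry ρ)) (u : ℝ → ℝ → ℝ) (t x : ℝ) :
    HasDerivAt (massCoord ρ u t) (ρ t x) x := by
  have h1 : Continuous (ρ t) := hρ.comp (by fun_prop : Continuous fun x => (t, x))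
  exact (h1.integral_hasStrictDerivAt 0 x).hasDerivAt.sub_const _

lemma massCoord_sub (hρ : Continuous (Function.uncurry ρ)) (u : ℝ → ℝ → ℝ) (t x y : ℝ) :
    massCoord ρ u t y - massCoord ρ u t x = ∫ r in x..y, ρ t r := by
  have h1 : Continuous (ρ t) := hρ.comp (by fun_prop : Continuous fun x => (t, x))
  rw [massCoord, massCoord, sub_sub_sub_cancel_right,
    intervalIntegral.integral_interval_sub_left (h1.intervalIntegrable _ _)
      (h1.intervalIntegrable _ _)]

/-- The flow map in Lagrangian mass coordinates. -/
structure IsFlowMap (T : ℝ) (ρ u X : ℝ → ℝ → ℝ) : Prop where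
  cont : Continuous (Function.uncurry X)
  right_inv : ∀ t y, massCoord ρ u t (X t y) = y
  left_inv : ∀ t x, X t (massCoord ρ u t x) = x
  space : ∀ t y, HasDerivAt (X t) (ρ t (X t y))⁻¹ y
  time : ∀ t ∈ Ioo 0 T, ∀ y, HasDerivAt (fun s => X s y) (u t (X t y)) t

namespace RegularFlow

lemma massCoord_eq (hF : RegularFlow a α γ T rbar ρ u ρt ut ρx ux uxx) {t : ℝ}
    (ht : t ∈ Icc 0 T) (x : ℝ) :
    massCoord ρ u t x = (∫ r in (0 : ℝ)..x, ρ 0 r) - ∫ s in (0 : ℝ)..t, ρ s x * u s x := by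
  have hc : ∀ x, Continuous fun s => ρ s x * u s x := fun x =>
    (hF.cont_density.comp (by fun_prop : Continuous fun s : ℝ => (s, x))).mul
      (hF.cont_velocity.comp (by fun_prop : Continuous fun s : ℝ => (s, x)))
  have h := local_balance (e := ρ) (et := ρt) (R := fun _ _ => 0) (J := fun t x => ρ t x * u t x)
    (.of_memLp hF.memLp_ρt) hF.time_density (.of_continuous continuous_const) ?_ ht 0 x
  · rw [intervalIntegral.integral_sub ((hF.cont_density_space t).intervalIntegrable _ _)
      ((hF.cont_density_space 0).intervalIntegrable _ _)] at h
    simp only [intervalIntegral.integral_zero, zero_sub, neg_sub] at h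
    rw [intervalIntegral.integral_sub ((hc 0).intervalIntegrable _ _)
      ((hc x).intervalIntegrable _ _)] at h
    rw [massCoord]
    linarith
  · filter_upwards [hF.space_density, hF.space_velocity, Measure.ae_ae_of_ae_prod hF.mass]
      with t h1 h2 h3 p q
    refine ((h1 p q).mul (h2 p q)).congr_right ?_
    filter_upwards [h3] with x h3 _
    linarith

theorem exists_flowMap (hF : RegularFlow a α γ T rbar ρ u ρt ut ρx ux uxx) :
    ∃ X, IsFlowMap T ρ u X := by
  obtain ⟨m, M, hm, hmM⟩ := hF.density_bounds
  have hρ := hF.cont_density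
  have hcont : ∀ t, Continuous (massCoord ρ u t) := fun t =>
    (continuous_massCoord hρ hF.cont_velocity).comp (by fun_prop : Continuous fun x => (t, x))
  have hlow : ∀ t x y, x ≤ y → m * (y - x) ≤ massCoord ρ u t y - massCoord ρ u t x := by
    intro t x y hxy
    rw [massCoord_sub hρ]
    calc m * (y - x) = ∫ _ in x..y, m := by simp [mul_comm]
      _ ≤ _ := intervalIntegral.integral_mono_on hxy (by simp)
        ((hF.cont_density_space t).intervalIntegrable _ _) fun r _ => (hmM t r).1
  have habs : ∀ t x y, m * |y - x| ≤ |massCoord ρ u t y - massCoord ρ u t x| := by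
    intro t x y
    rcases le_total x y with h | h
    · rw [abs_of_nonneg (sub_nonneg.2 h)]
      exact (hlow t x y h).trans (le_abs_self _)
    · rw [abs_sub_comm y x, abs_sub_comm (massCoord ρ u t y), abs_of_nonneg (sub_nonneg.2 h)]
      exact (hlow t y x h).trans (le_abs_self _)
  have hinj : ∀ t, Function.Injective (massCoord ρ u t) := fun t x y h => by
    have := habs t x y
    rw [h, sub_self, abs_zero] at this
    have : |y - x| ≤ 0 := by by_contra hc; nlinarith
    linarith [abs_nonpos_iff.1 this]
  have hsurj : ∀ t, Function.Surjective (massCoord ρ u t) := fun t => by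
    refine (hcont t).surjective ?_ ?_
    · refine tendsto_atTop_mono' atTop (f₁ := fun x => m * x + massCoord ρ u t 0) ?_ ?_
      · filter_upwards [eventually_ge_atTop 0] with x hx
        linarith [hlow t 0 x hx]
      · exact tendsto_atTop_add_const_right _ _ (tendsto_id.const_mul_atTop hm)
    · refine tendsto_atBot_mono' atBot (f₁ := fun x => m * x + massCoord ρ u t 0) ?_ ?_
      · filter_upwards [eventually_le_atBot 0] with x hx
        linarith [hlow t x 0 hx]
      · exact tendsto_atBot_add_const_right _ _ (tendsto_id.const_mul_atBot hm)
  choose X hX using hsurj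
  have hl : ∀ t x, X t (massCoord ρ u t x) = x := fun t x => hinj t (hX t _)
  have hXc : Continuous (Function.uncurry X) := by
    rw [continuous_iff_continuousAt]
    rintro ⟨t₀, y₀⟩
    rw [ContinuousAt, tendsto_iff_dist_tendsto_zero]
    have h0 : Tendsto (fun p : ℝ × ℝ => |p.2 - massCoord ρ u p.1 (X t₀ y₀)| / m) (𝓝 (t₀, y₀))
        (𝓝 0) := by
      have hc : Continuous fun p : ℝ × ℝ => |p.2 - massCoord ρ u p.1 (X t₀ y₀)| / m :=
        ((continuous_snd.sub ((continuous_massCoord hρ hF.cont_velocity).comp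
          (continuous_fst.prodMk continuous_const))).abs).div_const _
      have := hc.tendsto (t₀, y₀)
      simpa [hX] using this
    refine squeeze_zero (fun _ => dist_nonneg) (fun p => ?_) h0
    rw [le_div_iff₀ hm, mul_comm]
    have := habs p.1 (X t₀ y₀) (X p.1 p.2)
    rwa [hX] at this
  have hXt : ∀ y, Continuous fun s => X s y := fun y =>
    hXc.comp (by fun_prop : Continuous fun s : ℝ => (s, y))
  refine ⟨X, hXc, hX, hl, fun t y => ?_, fun t ht y => ?_⟩
  · exact HasDerivAt.of_local_left_inverse
      (hXc.comp (by fun_prop : Continuous fun y : ℝ => (t, y))).continuousAt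
      (hasDerivAt_massCoord hρ u t (X t y)) (hF.density_pos _ _).ne'
      (Eventually.of_forall (hX t))
  · set x := X t y with hx
    set c : ℝ → ℝ := fun r => ∫ θ in (0 : ℝ)..1, ρ r (x + θ * (X r y - x)) with hc
    have hcc : ContinuousAt c t := continuous_integral_segment hρ (hXt y).continuousAt x
    have hct : c t = ρ t x := by simp [hc, hx]
    have hcpos : ∀ r, c r ≠ 0 := fun r => by
      refine (lt_of_lt_of_le hm ?_).ne'
      calc m = ∫ _ in (0 : ℝ)..1, m := by simp
        _ ≤ _ := intervalIntegral.integral_mono_on zero_le_one (by simp)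
          (((hF.cont_density_space r).comp (by fun_prop :
            Continuous fun θ => x + θ * (X r y - x))).intervalIntegrable _ _)
            fun θ _ => (hmM r _).1
    have hpu : Continuous fun s => ρ s x * u s x :=
      (hρ.comp (by fun_prop : Continuous fun s : ℝ => (s, x))).mul
        (hF.cont_velocity.comp (by fun_prop : Continuous fun s : ℝ => (s, x)))
    have hd : HasDerivAt (fun r => y - massCoord ρ u r x) (ρ t x * u t x) t := by
      have h1 := ((hpu.integral_hasStrictDerivAt 0 t).hasDerivAt.const_sub
        (∫ r in (0 : ℝ)..x, ρ 0 r)).const_sub y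
      rw [neg_neg] at h1
      refine h1.congr_of_eventuallyEq ?_
      filter_upwards [Icc_mem_nhds ht.1 ht.2] with r hr
      rw [hF.massCoord_eq hr]
    have h2 := (hasDerivAt_mul_of_eq_zero hd (by rw [hX, sub_self]) (hcc.inv₀ (hcpos t))).const_add x
    rw [Pi.inv_apply, hct, mul_comm (ρ t x), mul_assoc, mul_inv_cancel₀ (hF.density_pos t x).ne',
      mul_one] at h2
    refine h2.congr_of_eventuallyEq (Eventually.of_forall fun r => ?_)
    have h3 := massCoord_sub hρ u r x (X r y)
    rw [hX, integral_segment] at h3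
    change X r y = x + (y - massCoord ρ u r x) * (c r)⁻¹
    rw [h3, mul_assoc, mul_inv_cancel₀ (hcpos r)]
    ring

end RegularFlow

end Flow

section Flow

variable {a α γ T : ℝ} {rbar : ℝ → ℝ} {ρ u ρt ut ρx ux uxx X : ℝ → ℝ → ℝ}

/-! ### Transport along the flow -/

lemma continuous_slice_space {f : ℝ → ℝ → ℝ} (hf : Continuous (Function.uncurry f)) (t : ℝ) :
    Continuous (f t) := hf.comp (by fun_prop : Continuous fun x => (t, x))

lemma continuous_slice_time {f : ℝ → ℝ → ℝ} (hf : Continuous (Function.uncurry f)) (x : ℝ) :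
    Continuous fun t => f t x := hf.comp (by fun_prop : Continuous fun t : ℝ => (t, x))

lemma eq_zero_of_forall_integral_eq_zero {k : ℝ → ℝ} (hk : Continuous k)
    (h : ∀ y, ∫ z in (0 : ℝ)..y, k z = 0) (y : ℝ) : k y = 0 := by
  have h1 := (hk.integral_hasStrictDerivAt 0 y).hasDerivAt
  simp only [h] at h1
  exact h1.unique (hasDerivAt_const y 0)

namespace IsFlowMap

lemma cont_comp (hX : IsFlowMap T ρ u X) {f : ℝ → ℝ → ℝ} (hf : Continuous (Function.uncurry f)) :
    Continuous (Function.uncurry fun t y => f t (X t y)) :=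
  hf.comp (continuous_fst.prodMk hX.cont)

/-- Change of variables to the mass coordinate. -/
lemma integral_comp (hX : IsFlowMap T ρ u X) (hρ : Continuous (Function.uncurry ρ))
    {f : ℝ → ℝ → ℝ} (hf : Continuous (Function.uncurry f)) (t y₁ y₂ : ℝ) :
    ∫ y in y₁..y₂, f t (X t y) = ∫ x in X t y₁..X t y₂, ρ t x * f t x := by
  have h := intervalIntegral.integral_comp_mul_deriv (a := X t y₁) (b := X t y₂)
    (f := massCoord ρ u t) (f' := ρ t) (g := fun y => f t (X t y))
    (fun x _ => hasDerivAt_massCoord hρ u t x) (continuous_slice_space hρ t).continuousOn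
    (continuous_slice_space (hX.cont_comp hf) t)
  rw [hX.right_inv, hX.right_inv] at h
  rw [← h]
  refine intervalIntegral.integral_congr fun x _ => ?_
  simp only [Function.comp, hX.left_inv, mul_comm]

theorem transport (hX : IsFlowMap T ρ u X) (hρ : Continuous (Function.uncurry ρ))
    (hu : Continuous (Function.uncurry u)) {f r : ℝ → ℝ → ℝ}
    (hf : Continuous (Function.uncurry f)) (hr : Continuous (Function.uncurry r))
    (h : ∀ t ∈ Icc 0 T, ∀ p q, ∫ x in p..q, (ρ t x * f t x - ρ 0 x * f 0 x) =
      ∫ s in (0 : ℝ)..t, ((∫ x in p..q, ρ s x * r s x) -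
        (ρ s q * u s q * f s q - ρ s p * u s p * f s p)))
    {t : ℝ} (ht : t ∈ Icc 0 T) (y : ℝ) :
    f t (X t y) = f 0 (X 0 y) + ∫ s in (0 : ℝ)..t, r s (X s y) := by
  have hρf : Continuous (Function.uncurry fun t x => ρ t x * f t x) := hρ.mul hf
  have hρr : Continuous (Function.uncurry fun t x => ρ t x * r t x) := hρ.mul hr
  have hρuf : Continuous (Function.uncurry fun t x => ρ t x * u t x * f t x) :=
    (hρ.mul hu).mul hf
  set B : ℝ → ℝ → ℝ := fun t x => ∫ z in (0 : ℝ)..x, ρ t z * f t z with hB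
  have hBc : Continuous (Function.uncurry B) := continuous_primitive_space hρf 0
  have hD : ∀ y, ∀ s ∈ Ioo 0 T, HasDerivAt (fun s => B s (X s y))
      ((∫ x in (0 : ℝ)..X s y, ρ s x * r s x) + ρ s 0 * u s 0 * f s 0) s := by
    intro y s hs
    set x := X s y with hx
    have hg : Continuous fun s => (∫ z in (0 : ℝ)..x, ρ s z * r s z) -
        (ρ s x * u s x * f s x - ρ s 0 * u s 0 * f s 0) :=
      (continuous_slice_time (continuous_primitive_space hρr 0) x).sub
        ((continuous_slice_time hρuf x).sub (continuous_slice_time hρuf 0))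
    have h1 := ((hg.integral_hasStrictDerivAt 0 s).hasDerivAt.const_add (B 0 x)).add
      (hasDerivAt_integral_moving hρf (hX.time s hs y))
    refine (h1.congr_deriv ?_).congr_of_eventuallyEq ?_
    · simp only [← hx]; ring
    · filter_upwards [Icc_mem_nhds hs.1 hs.2] with s' hs'
      have h2 := h s' hs' 0 x
      have hi : ∀ t p q, IntervalIntegrable (fun x => ρ t x * f t x) volume p q := fun t p q =>
        (continuous_slice_space hρf t).intervalIntegrable _ _
      rw [intervalIntegral.integral_sub (hi s' _ _) (hi 0 _ _)] at h2
      have h3 := intervalIntegral.integral_add_adjacent_intervals (hi s' 0 x) (hi s' x (X s' y))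
      simp only [Pi.add_apply, hB]
      linarith
  have key : ∀ y, ∫ z in (0 : ℝ)..y, f t (X t z) - f 0 (X 0 z) - ∫ s in (0 : ℝ)..t, r s (X s z)
      = 0 := by
    intro y
    have hcX : ∀ y, Continuous fun s => B s (X s y) := fun y =>
      continuous_slice_time (hX.cont_comp hBc) y
    have hi : ∀ t p q, IntervalIntegrable (fun x => ρ t x * f t x) volume p q := fun t p q =>
      (continuous_slice_space hρf t).intervalIntegrable _ _
    have hA : ∀ s, ∫ z in (0 : ℝ)..y, f s (X s z) = B s (X s y) - B s (X s 0) := fun s => by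
      rw [hX.integral_comp hρ hf]
      have := intervalIntegral.integral_add_adjacent_intervals (hi s 0 (X s 0))
        (hi s (X s 0) (X s y))
      simp only [hB]; linarith
    have hder : ∀ s ∈ Ioo 0 t, HasDerivAt (fun s => B s (X s y) - B s (X s 0))
        (∫ z in (0 : ℝ)..y, r s (X s z)) s := fun s hs => by
      have hs' : s ∈ Ioo 0 T := ⟨hs.1, hs.2.trans_le ht.2⟩
      refine ((hD y s hs').sub (hD 0 s hs')).congr_deriv ?_
      rw [hX.integral_comp hρ hr]
      have := intervalIntegral.integral_add_adjacent_intervals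
        ((continuous_slice_space hρr s).intervalIntegrable 0 (X s 0))
        ((continuous_slice_space hρr s).intervalIntegrable (μ := volume) (X s 0) (X s y))
      linarith
    have hcr : Continuous fun s => ∫ z in (0 : ℝ)..y, r s (X s z) :=
      continuous_slice_time (continuous_primitive_space (hX.cont_comp hr) 0) y
    have h4 := intervalIntegral.integral_eq_sub_of_hasDerivAt_of_le ht.1
      ((hcX y).sub (hcX 0)).continuousOn hder (hcr.intervalIntegrable _ _)
    have hsw : ∫ z in (0 : ℝ)..y, ∫ s in (0 : ℝ)..t, r s (X s z) =
        ∫ s in (0 : ℝ)..t, ∫ z in (0 : ℝ)..y, r s (X s z) := by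
      refine intervalIntegral_intervalIntegral_swap ?_
      have : Continuous (Function.uncurry fun z s => r s (X s z)) :=
        (hX.cont_comp hr).comp continuous_swap
      exact (this.continuousOn.integrableOn_compact (isCompact_uIcc.prod isCompact_uIcc)).mono_set
        (prod_mono uIoc_subset_uIcc uIoc_subset_uIcc)
    have c1 := (continuous_slice_space (hX.cont_comp hf) t).intervalIntegrable (μ := volume) 0 y
    have c2 := (continuous_slice_space (hX.cont_comp hf) 0).intervalIntegrable (μ := volume) 0 y
    have c3 : Continuous fun z => ∫ s in (0 : ℝ)..t, r s (X s z) :=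
      continuous_slice_time (continuous_primitive_space (f := fun z s => r s (X s z))
        ((hX.cont_comp hr).comp continuous_swap) 0) t
    rw [intervalIntegral.integral_sub (c1.sub c2) (c3.intervalIntegrable _ _),
      intervalIntegral.integral_sub c1 c2, hsw, h4, hA, hA]
    simp only [Pi.sub_apply]
    ring
  have c3 : Continuous fun z => ∫ s in (0 : ℝ)..t, r s (X s z) :=
    continuous_slice_time (continuous_primitive_space (f := fun z s => r s (X s z))
      ((hX.cont_comp hr).comp continuous_swap) 0) t
  have := eq_zero_of_forall_integral_eq_zero
    (((continuous_slice_space (hX.cont_comp hf) t).sub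
      (continuous_slice_space (hX.cont_comp hf) 0)).sub c3) key y
  simp only [Pi.sub_apply] at this
  linarith

end IsFlowMap

/-- A primitive of the momentum density `ρ u` in space which is the time integral of the
momentum flux. -/
theorem RegularFlow.exists_momentum_potential (hF : RegularFlow a α γ T rbar ρ u ρt ut ρx ux uxx)
    (hα : α ≠ 0) :
    ∃ Q : ℝ → ℝ → ℝ, Continuous (Function.uncurry Q) ∧
      (∀ t x y, Q t y - Q t x = ∫ r in x..y, ρ t r * u t r) ∧
      ∀ t ∈ Icc 0 T, ∀ p q,
        ∫ x in p..q, (ρ t x * (Q t x + ρ t x ^ α / α) - ρ 0 x * (Q 0 x + ρ 0 x ^ α / α)) =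
        ∫ s in (0 : ℝ)..t, ((∫ x in p..q, ρ s x * -(a * ρ s x ^ γ)) -
          (ρ s q * u s q * (Q s q + ρ s q ^ α / α) - ρ s p * u s p * (Q s p + ρ s p ^ α / α))) := by
  obtain ⟨m, M, hm, hmM⟩ := hF.density_bounds
  have hρu : Continuous (Function.uncurry fun t x => ρ t x * u t x) :=
    hF.cont_density.mul hF.cont_velocity
  set G : ℝ → ℝ → ℝ := fun t x => ρ t x * u t x ^ 2 + -(ρ t x ^ α * ux t x) + a * ρ t x ^ γ
    with hG
  have hGl : LocInt T G :=
    ((LocInt.of_continuous (k := fun t x => ρ t x * u t x ^ 2)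
      (hF.bdd_density.mul (hF.bdd_velocity.pow 2)).1).add
      ((LocInt.of_memLp hF.memLp_ux).continuous_mul (hF.bdd_rpow α).1).neg).add
      (.of_continuous (k := fun t x => a * ρ t x ^ γ) (continuous_const.mul (hF.bdd_rpow γ).1))
  have hmom := fun {t} (ht : t ∈ Icc 0 T) => local_balance (e := fun t x => ρ t x * u t x)
    (et := fun t x => ρt t x * u t x + ρ t x * ut t x) (R := fun _ _ => 0) (J := G)
    ((((LocInt.of_memLp hF.memLp_ρt).continuous_mul hF.cont_velocity).add
      ((LocInt.of_memLp hF.memLp_ut).continuous_mul hF.cont_density)).congr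
        (ae_of_all _ fun z => by rw [mul_comm (u _ _)]))
    (by filter_upwards [hF.time_density, hF.time_velocity] with x h1 h2 using h1.mul h2)
    (.of_continuous continuous_const) (by
      filter_upwards [hF.space_density, hF.space_velocity, hF.space_gradient,
        Measure.ae_ae_of_ae_prod hF.mass, Measure.ae_ae_of_ae_prod hF.momentum]
        with t h1 h2 h3 h4 h5 p q
      refine ((((h1 p q).mul ((h2 p q).pow 2)).sub
        (((h1 p q).rpow hm (hmM t) α).mul (h3 p q))).add
          (((h1 p q).rpow hm (hmM t) γ).const_mul a)).congr_right ?_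
      filter_upwards [h4, h5] with x h4 h5 _
      push_cast
      linear_combination (u t x) * h4 + h5) ht
  obtain ⟨z, hz⟩ := hGl.ae_time.exists
  set g : ℝ → ℝ := (Ioc 0 T).indicator fun s => G s z with hg
  have hgi : Integrable g := (integrable_indicator_iff measurableSet_Ioc).2 hz
  have hgI : ∀ t ∈ Icc 0 T, ∫ s in (0 : ℝ)..t, g s = ∫ s in (0 : ℝ)..t, G s z := fun t ht => by
    refine intervalIntegral.integral_congr_ae (ae_of_all _ fun s hs => ?_)
    exact indicator_of_mem (uIoc_subset_of_mem_Icc ht hs) _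
  set Q : ℝ → ℝ → ℝ := fun t x => (∫ r in z..x, ρ t r * u t r) - ∫ s in (0 : ℝ)..t, g s with hQ
  have hQc : Continuous (Function.uncurry Q) :=
    (continuous_primitive_space hρu z).sub
      ((intervalIntegral.continuous_primitive (fun _ _ => hgi.intervalIntegrable) 0).comp
        continuous_fst)
  have hQt : ∀ᵐ x, HasACDeriv (fun t => Q t x) (fun t => -G t x) 0 T := by
    filter_upwards [hGl.ae_time] with x hx
    have hx' : IntervalIntegrable (fun t => -G t x) volume 0 T :=
      ((intervalIntegrable_iff_integrableOn_Ioc_of_le hF.T_pos.le).2 hx).neg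
    refine .of_integral hx' fun t ht => ?_
    rw [uIcc_of_le hF.T_pos.le] at ht
    have h1 := hmom ht z x
    have hI : ∀ x, IntegrableOn (fun t => G t x) (Ioc 0 T) →
        IntervalIntegrable (fun t => G t x) volume 0 t := fun x hx =>
      (intervalIntegrable_iff_integrableOn_Ioc_of_le ht.1).2
        (hx.mono_set (Ioc_subset_Ioc_right ht.2))
    rw [intervalIntegral.integral_sub ((continuous_slice_space hρu t).intervalIntegrable _ _)
      ((continuous_slice_space hρu 0).intervalIntegrable _ _)] at h1
    simp only [intervalIntegral.integral_zero, zero_sub, neg_sub] at h1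
    rw [intervalIntegral.integral_sub (hI z hz) (hI x hx)] at h1
    simp only [hQ, intervalIntegral.integral_same, intervalIntegral.integral_neg]
    rw [hgI t ht]
    linarith
  have hQx : ∀ t x y, Q t y - Q t x = ∫ r in x..y, ρ t r * u t r := fun t x y => by
    simp only [hQ]
    rw [sub_sub_sub_cancel_right, intervalIntegral.integral_interval_sub_left
      ((continuous_slice_space hρu t).intervalIntegrable _ _)
      ((continuous_slice_space hρu t).intervalIntegrable _ _)]
  have hQd : ∀ t x, HasDerivAt (Q t) (ρ t x * u t x) x := fun t x =>
    ((continuous_slice_space hρu t).integral_hasStrictDerivAt z x).hasDerivAt.sub_const _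
  refine ⟨Q, hQc, hQx, fun t ht p q => ?_⟩
  have hα1 := (hF.bdd_rpow α).1
  have hVc : Continuous (Function.uncurry fun t x => Q t x + ρ t x ^ α / α) :=
    hQc.add (hα1.div_const α)
  refine local_balance (e := fun t x => ρ t x * (Q t x + ρ t x ^ α / α))
    (et := fun t x => ρt t x * (Q t x + α⁻¹ * ρ t x ^ α) +
      ρ t x * (-G t x + α⁻¹ * (α * ρ t x ^ (α - 1) * ρt t x)))
    (R := fun s x => ρ s x * -(a * ρ s x ^ γ))
    (J := fun s x => ρ s x * u s x * (Q s x + ρ s x ^ α / α)) ?_ ?_ ?_ ?_ ht p q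
  · refine (((LocInt.of_memLp hF.memLp_ρt).continuous_mul hVc).add ((hGl.neg.add
      ((LocInt.of_memLp hF.memLp_ρt).continuous_mul (hF.bdd_rpow (α - 1)).1)).continuous_mul
        hF.cont_density)).congr (ae_of_all _ fun z => ?_)
    field_simp
  · filter_upwards [hF.time_density, hQt] with x h1 h2
    have := h1.mul (h2.add ((h1.rpow hm (fun t => hmM t x) α).const_mul α⁻¹))
    simpa only [div_eq_inv_mul] using this
  · exact .of_continuous (k := fun s x => ρ s x * -(a * ρ s x ^ γ)) (hF.cont_density.mul (continuous_const.mul (hF.bdd_rpow γ).1).neg)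
  · filter_upwards [hF.space_density, hF.space_velocity, Measure.ae_ae_of_ae_prod hF.mass]
      with t h1 h2 h3 p q
    have hQac : HasACDeriv (Q t) (fun x => ρ t x * u t x) p q :=
      .of_hasDerivAt (hQd t) (continuous_slice_space hρu t)
    have h4 := ((h1 p q).mul (h2 p q)).mul
      (hQac.add (((h1 p q).rpow hm (hmM t) α).const_mul α⁻¹))
    simp only [div_eq_inv_mul]
    refine h4.congr_right ?_
    filter_upwards [h3] with x h3 _
    have e1 : ρ t x ^ α = ρ t x ^ (α - 1) * ρ t x := by
      rw [← Real.rpow_add_one (hF.density_pos t x).ne']; ring_nf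
    have e2 : α⁻¹ * (α * ρ t x ^ (α - 1) * ρx t x) = ρ t x ^ (α - 1) * ρx t x := by
      field_simp
    have e3 : α⁻¹ * (α * ρ t x ^ (α - 1) * ρt t x) = ρ t x ^ (α - 1) * ρt t x := by
      field_simp
    simp only [hG]
    rw [e2, e3, e1]
    linear_combination (Q t x + α⁻¹ * (ρ t x ^ (α - 1) * ρ t x) +
      ρ t x * ρ t x ^ (α - 1)) * h3

end Flow

/-! ### Damped differences along the flow -/

lemma abs_le_add_integral_of_mul_deriv_le {W W' g : ℝ → ℝ} {t : ℝ} (ht : 0 ≤ t)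
    (hW : ContinuousOn W (Icc 0 t)) (hd : ∀ s ∈ Ioo 0 t, HasDerivAt W (W' s) s)
    (hg : Continuous g) (hg0 : ∀ s, 0 ≤ g s)
    (h : ∀ s ∈ Ioo 0 t, W s * W' s ≤ g s * |W s|) :
    |W t| ≤ |W 0| + ∫ s in (0 : ℝ)..t, g s := by
  refine le_of_forall_pos_le_add fun η hη => ?_
  have hpos : ∀ s, 0 < W s ^ 2 + η ^ 2 := fun s => by positivity
  set N : ℝ → ℝ := fun s => √(W s ^ 2 + η ^ 2) with hN
  have hG : ∀ s, HasDerivAt (fun s => ∫ r in (0 : ℝ)..s, g r) (g s) s := fun s =>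
    (hg.integral_hasStrictDerivAt 0 s).hasDerivAt
  have hder : ∀ s ∈ Ioo 0 t, HasDerivAt (fun s => N s - ∫ r in (0 : ℝ)..s, g r)
      (W s * W' s / N s - g s) s := fun s hs => by
    refine (((((hd s hs).pow 2).add_const (η ^ 2)).sqrt (hpos s).ne').sub (hG s)).congr_deriv ?_
    have := (Real.sqrt_pos.2 (hpos s)).ne'
    simp only [hN, Nat.cast_ofNat, Nat.add_one_sub_one, pow_one, Pi.pow_apply]
    field_simp
  have hWN : ∀ s, |W s| ≤ N s := fun s => Real.abs_le_sqrt (by nlinarith)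
  have hNpos : ∀ s, 0 < N s := fun s => Real.sqrt_pos.2 (hpos s)
  have hanti : AntitoneOn (fun s => N s - ∫ r in (0 : ℝ)..s, g r) (Icc 0 t) := by
    refine antitoneOn_of_deriv_nonpos (convex_Icc 0 t) ?_ ?_ ?_
    · exact (((hW.pow 2).add continuousOn_const).sqrt).sub
        (fun s _ => (hG s).continuousAt.continuousWithinAt)
    · rw [interior_Icc]
      exact fun s hs => (hder s hs).differentiableAt.differentiableWithinAt
    · rw [interior_Icc]
      intro s hs
      rw [(hder s hs).deriv, sub_nonpos, div_le_iff₀ (hNpos s)]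
      exact (h s hs).trans (mul_le_mul_of_nonneg_left (hWN s) (hg0 s))
  have h1 := hanti (left_mem_Icc.2 ht) (right_mem_Icc.2 ht) ht
  simp only [intervalIntegral.integral_same, sub_zero] at h1
  have h2 : N 0 ≤ |W 0| + η := by
    refine Real.sqrt_le_iff.2 ⟨by positivity, ?_⟩
    nlinarith [sq_abs (W 0), abs_nonneg (W 0)]
  linarith [hWN t]

lemma sq_le_of_mul_deriv_le {W W' g : ℝ → ℝ} {t : ℝ} (ht : 0 ≤ t)
    (hW : ContinuousOn W (Icc 0 t)) (hd : ∀ s ∈ Ioo 0 t, HasDerivAt W (W' s) s)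
    (hg : Continuous g) (h : ∀ s ∈ Ioo 0 t, W s * W' s ≤ g s) :
    W t ^ 2 ≤ W 0 ^ 2 + 2 * ∫ s in (0 : ℝ)..t, g s := by
  have hG : ∀ s, HasDerivAt (fun s => ∫ r in (0 : ℝ)..s, g r) (g s) s := fun s =>
    (hg.integral_hasStrictDerivAt 0 s).hasDerivAt
  have hder : ∀ s ∈ Ioo 0 t, HasDerivAt (fun s => W s ^ 2 - 2 * ∫ r in (0 : ℝ)..s, g r)
      (2 * (W s * W' s) - 2 * g s) s := fun s hs => by
    refine (((hd s hs).pow 2).sub ((hG s).const_mul 2)).congr_deriv ?_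
    simp only [Nat.cast_ofNat, Nat.add_one_sub_one, pow_one]
    ring
  have hanti : AntitoneOn (fun s => W s ^ 2 - 2 * ∫ r in (0 : ℝ)..s, g r) (Icc 0 t) := by
    refine antitoneOn_of_deriv_nonpos (convex_Icc 0 t) ?_ ?_ ?_
    · exact (hW.pow 2).sub (continuousOn_const.mul
        (fun s _ => (hG s).continuousAt.continuousWithinAt))
    · rw [interior_Icc]
      exact fun s hs => (hder s hs).differentiableAt.differentiableWithinAt
    · rw [interior_Icc]
      intro s hs
      rw [(hder s hs).deriv]
      linarith [h s hs]
  have h1 := hanti (left_mem_Icc.2 ht) (right_mem_Icc.2 ht) ht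
  simp only [intervalIntegral.integral_same, mul_zero, sub_zero] at h1
  linarith

lemma rpow_sub_rpow_le {α γ r s : ℝ} (hα : 0 < α) (hγ : α ≤ γ) (hr : 0 < r) (hrs : r ≤ s) :
    s ^ γ - r ^ γ ≤ γ * s ^ (γ - α) * ((s ^ α - r ^ α) / α) := by
  rcases hrs.eq_or_lt with rfl | hlt
  · simp
  have hc : ∀ p : ℝ, ContinuousOn (fun x : ℝ => x ^ p) (Icc r s) := fun p =>
    continuousOn_rpow_Icc hr p
  have hd : ∀ p : ℝ, ∀ x ∈ Ioo r s, HasDerivAt (fun x : ℝ => x ^ p) (p * x ^ (p - 1)) x :=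
    fun p x hx => hasDerivAt_rpow_of_pos p (hr.trans hx.1)
  obtain ⟨c, hcI, h⟩ := exists_ratio_hasDerivAt_eq_ratio_slope _ _ hlt (hc γ) (hd γ) _ _ (hc α)
    (hd α)
  have hc0 : 0 < c := hr.trans hcI.1
  have e : c ^ (γ - 1) = c ^ (γ - α) * c ^ (α - 1) := by
    rw [← Real.rpow_add hc0]; ring_nf
  have hpos : 0 < c ^ (α - 1) := Real.rpow_pos_of_pos hc0 _
  rw [e] at h
  have h2 : s ^ γ - r ^ γ = γ * c ^ (γ - α) * ((s ^ α - r ^ α) / α) := by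
    field_simp
    have : (c ^ (α - 1)) * (α * (s ^ γ - r ^ γ)) =
        (c ^ (α - 1)) * (γ * c ^ (γ - α) * (s ^ α - r ^ α)) := by linarith
    have := mul_left_cancel₀ hpos.ne' this
    linarith
  rw [h2]
  have h3 : c ^ (γ - α) ≤ s ^ (γ - α) :=
    Real.rpow_le_rpow hc0.le hcI.2.le (by linarith)
  have h4 : 0 ≤ (s ^ α - r ^ α) / α :=
    div_nonneg (sub_nonneg.2 (Real.rpow_le_rpow hr.le hrs hα.le)) hα.le
  gcongr
  linarith

/-- The pressure increments are dominated by the increments of `r ^ α / α`, with the same sign. -/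
lemma pressure_increment {a α γ r s : ℝ} (ha : 0 < a) (hα : 0 < α) (hγ : α ≤ γ) (hr : 0 < r)
    (hs : 0 < s) :
    0 ≤ (s ^ α / α - r ^ α / α) * (a * s ^ γ - a * r ^ γ) ∧
      |a * s ^ γ - a * r ^ γ| ≤ a * γ * max r s ^ (γ - α) * |s ^ α / α - r ^ α / α| := by
  have key : ∀ {r s : ℝ}, 0 < r → r ≤ s → 0 ≤ s ^ α / α - r ^ α / α ∧ 0 ≤ a * s ^ γ - a * r ^ γ ∧
      a * s ^ γ - a * r ^ γ ≤ a * γ * s ^ (γ - α) * (s ^ α / α - r ^ α / α) := by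
    intro r s hr h
    have h1 := rpow_sub_rpow_le hα hγ hr h
    have h2 := Real.rpow_le_rpow hr.le h hα.le
    have h3 := Real.rpow_le_rpow hr.le h (hα.le.trans hγ)
    refine ⟨?_, ?_, ?_⟩
    · rw [← sub_div]; exact div_nonneg (by linarith) hα.le
    · nlinarith
    · rw [← sub_div]; nlinarith
  rcases le_total r s with h | h
  · obtain ⟨h1, h2, h3⟩ := key hr h
    rw [abs_of_nonneg h1, abs_of_nonneg h2, max_eq_right h]
    exact ⟨mul_nonneg h1 h2, h3⟩
  · obtain ⟨h1, h2, h3⟩ := key hs h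
    rw [abs_sub_comm, abs_sub_comm (s ^ α / α), abs_of_nonneg h1, abs_of_nonneg h2, max_eq_left h]
    exact ⟨by nlinarith, h3⟩

lemma tendsto_diffQuot {f : ℝ → ℝ} {f' y : ℝ} (h : HasDerivAt f f' y) :
    Tendsto (fun n : ℕ => ((n : ℝ) + 1) * (f (y + 1 / ((n : ℝ) + 1)) - f y)) atTop (𝓝 f') := by
  have h1 := h.tendsto_slope_zero_right
  have h2 : Tendsto (fun n : ℕ => 1 / ((n : ℝ) + 1)) atTop (𝓝[>] 0) :=
    tendsto_nhdsWithin_iff.2 ⟨tendsto_one_div_add_atTop_nhds_zero_nat,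
      Eventually.of_forall fun n => by simp only [mem_Ioi]; positivity⟩
  refine (h1.comp h2).congr fun n => ?_
  simp

section Flow

variable {a α γ T : ℝ} {rbar : ℝ → ℝ} {ρ u ρt ut ρx ux uxx X Q : ℝ → ℝ → ℝ}

/-- The effective velocity, with the pointwise derivative of the density. -/
noncomputable def effVel (α : ℝ) (ρ u : ℝ → ℝ → ℝ) (t x : ℝ) : ℝ :=
  u t x + ρ t x ^ (α - 2) * deriv (ρ t) x

/-- The quantities entering the evolution of the effective velocity along the flow. -/
structure LagrangianFlow (a α γ T : ℝ) (ρ u X Q : ℝ → ℝ → ℝ) : Prop where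
  a_pos : 0 < a
  α_pos : 0 < α
  le_γ : α ≤ γ
  cont_density : Continuous (Function.uncurry ρ)
  cont_velocity : Continuous (Function.uncurry u)
  density_bounds : ∃ m M : ℝ, 0 < m ∧ ∀ t x, m ≤ ρ t x ∧ ρ t x ≤ M
  velocity_bound : ∃ U : ℝ, ∀ t x, |u t x| ≤ U
  flow : IsFlowMap T ρ u X
  cont_potential : Continuous (Function.uncurry Q)
  potential_sub : ∀ t x y, Q t y - Q t x = ∫ r in x..y, ρ t r * u t r
  transport : ∀ t ∈ Icc 0 T, ∀ y, Q t (X t y) + ρ t (X t y) ^ α / α =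
    Q 0 (X 0 y) + ρ 0 (X 0 y) ^ α / α - ∫ s in (0 : ℝ)..t, a * ρ s (X s y) ^ γ

theorem RegularFlow.exists_lagrangianFlow (hF : RegularFlow a α γ T rbar ρ u ρt ut ρx ux uxx)
    (ha : 0 < a) (hα : 0 < α) (hγ : α ≤ γ) : ∃ X Q, LagrangianFlow a α γ T ρ u X Q := by
  obtain ⟨X, hX⟩ := hF.exists_flowMap
  obtain ⟨Q, h1, h2, h3⟩ := hF.exists_momentum_potential hα.ne'
  refine ⟨X, Q, ha, hα, hγ, hF.cont_density, hF.cont_velocity, hF.density_bounds,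
    hF.velocity_bound, hX, h1, h2, fun t ht y => ?_⟩
  have := hX.transport hF.cont_density hF.cont_velocity
    (f := fun t x => Q t x + ρ t x ^ α / α) (r := fun s x => -(a * ρ s x ^ γ))
    (h1.add ((hF.bdd_rpow α).1.div_const α)) (continuous_const.mul (hF.bdd_rpow γ).1).neg h3 ht y
  rw [intervalIntegral.integral_neg] at this
  linarith

namespace LagrangianFlow

lemma density_pos (hL : LagrangianFlow a α γ T ρ u X Q) (t x : ℝ) : 0 < ρ t x := by
  obtain ⟨m, M, hm, h⟩ := hL.density_bounds
  exact hm.trans_le (h t x).1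

lemma cont_rpow (hL : LagrangianFlow a α γ T ρ u X Q) (p : ℝ) :
    Continuous (Function.uncurry fun t x => ρ t x ^ p) :=
  hL.cont_density.rpow_const fun z => Or.inl (hL.density_pos z.1 z.2).ne'

lemma potential_diff_le (hL : LagrangianFlow a α γ T ρ u X Q)
    {U : ℝ} (hU : ∀ t x, |u t x| ≤ U) (t : ℝ) {y₁ y₂ : ℝ} (h : y₁ ≤ y₂) :
    |Q t (X t y₂) - Q t (X t y₁)| ≤ U * (y₂ - y₁) := by
  rw [hL.potential_sub, ← hL.flow.integral_comp hL.cont_density hL.cont_velocity]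
  have := intervalIntegral.norm_integral_le_of_norm_le_const (a := y₁) (b := y₂)
    (f := fun y => u t (X t y)) (C := U) fun y _ => hU t _
  rwa [Real.norm_eq_abs, abs_of_nonneg (sub_nonneg.2 h)] at this

/-- Bounds for the increments of the transported quantity. -/
theorem increment_bounds (hL : LagrangianFlow a α γ T ρ u X Q)
    {t : ℝ} (ht : t ∈ Icc 0 T) (y₁ y₂ : ℝ) :
    |(Q t (X t y₂) + ρ t (X t y₂) ^ α / α) - (Q t (X t y₁) + ρ t (X t y₁) ^ α / α)| ≤
      |(Q 0 (X 0 y₂) + ρ 0 (X 0 y₂) ^ α / α) - (Q 0 (X 0 y₁) + ρ 0 (X 0 y₁) ^ α / α)| +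
        ∫ s in (0 : ℝ)..t, a * γ * max (ρ s (X s y₁)) (ρ s (X s y₂)) ^ (γ - α) *
          |Q s (X s y₂) - Q s (X s y₁)| ∧
    ((Q t (X t y₂) + ρ t (X t y₂) ^ α / α) - (Q t (X t y₁) + ρ t (X t y₁) ^ α / α)) ^ 2 ≤
      ((Q 0 (X 0 y₂) + ρ 0 (X 0 y₂) ^ α / α) - (Q 0 (X 0 y₁) + ρ 0 (X 0 y₁) ^ α / α)) ^ 2 +
        2 * ∫ s in (0 : ℝ)..t, -((Q s (X s y₂) - Q s (X s y₁)) *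
          (a * ρ s (X s y₂) ^ γ - a * ρ s (X s y₁) ^ γ)) := by
  have hX := hL.flow
  have hVc : Continuous (Function.uncurry fun t x => Q t x + ρ t x ^ α / α) :=
    hL.cont_potential.add ((hL.cont_rpow α).div_const α)
  have hQc := fun y => continuous_slice_time (hX.cont_comp hL.cont_potential) y
  have hrc := fun y => continuous_slice_time (hX.cont_comp hL.cont_density) y
  have hpc := fun y => continuous_slice_time
    (hX.cont_comp (f := fun t x => a * ρ t x ^ γ) (continuous_const.mul (hL.cont_rpow γ))) y
  set W : ℝ → ℝ := fun s => (Q s (X s y₂) + ρ s (X s y₂) ^ α / α) -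
    (Q s (X s y₁) + ρ s (X s y₁) ^ α / α) with hW
  have hWc : Continuous W := (continuous_slice_time (hX.cont_comp hVc) y₂).sub
    (continuous_slice_time (hX.cont_comp hVc) y₁)
  have hWd : ∀ s ∈ Ioo 0 t, HasDerivAt W
      (-(a * ρ s (X s y₂) ^ γ - a * ρ s (X s y₁) ^ γ)) s := by
    intro s hs
    have h1 := fun y => ((hpc y).integral_hasStrictDerivAt 0 s).hasDerivAt.const_sub
      (Q 0 (X 0 y) + ρ 0 (X 0 y) ^ α / α)
    refine (((h1 y₂).sub (h1 y₁)).congr_deriv (by ring)).congr_of_eventuallyEq ?_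
    filter_upwards [Icc_mem_nhds hs.1 (hs.2.trans_le ht.2)] with r hr
    simp only [hW, Pi.sub_apply, hL.transport r hr]
  have hγ0 : 0 ≤ γ := hL.α_pos.le.trans hL.le_γ
  have hmax : ∀ s, 0 < max (ρ s (X s y₁)) (ρ s (X s y₂)) := fun s =>
    (hL.density_pos _ _).trans_le (le_max_left _ _)
  constructor
  · refine abs_le_add_integral_of_mul_deriv_le ht.1 hWc.continuousOn hWd ?_ ?_ ?_
    · exact (continuous_const.mul (((hrc y₁).max (hrc y₂)).rpow_const
        fun s => Or.inl (hmax s).ne')).mul ((hQc y₂).sub (hQc y₁)).abs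
    · intro s
      have := hL.a_pos
      have := hmax s
      positivity
    · intro s _
      obtain ⟨h1, h2⟩ := pressure_increment hL.a_pos hL.α_pos hL.le_γ (hL.density_pos s (X s y₁))
        (hL.density_pos s (X s y₂))
      set Λ := a * γ * max (ρ s (X s y₁)) (ρ s (X s y₂)) ^ (γ - α)
      have hΛ : 0 ≤ Λ := by
        have := hL.a_pos
        have := hmax s
        positivity
      set U := Q s (X s y₂) - Q s (X s y₁) with hU
      set q := ρ s (X s y₂) ^ α / α - ρ s (X s y₁) ^ α / α with hq
      set p := a * ρ s (X s y₂) ^ γ - a * ρ s (X s y₁) ^ γ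
      have hWs : W s = U + q := by simp only [hW, hU, hq]; ring
      rw [hWs]
      by_cases hUW : (U + q) * p ≤ 0 ∧ |q| ≤ |U|
      · calc (U + q) * -p ≤ |(U + q) * -p| := le_abs_self _
          _ = |p| * |U + q| := by rw [abs_mul, abs_neg, mul_comm]
          _ ≤ Λ * |U| * |U + q| := by
            refine mul_le_mul_of_nonneg_right (h2.trans ?_) (abs_nonneg _)
            exact mul_le_mul_of_nonneg_left hUW.2 hΛ
      · have : 0 ≤ (U + q) * p := by
          by_contra hneg
          push Not at hneg
          refine hUW ⟨hneg.le, ?_⟩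
          by_contra hlt
          push Not at hlt
          have hU2 := abs_lt.1 (show |U| < |q| from hlt)
          rcases le_total 0 q with hq0 | hq0
          · rw [abs_of_nonneg hq0] at hU2
            have hq1 : 0 < q := by linarith
            have : 0 ≤ p := nonneg_of_mul_nonneg_right h1 hq1
            nlinarith
          · rw [abs_of_nonpos hq0] at hU2
            have hq1 : q < 0 := by linarith
            have : p ≤ 0 := by by_contra hp; push Not at hp; nlinarith
            nlinarith
        have : 0 ≤ Λ * |U| * |U + q| := by positivity
        linarith
  · refine sq_le_of_mul_deriv_le ht.1 hWc.continuousOn hWd ?_ ?_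
    · exact (((hQc y₂).sub (hQc y₁)).mul ((hpc y₂).sub (hpc y₁))).neg
    · intro s _
      have h1 := (pressure_increment hL.a_pos hL.α_pos hL.le_γ (hL.density_pos s (X s y₁))
        (hL.density_pos s (X s y₂))).1
      simp only [hW]
      nlinarith

lemma hasDerivAt_potential_comp (hL : LagrangianFlow a α γ T ρ u X Q) (t y : ℝ) :
    HasDerivAt (fun y => Q t (X t y)) (u t (X t y)) y := by
  have hc : Continuous fun r => ρ t r * u t r :=
    (continuous_slice_space hL.cont_density t).mul (continuous_slice_space hL.cont_velocity t)
  have h1 : HasDerivAt (Q t) (ρ t (X t y) * u t (X t y)) (X t y) := by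
    refine ((hc.integral_hasStrictDerivAt 0 _).hasDerivAt.add_const
      (Q t 0)).congr_of_eventuallyEq (Eventually.of_forall fun x => ?_)
    simp only [← hL.potential_sub]; ring
  refine (h1.comp y (hL.flow.space t y)).congr_deriv ?_
  have := (hL.density_pos t (X t y)).ne'
  field_simp

lemma hasDerivAt_rpow_comp (hL : LagrangianFlow a α γ T ρ u X Q)
    (p : ℝ) {t y : ℝ} (hd : DifferentiableAt ℝ (ρ t) (X t y)) :
    HasDerivAt (fun y => ρ t (X t y) ^ p) (p * ρ t (X t y) ^ (p - 2) * deriv (ρ t) (X t y)) y := by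
  have hpos := hL.density_pos t (X t y)
  refine ((hasDerivAt_rpow_of_pos p hpos).comp y
    (hd.hasDerivAt.comp y (hL.flow.space t y))).congr_deriv ?_
  have : ρ t (X t y) ^ (p - 1) = ρ t (X t y) ^ (p - 2) * ρ t (X t y) := by
    rw [← Real.rpow_add_one hpos.ne']; ring_nf
  rw [this]
  field_simp

lemma hasDerivAt_transported (hL : LagrangianFlow a α γ T ρ u X Q)
    {t y : ℝ} (hd : DifferentiableAt ℝ (ρ t) (X t y)) :
    HasDerivAt (fun y => Q t (X t y) + ρ t (X t y) ^ α / α) (effVel α ρ u t (X t y)) y := by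
  refine ((hL.hasDerivAt_potential_comp t y).add
    ((hL.hasDerivAt_rpow_comp α hd).div_const α)).congr_deriv ?_
  have := hL.α_pos.ne'
  rw [effVel]
  field_simp

/-- Pointwise bounds for the effective velocity along the flow. -/
theorem effVel_bounds (hL : LagrangianFlow a α γ T ρ u X Q)
    {t y : ℝ} (ht : t ∈ Icc 0 T) (h0 : DifferentiableAt ℝ (ρ 0) (X 0 y))
    (hdt : DifferentiableAt ℝ (ρ t) (X t y))
    (hds : ∀ᵐ s ∂volume.restrict (Ioc 0 T), DifferentiableAt ℝ (ρ s) (X s y)) :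
    |effVel α ρ u t (X t y)| ≤ |effVel α ρ u 0 (X 0 y)| +
      ∫ s in (0 : ℝ)..t, a * γ * ρ s (X s y) ^ (γ - α) * |u s (X s y)| ∧
    effVel α ρ u t (X t y) ^ 2 ≤ effVel α ρ u 0 (X 0 y) ^ 2 +
      2 * ∫ s in (0 : ℝ)..t, -(u s (X s y) *
        (a * (γ * ρ s (X s y) ^ (γ - 2) * deriv (ρ s) (X s y)))) := by
  obtain ⟨m, M, hm, hmM⟩ := hL.density_bounds
  obtain ⟨U, hU⟩ := hL.velocity_bound
  have hU0 : 0 ≤ U := (abs_nonneg _).trans (hU 0 0)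
  have hX := hL.flow
  have ha := hL.a_pos
  have hγ0 : 0 ≤ γ := hL.α_pos.le.trans hL.le_γ
  have hM0 : 0 < M := hm.trans_le ((hmM 0 0).1.trans (hmM 0 0).2)
  set K := a * γ * M ^ (γ - α) with hK
  have hK0 : 0 ≤ K := by positivity
  have hh0 : ∀ n : ℕ, 0 < 1 / ((n : ℝ) + 1) := fun n => by positivity
  have hn0 : ∀ n : ℕ, 0 < (n : ℝ) + 1 := fun n => by positivity
  have hyn : Tendsto (fun n : ℕ => y + 1 / ((n : ℝ) + 1)) atTop (𝓝 y) := by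
    simpa using tendsto_one_div_add_atTop_nhds_zero_nat.const_add y
  have hQc := fun y => continuous_slice_time (hX.cont_comp hL.cont_potential) y
  have hrc := fun y => continuous_slice_time (hX.cont_comp hL.cont_density) y
  have hpc := fun y => continuous_slice_time
    (hX.cont_comp (f := fun t x => a * ρ t x ^ γ) (continuous_const.mul (hL.cont_rpow γ))) y
  have hmax : ∀ s y₁ y₂, 0 < max (ρ s (X s y₁)) (ρ s (X s y₂)) := fun s _ _ =>
    (hL.density_pos _ _).trans_le (le_max_left _ _)
  have hmaxK : ∀ s y₁ y₂, a * γ * max (ρ s (X s y₁)) (ρ s (X s y₂)) ^ (γ - α) ≤ K :=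
    fun s y₁ y₂ => mul_le_mul_of_nonneg_left (Real.rpow_le_rpow (hmax s y₁ y₂).le
      (max_le (hmM _ _).2 (hmM _ _).2) (by linarith [hL.le_γ])) (by positivity)
  -- scaled increments
  set V : ℝ → ℝ → ℝ := fun t y => Q t (X t y) + ρ t (X t y) ^ α / α with hV
  set W : ℕ → ℝ → ℝ := fun n s => ((n : ℝ) + 1) * (V s (y + 1 / ((n : ℝ) + 1)) - V s y) with hW
  set D : ℕ → ℝ → ℝ := fun n s =>
    ((n : ℝ) + 1) * (Q s (X s (y + 1 / ((n : ℝ) + 1))) - Q s (X s y)) with hD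
  set P : ℕ → ℝ → ℝ := fun n s => ((n : ℝ) + 1) *
    (a * ρ s (X s (y + 1 / ((n : ℝ) + 1))) ^ γ - a * ρ s (X s y) ^ γ) with hP
  set Λ : ℕ → ℝ → ℝ := fun n s =>
    a * γ * max (ρ s (X s y)) (ρ s (X s (y + 1 / ((n : ℝ) + 1)))) ^ (γ - α) with hΛ
  have hΛK : ∀ n s, Λ n s ≤ K := fun n s => hmaxK _ _ _
  have hΛ0 : ∀ n s, 0 ≤ Λ n s := fun n s => by
    have := hmax s y (y + 1 / ((n : ℝ) + 1))
    positivity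
  have hDc : ∀ n, Continuous (D n) := fun n => continuous_const.mul ((hQc _).sub (hQc _))
  have hPc : ∀ n, Continuous (P n) := fun n => continuous_const.mul ((hpc _).sub (hpc _))
  have hΛc : ∀ n, Continuous (Λ n) := fun n => continuous_const.mul
    (((hrc _).max (hrc _)).rpow_const fun s => Or.inl (hmax s _ _).ne')
  have hDU : ∀ n s, |D n s| ≤ U := fun n s => by
    have := hL.potential_diff_le hU s (y₁ := y) (y₂ := y + 1 / ((n : ℝ) + 1))
      (by linarith [hh0 n])
    simp only [hD]
    rw [abs_mul, abs_of_pos (hn0 n)]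
    calc ((n : ℝ) + 1) * _ ≤ ((n : ℝ) + 1) * (U * (y + 1 / ((n : ℝ) + 1) - y)) :=
          mul_le_mul_of_nonneg_left this (hn0 n).le
      _ = U := by have := (hn0 n).ne'; field_simp; ring
  have hb1 : ∀ n, ∀ t ∈ Icc 0 T, |W n t| ≤ |W n 0| + ∫ s in (0 : ℝ)..t, Λ n s * |D n s| := by
    intro n t ht
    have h1 := (hL.increment_bounds ht y (y + 1 / ((n : ℝ) + 1))).1
    have h2 := mul_le_mul_of_nonneg_left h1 (hn0 n).le
    rw [mul_add, ← intervalIntegral.integral_const_mul] at h2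
    simp only [hW, hD, abs_mul, abs_of_pos (hn0 n)]
    refine h2.trans (le_of_eq ?_)
    congr 1
    refine intervalIntegral.integral_congr fun s _ => ?_
    simp only [hΛ]; ring
  have hb2 : ∀ n, W n t ^ 2 ≤ W n 0 ^ 2 + 2 * ∫ s in (0 : ℝ)..t, -(D n s * P n s) := by
    intro n
    have h1 := (hL.increment_bounds ht y (y + 1 / ((n : ℝ) + 1))).2
    have h2 := mul_le_mul_of_nonneg_left h1 (sq_nonneg ((n : ℝ) + 1))
    rw [mul_add, mul_left_comm, ← intervalIntegral.integral_const_mul] at h2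
    simp only [hW, mul_pow]
    refine h2.trans (le_of_eq ?_)
    congr 2
    refine intervalIntegral.integral_congr fun s _ => ?_
    simp only [hD, hP]; ring
  have hWt : ∀ s, DifferentiableAt ℝ (ρ s) (X s y) →
      Tendsto (fun n => W n s) atTop (𝓝 (effVel α ρ u s (X s y))) := fun s hs =>
    tendsto_diffQuot (hL.hasDerivAt_transported hs)
  have hDt : ∀ s, Tendsto (fun n => D n s) atTop (𝓝 (u s (X s y))) := fun s =>
    tendsto_diffQuot (hL.hasDerivAt_potential_comp s y)
  have hPt : ∀ s, DifferentiableAt ℝ (ρ s) (X s y) → Tendsto (fun n => P n s) atTop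
      (𝓝 (a * (γ * ρ s (X s y) ^ (γ - 2) * deriv (ρ s) (X s y)))) := fun s hs =>
    tendsto_diffQuot ((hL.hasDerivAt_rpow_comp γ hs).const_mul a)
  have hΛt : ∀ s, Tendsto (fun n => Λ n s) atTop (𝓝 (a * γ * ρ s (X s y) ^ (γ - α))) := fun s => by
    have h1 : Tendsto (fun n : ℕ => ρ s (X s (y + 1 / ((n : ℝ) + 1)))) atTop (𝓝 (ρ s (X s y))) :=
      ((continuous_slice_space (hX.cont_comp hL.cont_density) s).tendsto y).comp hyn
    have h2 := (tendsto_const_nhds (x := ρ s (X s y)) (f := atTop (α := ℕ))).max h1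
    rw [max_self] at h2
    exact (h2.rpow_const (Or.inl (hL.density_pos _ _).ne')).const_mul _
  -- uniform bound on the scaled increments
  obtain ⟨L, hLb⟩ := (hWt 0 h0).abs.bddAbove_range
  have hLb' : ∀ n, |W n 0| ≤ L := fun n => hLb ⟨n, rfl⟩
  have hWL : ∀ n, ∀ s ∈ Icc 0 T, |W n s| ≤ L + K * U * T := by
    intro n s hs
    refine (hb1 n s hs).trans (add_le_add (hLb' n) ?_)
    calc ∫ r in (0 : ℝ)..s, Λ n r * |D n r| ≤ ∫ _ in (0 : ℝ)..s, K * U :=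
          intervalIntegral.integral_mono_on hs.1
            (((hΛc n).mul (hDc n).abs).intervalIntegrable _ _) (by simp)
            fun r _ => mul_le_mul (hΛK n r) (hDU n r) (abs_nonneg _) hK0
      _ = K * U * s := by simp only [intervalIntegral.integral_const, smul_eq_mul]; ring
      _ ≤ K * U * T := mul_le_mul_of_nonneg_left hs.2 (by positivity)
  have hPb : ∀ n, ∀ s ∈ Icc 0 T, |P n s| ≤ K * (L + K * U * T + U) := by
    intro n s hs
    have h1 := (pressure_increment hL.a_pos hL.α_pos hL.le_γ (hL.density_pos s (X s y))
      (hL.density_pos s (X s (y + 1 / ((n : ℝ) + 1))))).2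
    have h2 : ((n : ℝ) + 1) * (ρ s (X s (y + 1 / ((n : ℝ) + 1))) ^ α / α - ρ s (X s y) ^ α / α) =
        W n s - D n s := by simp only [hW, hD, hV]; ring
    have h3 : |P n s| ≤ Λ n s * |W n s - D n s| := by
      rw [← h2]
      simp only [hP, abs_mul, abs_of_pos (hn0 n)]
      calc ((n : ℝ) + 1) * _ ≤ ((n : ℝ) + 1) * _ := mul_le_mul_of_nonneg_left h1 (hn0 n).le
        _ = _ := by simp only [hΛ]; ring
    refine h3.trans (mul_le_mul (hΛK n s) ?_ (abs_nonneg _) hK0)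
    exact (abs_sub _ _).trans (add_le_add (hWL n s hs) (hDU n s))
  constructor
  · have hlim := intervalIntegral.tendsto_integral_filter_of_dominated_convergence
      (μ := volume) (a := 0) (b := t) (l := atTop) (F := fun n s => Λ n s * |D n s|)
      (f := fun s => a * γ * ρ s (X s y) ^ (γ - α) * |u s (X s y)|) (fun _ => K * U)
      (Eventually.of_forall fun n => ((hΛc n).mul (hDc n).abs).aestronglyMeasurable)
      (Eventually.of_forall fun n => ae_of_all _ fun s _ => by
        rw [Real.norm_eq_abs, abs_mul, abs_abs, abs_of_nonneg (hΛ0 n s)]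
        exact mul_le_mul (hΛK n s) (hDU n s) (abs_nonneg _) hK0)
      (by simp) (ae_of_all _ fun s _ => (hΛt s).mul (hDt s).abs)
    exact le_of_tendsto_of_tendsto' (hWt t hdt).abs ((hWt 0 h0).abs.add hlim)
      fun n => hb1 n t ht
  · have hlim := intervalIntegral.tendsto_integral_filter_of_dominated_convergence
      (μ := volume) (a := 0) (b := t) (l := atTop) (F := fun n s => -(D n s * P n s))
      (f := fun s => -(u s (X s y) * (a * (γ * ρ s (X s y) ^ (γ - 2) * deriv (ρ s) (X s y)))))
      (fun _ => U * (K * (L + K * U * T + U)))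
      (Eventually.of_forall fun n => ((hDc n).mul (hPc n)).neg.aestronglyMeasurable)
      (Eventually.of_forall fun n => ae_of_all _ fun s hs => by
        rw [norm_neg, Real.norm_eq_abs, abs_mul]
        exact mul_le_mul (hDU n s) (hPb n s (Ioc_subset_Icc_self (uIoc_subset_of_mem_Icc ht hs)))
          (abs_nonneg _) hU0)
      (by simp) ((ae_mem_uIoc ht hds).mono fun s h hs => ((hDt s).mul (hPt s (h hs))).neg)
    exact le_of_tendsto_of_tendsto' ((hWt t hdt).pow 2)
      (((hWt 0 h0).pow 2).add (hlim.const_mul 2)) fun n => hb2 n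

end LagrangianFlow

end Flow

section Flow

variable {a α γ T : ℝ} {rbar : ℝ → ℝ} {ρ u ρt ut ρx ux uxx X Q : ℝ → ℝ → ℝ}

namespace IsFlowMap

lemma injective_massCoord (hX : IsFlowMap T ρ u X) (t : ℝ) :
    Function.Injective (massCoord ρ u t) := Function.LeftInverse.injective (hX.left_inv t)

lemma surjective_massCoord (hX : IsFlowMap T ρ u X) (t : ℝ) :
    Function.Surjective (massCoord ρ u t) := Function.RightInverse.surjective (hX.right_inv t)

lemma integrable_comp_iff (hX : IsFlowMap T ρ u X) (hρ : Continuous (Function.uncurry ρ))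
    (hpos : ∀ t x, 0 < ρ t x) (t : ℝ) (g : ℝ → ℝ) :
    Integrable (fun y => g (X t y)) ↔ Integrable fun x => ρ t x * g x := by
  have h := integrableOn_image_iff_integrableOn_abs_deriv_smul MeasurableSet.univ
    (fun x _ => (hasDerivAt_massCoord hρ u t x).hasDerivWithinAt)
    (hX.injective_massCoord t).injOn (fun y => g (X t y))
  rw [image_univ, (hX.surjective_massCoord t).range_eq, integrableOn_univ, integrableOn_univ] at h
  rw [h]
  simp only [hX.left_inv, abs_of_pos (hpos t _), smul_eq_mul]

lemma integral_comp_univ (hX : IsFlowMap T ρ u X) (hρ : Continuous (Function.uncurry ρ))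
    (hpos : ∀ t x, 0 < ρ t x) (t : ℝ) (g : ℝ → ℝ) :
    ∫ y, g (X t y) = ∫ x, ρ t x * g x := by
  have h := integral_image_eq_integral_abs_deriv_smul MeasurableSet.univ
    (fun x _ => (hasDerivAt_massCoord hρ u t x).hasDerivWithinAt)
    (hX.injective_massCoord t).injOn (fun y => g (X t y))
  rw [image_univ, (hX.surjective_massCoord t).range_eq, setIntegral_univ, setIntegral_univ] at h
  rw [h]
  simp only [hX.left_inv, abs_of_pos (hpos t _), smul_eq_mul]

lemma ae_comp (hX : IsFlowMap T ρ u X) (hρ : Continuous (Function.uncurry ρ)) (t : ℝ)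
    {p : ℝ → Prop} (h : ∀ᵐ x, p x) : ∀ᵐ y, p (X t y) := by
  have h1 := addHaar_image_eq_zero_of_differentiableOn_of_addHaar_eq_zero volume
    (f := massCoord ρ u t) (s := {x | ¬ p x})
    (fun x _ => (hasDerivAt_massCoord hρ u t x).differentiableAt.differentiableWithinAt) h
  refine measure_mono_null ?_ h1
  exact fun y hy => ⟨X t y, hy, hX.right_inv t y⟩

lemma ae_of_ae_comp (hX : IsFlowMap T ρ u X) (t : ℝ)
    {p : ℝ → Prop} (h : ∀ᵐ y, p (X t y)) : ∀ᵐ x, p x := by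
  have h1 := addHaar_image_eq_zero_of_differentiableOn_of_addHaar_eq_zero volume
    (f := X t) (s := {y | ¬ p (X t y)})
    (fun y _ => (hX.space t y).differentiableAt.differentiableWithinAt) h
  refine measure_mono_null ?_ h1
  refine fun x hx => ⟨massCoord ρ u t x, ?_, hX.left_inv t x⟩
  change ¬ p (X t (massCoord ρ u t x))
  rw [hX.left_inv]
  exact hx

end IsFlowMap

namespace LagrangianFlow

lemma ae_differentiable (hL : LagrangianFlow a α γ T ρ u X Q)
    (hd : ∀ᵐ s ∂volume.restrict (Ioc 0 T), ∀ᵐ x, DifferentiableAt ℝ (ρ s) x) :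
    ∀ᵐ y, ∀ᵐ s ∂volume.restrict (Ioc 0 T), DifferentiableAt ℝ (ρ s) (X s y) := by
  have hm : MeasurableSet {p : ℝ × ℝ | DifferentiableAt ℝ (ρ p.1) (X p.1 p.2)} :=
    (measurableSet_of_differentiableAt_with_param ℝ hL.cont_density).preimage
      (continuous_fst.prodMk hL.flow.cont).measurable
  rw [← Measure.ae_ae_comm hm]
  filter_upwards [hd] with s hs using hL.flow.ae_comp hL.cont_density s hs

/-- The effective velocity is bounded in terms of its initial value and of the damping. -/
theorem effVel_le (hL : LagrangianFlow a α γ T ρ u X Q)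
    (hd : ∀ᵐ s ∂volume.restrict (Ioc 0 T), ∀ᵐ x, DifferentiableAt ℝ (ρ s) x)
    (hd0 : ∀ᵐ x, DifferentiableAt ℝ (ρ 0) x) {A : ℝ} (hA : ∀ᵐ x, |effVel α ρ u 0 x| ≤ A)
    {k : ℝ → ℝ} (hk : IntegrableOn k (Ioc 0 T))
    (hks : ∀ᵐ s ∂volume.restrict (Ioc 0 T), ∀ x, a * γ * ρ s x ^ (γ - α) * |u s x| ≤ k s) :
    ∀ᵐ t ∂volume.restrict (Ioc 0 T), ∀ᵐ x, |effVel α ρ u t x| ≤ A + ∫ s in Ioc 0 T, k s := by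
  filter_upwards [hd, ae_restrict_mem measurableSet_Ioc] with t hdt ht
  have ht' : t ∈ Icc 0 T := Ioc_subset_Icc_self ht
  refine hL.flow.ae_of_ae_comp t ?_
  filter_upwards [hL.ae_differentiable hd, hL.flow.ae_comp hL.cont_density 0 hd0,
    hL.flow.ae_comp hL.cont_density t hdt, hL.flow.ae_comp hL.cont_density 0 hA]
    with y h1 h2 h3 h4
  refine (hL.effVel_bounds ht' h2 h3 h1).1.trans (add_le_add h4 ?_)
  have hc : Continuous fun s => a * γ * ρ s (X s y) ^ (γ - α) * |u s (X s y)| :=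
    (continuous_const.mul (continuous_slice_time (hL.flow.cont_comp (hL.cont_rpow (γ - α))) y)).mul
      (continuous_slice_time (hL.flow.cont_comp hL.cont_velocity) y).abs
  have hγ0 : 0 ≤ γ := hL.α_pos.le.trans hL.le_γ
  have hk0 : ∀ᵐ s ∂volume.restrict (Ioc 0 T), 0 ≤ k s := by
    filter_upwards [hks] with s hs
    refine le_trans ?_ (hs 0)
    have := hL.a_pos
    have := hL.density_pos s 0
    positivity
  rw [intervalIntegral.integral_of_le ht.1.le]
  calc _ ≤ ∫ s in Ioc 0 t, k s :=
        setIntegral_mono_ae_restrict (hc.integrableOn_Ioc)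
          (hk.mono_set (Ioc_subset_Ioc_right ht.2))
          (ae_restrict_of_ae_restrict_of_subset (Ioc_subset_Ioc_right ht.2)
            (hks.mono fun s hs => hs _))
    _ ≤ _ := setIntegral_mono_set hk hk0 (Ioc_subset_Ioc_right ht.2).eventuallyLE

/-- The entropy inequality for the effective velocity. -/
theorem integral_effVel_sq_le (hL : LagrangianFlow a α γ T ρ u X Q)
    (hd : ∀ᵐ s ∂volume.restrict (Ioc 0 T), ∀ᵐ x, DifferentiableAt ℝ (ρ s) x)
    (hd0 : ∀ᵐ x, DifferentiableAt ℝ (ρ 0) x)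
    (hi : ∀ᵐ s ∂volume.restrict (Ioc 0 T), Integrable fun x => ρ s x * effVel α ρ u s x ^ 2)
    (hi0 : Integrable fun x => ρ 0 x * effVel α ρ u 0 x ^ 2)
    (hw : Integrable (Function.uncurry fun s x =>
      u s x * (a * γ * ρ s x ^ (γ - 1) * deriv (ρ s) x)) (stripMeasure T)) :
    ∀ᵐ t ∂volume.restrict (Ioc 0 T),
      ∫ x, ρ t x * effVel α ρ u t x ^ 2 ≤ (∫ x, ρ 0 x * effVel α ρ u 0 x ^ 2) -
        2 * ∫ s in (0 : ℝ)..t, ∫ x, u s x * (a * γ * ρ s x ^ (γ - 1) * deriv (ρ s) x) := by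
  have hρ := hL.cont_density
  have hpos := hL.density_pos
  have hX := hL.flow
  set f : ℝ → ℝ → ℝ := fun s x => -(u s x * (a * (γ * ρ s x ^ (γ - 2) * deriv (ρ s) x))) with hf
  have hfm : Measurable (Function.uncurry f) := by
    have h1 := measurable_deriv_with_param hρ
    exact (hL.cont_velocity.measurable.mul ((((hL.cont_rpow (γ - 2)).measurable.const_mul γ).mul
      h1).const_mul a)).neg
  have hρf : ∀ s x, ρ s x * f s x = -(u s x * (a * γ * ρ s x ^ (γ - 1) * deriv (ρ s) x)) := by
    intro s x
    have e : ρ s x ^ (γ - 1) = ρ s x ^ (γ - 2) * ρ s x := by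
      rw [← Real.rpow_add_one (hpos s x).ne']; ring_nf
    simp only [hf]; rw [e]; ring
  have hFi : Integrable (Function.uncurry fun s y => f s (X s y)) (stripMeasure T) := by
    have hw' : Integrable (Function.uncurry fun s x => ρ s x * f s x) (stripMeasure T) := by
      simp only [hρf]; exact hw.neg
    refine (integrable_prod_iff (hfm.comp (continuous_fst.prodMk
      hX.cont).measurable).aestronglyMeasurable).2 ⟨?_, ?_⟩
    · filter_upwards [hw'.prod_right_ae] with s hs
      exact (hX.integrable_comp_iff hρ hpos s (f s)).2 hs
    · refine hw'.integral_norm_prod_left.congr (ae_of_all _ fun s => ?_)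
      have := hX.integral_comp_univ hρ hpos s fun x => ‖f s x‖
      simp only [Function.uncurry, norm_mul, Real.norm_eq_abs, abs_of_pos (hpos _ _)] at this ⊢
      exact this.symm
  filter_upwards [hd, hi, ae_restrict_mem measurableSet_Ioc] with t hdt hit ht
  have ht' : t ∈ Icc 0 T := Ioc_subset_Icc_self ht
  have hFt : Integrable (Function.uncurry fun s y => f s (X s y))
      ((volume.restrict (uIoc 0 t)).prod volume) :=
    hFi.mono_measure (Measure.prod_mono
      (Measure.restrict_mono (uIoc_subset_of_mem_Icc ht') le_rfl) le_rfl)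
  have hFy : Integrable fun y => ∫ s in (0 : ℝ)..t, f s (X s y) := by
    simp_rw [intervalIntegral.integral_of_le ht.1.le]
    rw [uIoc_of_le ht.1.le] at hFt
    exact hFt.integral_prod_right
  have h1 : ∀ᵐ y, effVel α ρ u t (X t y) ^ 2 ≤ effVel α ρ u 0 (X 0 y) ^ 2 +
      2 * ∫ s in (0 : ℝ)..t, f s (X s y) := by
    filter_upwards [hL.ae_differentiable hd, hX.ae_comp hρ 0 hd0, hX.ae_comp hρ t hdt]
      with y h1 h2 h3 using (hL.effVel_bounds ht' h2 h3 h1).2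
  have j1 := (hX.integrable_comp_iff hρ hpos t fun x => effVel α ρ u t x ^ 2).2 hit
  have j0 := (hX.integrable_comp_iff hρ hpos 0 fun x => effVel α ρ u 0 x ^ 2).2 hi0
  have h2 := integral_mono_ae j1 (j0.add (hFy.const_mul 2)) h1
  rw [integral_add' j0 (hFy.const_mul 2), integral_const_mul,
    hX.integral_comp_univ hρ hpos t fun x => effVel α ρ u t x ^ 2,
    hX.integral_comp_univ hρ hpos 0 fun x => effVel α ρ u 0 x ^ 2,
    ← intervalIntegral_integral_swap hFt] at h2
  have h3 : ∫ s in (0 : ℝ)..t, ∫ y, f s (X s y) =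
      -∫ s in (0 : ℝ)..t, ∫ x, u s x * (a * γ * ρ s x ^ (γ - 1) * deriv (ρ s) x) := by
    rw [← intervalIntegral.integral_neg]
    refine intervalIntegral.integral_congr fun s _ => ?_
    rw [hX.integral_comp_univ hρ hpos s, ← integral_neg]
    simp only [hρf]
  rw [h3] at h2
  linarith

end LagrangianFlow

end Flow

/-! ### Convexity of the potential energy -/

lemma rpow_tangent_le {γ r s : ℝ} (hγ : 1 ≤ γ) (hr : 0 < r) (hs : 0 < s) :
    s ^ γ + γ * s ^ (γ - 1) * (r - s) ≤ r ^ γ := by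
  have h1 := one_add_mul_self_le_rpow_one_add (s := r / s - 1) (p := γ)
    (by linarith [div_pos hr hs]) hγ
  rw [add_sub_cancel, Real.div_rpow hr.le hs.le, le_div_iff₀ (Real.rpow_pos_of_pos hs γ)] at h1
  have e : s ^ γ = s ^ (γ - 1) * s := by
    rw [← Real.rpow_add_one hs.ne']; ring_nf
  refine le_trans (le_of_eq ?_) h1
  rw [e]
  field_simp

lemma relPotential_nonneg {a γ r s : ℝ} (ha : 0 < a) (hγ : 1 < γ) (hr : 0 < r) (hs : 0 < s) :
    0 ≤ relPotential a γ r s := by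
  have h1 := rpow_tangent_le hγ.le hr hs
  have h2 : relPotential a γ r s = a / (γ - 1) * (r ^ γ - (s ^ γ + γ * s ^ (γ - 1) * (r - s))) := by
    rw [relPotential, potential, potential, enthalpy]; ring
  rw [h2]
  exact mul_nonneg (div_nonneg ha.le (by linarith)) (by linarith)

/-- The density is controlled by the relative potential energy. -/
lemma exists_le_relPotential {a γ M : ℝ} (ha : 0 < a) (hγ : 1 < γ) (hM : 0 < M) :
    ∃ c, 0 ≤ c ∧ ∀ r s, 0 < r → 0 < s → s ≤ M → r ≤ c * (1 + relPotential a γ r s) := by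
  set R := 2 * M with hR
  have hR0 : 0 < R := by positivity
  have hγ1 : 0 < γ - 1 := by linarith
  have hδ : M ^ (γ - 1) < R ^ (γ - 1) := Real.rpow_lt_rpow hM.le (by linarith) hγ1
  set δ := γ * (R ^ (γ - 1) - M ^ (γ - 1)) with hδ'
  have hδ0 : 0 < δ := mul_pos (by linarith) (by linarith)
  set k := max ((γ - 1) / a) ((γ - 1) * R ^ γ) with hk
  have hk0 : 0 ≤ k := le_max_of_le_left (by positivity)
  refine ⟨k / δ, by positivity, fun r s hr hs hsM => ?_⟩
  have h1 := rpow_tangent_le hγ.le hr hR0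
  have h0 := relPotential_nonneg ha hγ hr hs
  have h2 : (γ - 1) / a * relPotential a γ r s =
      r ^ γ - (s ^ γ + γ * s ^ (γ - 1) * (r - s)) := by
    rw [relPotential, potential, potential, enthalpy]; field_simp; ring
  have e : ∀ {s : ℝ}, 0 < s → s ^ γ = s ^ (γ - 1) * s := fun {s} hs => by
    rw [← Real.rpow_add_one hs.ne']; ring_nf
  have h3 : s ^ (γ - 1) ≤ M ^ (γ - 1) := Real.rpow_le_rpow hs.le hsM hγ1.le
  have h4 : δ * r ≤ (γ - 1) / a * relPotential a γ r s + (γ - 1) * R ^ γ := by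
    rw [h2, hδ']
    have h5 : γ * (s ^ (γ - 1) * r) ≤ γ * (M ^ (γ - 1) * r) := by gcongr
    have h6 : 0 ≤ (γ - 1) * s ^ γ := by positivity
    have := e hs
    have := e hR0
    nlinarith
  have h7 : δ * r ≤ k * (1 + relPotential a γ r s) := by
    have := mul_le_mul_of_nonneg_right (le_max_left ((γ - 1) / a) ((γ - 1) * R ^ γ)) h0
    have := le_max_right ((γ - 1) / a) ((γ - 1) * R ^ γ)
    rw [mul_add, mul_one]
    linarith
  rw [div_mul_eq_mul_div, le_div_iff₀ hδ0]
  linarith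

/-- Grönwall's inequality in integral form. -/
lemma le_exp_of_le_integral {G : ℝ → ℝ} {T G₀ B : ℝ} (hG : ContinuousOn G (Icc 0 T)) (hB : 0 ≤ B)
    (h : ∀ t ∈ Icc 0 T, G t ≤ G₀ + B * ∫ s in (0 : ℝ)..t, G s) {t : ℝ} (ht : t ∈ Icc 0 T) :
    G t ≤ G₀ * Real.exp (B * t) := by
  set H : ℝ → ℝ := fun t => ∫ s in (0 : ℝ)..t, G s with hH
  have hi : IntervalIntegrable G volume 0 t :=
    ContinuousOn.intervalIntegrable (by
      rw [uIcc_of_le ht.1]; exact hG.mono (Icc_subset_Icc_right ht.2))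
  have hHc : ContinuousOn H (Icc 0 t) := by
    have := intervalIntegral.continuousOn_primitive_interval
      ((intervalIntegrable_iff' (by simp)).1 hi)
    rwa [uIcc_of_le ht.1] at this
  have hHd : ∀ s ∈ Ioo 0 t, HasDerivAt H (G s) s := fun s hs => by
    have hGs : ContinuousAt G s := hG.continuousAt (Icc_mem_nhds hs.1 (hs.2.trans_le ht.2))
    refine intervalIntegral.integral_hasDerivAt_right
      (hi.mono_set ?_) ?_ hGs
    · rw [uIcc_of_le hs.1.le, uIcc_of_le ht.1]; exact Icc_subset_Icc_right hs.2.le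
    · exact (hG.mono Ioo_subset_Icc_self).stronglyMeasurableAtFilter isOpen_Ioo s
        ⟨hs.1, hs.2.trans_le ht.2⟩
  have hder : ∀ s ∈ Ioo 0 t, HasDerivAt (fun s => Real.exp (-(B * s)) * (G₀ + B * H s))
      (B * Real.exp (-(B * s)) * (G s - (G₀ + B * H s))) s := fun s hs => by
    have h1 : HasDerivAt (fun s => Real.exp (-(B * s))) (Real.exp (-(B * s)) * -(B * 1)) s :=
      ((hasDerivAt_id s).const_mul B).neg.exp
    refine (h1.mul (((hHd s hs).const_mul B).const_add G₀)).congr_deriv ?_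
    ring
  have hanti : AntitoneOn (fun s => Real.exp (-(B * s)) * (G₀ + B * H s)) (Icc 0 t) := by
    refine antitoneOn_of_deriv_nonpos (convex_Icc 0 t) ?_ ?_ ?_
    · exact (by fun_prop : Continuous fun s => Real.exp (-(B * s))).continuousOn.mul
        (continuousOn_const.add (continuousOn_const.mul hHc))
    · rw [interior_Icc]
      exact fun s hs => (hder s hs).differentiableAt.differentiableWithinAt
    · rw [interior_Icc]
      intro s hs
      rw [(hder s hs).deriv]
      refine mul_nonpos_of_nonneg_of_nonpos (by positivity) ?_
      linarith [h s ⟨hs.1.le, hs.2.le.trans ht.2⟩]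
  have h1 := hanti (left_mem_Icc.2 ht.1) (right_mem_Icc.2 ht.1) ht.1
  simp only [hH, intervalIntegral.integral_same, mul_zero, neg_zero, Real.exp_zero, one_mul,
    add_zero] at h1
  rw [Real.exp_neg, inv_mul_le_iff₀ (Real.exp_pos _)] at h1
  exact (h t ht).trans (h1.trans_eq (mul_comm _ _))

lemma integral_integral_sub {T t : ℝ} {f g : ℝ → ℝ → ℝ} (ht : t ∈ Icc 0 T)
    (hf : Integrable (Function.uncurry f) (stripMeasure T))
    (hg : Integrable (Function.uncurry g) (stripMeasure T)) (c d : ℝ) :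
    ∫ s in (0 : ℝ)..t, ∫ x, (c * f s x - d * g s x) =
      c * (∫ s in (0 : ℝ)..t, ∫ x, f s x) - d * ∫ s in (0 : ℝ)..t, ∫ x, g s x := by
  have hI : ∀ {f : ℝ → ℝ → ℝ}, Integrable (Function.uncurry f) (stripMeasure T) →
      IntervalIntegrable (fun s => ∫ x, f s x) volume 0 t := fun {f} hf =>
    (intervalIntegrable_iff_integrableOn_Ioc_of_le ht.1).2
      (IntegrableOn.mono_set (t := Ioc 0 T) hf.integral_prod_left (Ioc_subset_Ioc_right ht.2))
  rw [← intervalIntegral.integral_const_mul, ← intervalIntegral.integral_const_mul,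
    ← intervalIntegral.integral_sub ((hI hf).const_mul c) ((hI hg).const_mul d)]
  refine intervalIntegral.integral_congr_ae (ae_mem_uIoc ht ?_)
  filter_upwards [hf.prod_right_ae, hg.prod_right_ae] with s h1 h2
  have h1' : Integrable (f s) := h1
  have h2' : Integrable (g s) := h2
  rw [integral_sub (h1'.const_mul c) (h2'.const_mul d), integral_const_mul, integral_const_mul]

/-- Quantitative bounds on the initial data. -/
structure InitialBounds (a α γ : ℝ) (rbar : ℝ → ℝ) (ρ u : ℝ → ℝ → ℝ) (E : ℝ) : Prop where
  kinetic : Integrable fun x => ρ 0 x * u 0 x ^ 2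
  kinetic_le : ∫ x, ρ 0 x * u 0 x ^ 2 ≤ E
  quartic : Integrable fun x => ρ 0 x * u 0 x ^ 4
  quartic_le : ∫ x, ρ 0 x * u 0 x ^ 4 ≤ E
  relPotential : Integrable fun x => relPotential a γ (ρ 0 x) (rbar x)
  relPotential_le : ∫ x, DegenerateNS.relPotential a γ (ρ 0 x) (rbar x) ≤ E
  effVel_sq : Integrable fun x => ρ 0 x * effVel α ρ u 0 x ^ 2
  effVel_sq_le : ∫ x, ρ 0 x * effVel α ρ u 0 x ^ 2 ≤ E
  effVel_le : ∀ᵐ x, |effVel α ρ u 0 x| ≤ E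
  differentiable : ∀ᵐ x, DifferentiableAt ℝ (ρ 0) x

section Energy

variable {a α γ : ℝ} {rbar : ℝ → ℝ} {rm rp : ℝ}

/-- The source term in the energy balance is controlled by the energy. -/
lemma exists_source_bound (ha : 0 < a) (hγ : 1 < γ) (hb : IsBackground rbar rm rp) :
    ∃ B, 0 ≤ B ∧ ∀ r v : ℝ → ℝ, (∀ x, 0 < r x) → Integrable (fun x => r x * v x ^ 2) →
      Integrable (fun x => relPotential a γ (r x) (rbar x)) →
      |∫ x, r x * v x * (a * γ * rbar x ^ (γ - 2) * deriv rbar x)| ≤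
        B * (1 + ((∫ x, r x * v x ^ 2) / 2 + ∫ x, relPotential a γ (r x) (rbar x))) := by
  obtain ⟨m, M, hm, hmM⟩ := hb.bounds
  obtain ⟨hb1, hb2, -⟩ := hb.memLp_deriv
  have hM : 0 < M := hm.trans_le ((hmM 0).1.trans (hmM 0).2)
  obtain ⟨c, hc0, hc⟩ := exists_le_relPotential ha hγ hM
  set S : ℝ → ℝ := fun x => a * γ * rbar x ^ (γ - 2) * deriv rbar x with hS
  have hSc : Continuous S := (continuous_const.mul (hb.smooth.continuous.rpow_const
    fun x => Or.inl (hm.trans_le (hmM x).1).ne')).mul hb1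
  obtain ⟨K, hK⟩ := (isCompact_Icc (a := (-1 : ℝ)) (b := 1)).exists_bound_of_continuousOn
    hSc.continuousOn
  have hS0 : ∀ x, x ∉ Icc (-1 : ℝ) 1 → S x = 0 := fun x hx => by
    simp only [hS, hb2 x hx, mul_zero]
  refine ⟨1 + K ^ 2 * c, by positivity, fun r v hr hkin hpot => ?_⟩
  have hp0 : ∀ x, 0 ≤ relPotential a γ (r x) (rbar x) := fun x =>
    relPotential_nonneg ha hγ (hr x) (hm.trans_le (hmM x).1)
  have hI : Integrable ((Icc (-1 : ℝ) 1).indicator fun _ => (1 : ℝ)) :=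
    (integrable_indicator_iff measurableSet_Icc).2 (by simp)
  have hbound : ∀ x, ‖r x * v x * S x‖ ≤ 1 / 2 * (r x * v x ^ 2) +
      K ^ 2 * c / 2 * ((Icc (-1 : ℝ) 1).indicator (fun _ => (1 : ℝ)) x +
        relPotential a γ (r x) (rbar x)) := by
    intro x
    have h1 : ‖r x * v x * S x‖ ≤ 1 / 2 * (r x * v x ^ 2) + 1 / 2 * (r x * S x ^ 2) := by
      rw [Real.norm_eq_abs, abs_le]
      have := hr x
      constructor <;> nlinarith [mul_nonneg (hr x).le (sq_nonneg (v x + S x)),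
        mul_nonneg (hr x).le (sq_nonneg (v x - S x))]
    refine h1.trans (add_le_add le_rfl ?_)
    by_cases hx : x ∈ Icc (-1 : ℝ) 1
    · rw [indicator_of_mem hx]
      have h2 : S x ^ 2 ≤ K ^ 2 := by
        rw [← sq_abs]; exact pow_le_pow_left₀ (abs_nonneg _) (hK x hx) 2
      have h3 := hc (r x) (rbar x) (hr x) (hm.trans_le (hmM x).1) (hmM x).2
      have h4 : r x * S x ^ 2 ≤ c * (1 + relPotential a γ (r x) (rbar x)) * K ^ 2 :=
        mul_le_mul h3 h2 (sq_nonneg _) ((hr x).le.trans h3)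
      linarith
    · rw [hS0 x hx, indicator_of_notMem hx]
      have := hp0 x
      have : 0 ≤ K ^ 2 * c / 2 * (0 + relPotential a γ (r x) (rbar x)) := by positivity
      simpa using this
  have h5 := norm_integral_le_of_norm_le ((hkin.const_mul (1 / 2)).add
    ((hI.add hpot).const_mul (K ^ 2 * c / 2))) (ae_of_all _ hbound)
  rw [integral_add' (hkin.const_mul (1 / 2)) ((hI.add hpot).const_mul (K ^ 2 * c / 2)),
    integral_const_mul, integral_const_mul, integral_add' hI hpot,
    integral_indicator_const _ measurableSet_Icc] at h5
  simp only [Real.volume_real_Icc, Real.norm_eq_abs] at h5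
  norm_num at h5
  have hk0 : 0 ≤ ∫ x, r x * v x ^ 2 := integral_nonneg fun x =>
    mul_nonneg (hr x).le (sq_nonneg _)
  have hq0 : 0 ≤ ∫ x, relPotential a γ (r x) (rbar x) := integral_nonneg hp0
  refine h5.trans ?_
  have : 0 ≤ K ^ 2 * c := by positivity
  nlinarith [mul_nonneg this hk0, mul_nonneg this hq0]

/-- The energy estimate. -/
theorem exists_energy_bound (ha : 0 < a) (hγ : 1 < γ) (hb : IsBackground rbar rm rp)
    (E S : ℝ) :
    ∃ C, ∀ (T : ℝ) (ρ u ρt ut ρx ux uxx : ℝ → ℝ → ℝ), T ≤ S →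
      RegularFlow a α γ T rbar ρ u ρt ut ρx ux uxx → InitialBounds a α γ rbar ρ u E →
      (∀ t ∈ Icc 0 T, (Integrable fun x => ρ t x * u t x ^ 2) ∧
        (Integrable fun x => relPotential a γ (ρ t x) (rbar x)) ∧
        ∫ x, ρ t x * u t x ^ 2 ≤ C ∧ ∫ x, relPotential a γ (ρ t x) (rbar x) ≤ C ∧
        -∫ s in (0 : ℝ)..t, ∫ x, u s x * (a * γ * ρ s x ^ (γ - 1) * ρx s x) ≤ C) ∧
      ∫ s in Ioc 0 T, ∫ x, ρ s x ^ α * ux s x ^ 2 ≤ C := by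
  obtain ⟨B, hB0, hB⟩ := exists_source_bound ha hγ hb
  obtain ⟨mb, Mb, hmb, hmMb⟩ := hb.bounds
  set C₁ := (1 + (|E| / 2 + |E|)) * Real.exp (B * |S|) with hC₁
  refine ⟨2 * C₁ + 2 * |E| + |S| * B * C₁, fun T ρ u ρt ut ρx ux uxx hTS hF h0 => ?_⟩
  have hT := hF.T_pos
  have hpos := hF.density_pos
  have hEabs := le_abs_self E
  have hE0 : 0 ≤ |E| := abs_nonneg E
  have hTS' : T ≤ |S| := hTS.trans (le_abs_self S)
  have hC₁0 : 0 < C₁ := by positivity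
  have hkin : ∀ t ∈ Icc 0 T, Integrable fun x => ρ t x * u t x ^ 2 := fun t ht => by
    have := (hF.balance_moment 0 ht).1.add h0.kinetic
    refine this.congr (ae_of_all _ fun x => ?_)
    simp
  have hpot : ∀ t ∈ Icc 0 T, Integrable fun x => relPotential a γ (ρ t x) (rbar x) :=
    fun t ht => by
    have := (hF.balance_potential hγ hb ht).1.add h0.relPotential
    refine this.congr (ae_of_all _ fun x => ?_)
    simp
  have iD : Integrable (Function.uncurry fun s x => ρ s x ^ α * ux s x ^ 2) (stripMeasure T) := by
    simpa using hF.integrable_dissipation 0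
  have iw : Integrable (Function.uncurry fun s x => u s x * (a * γ * ρ s x ^ (γ - 1) * ρx s x))
      (stripMeasure T) := by
    simpa using hF.integrable_work 0
  have iσ := hF.integrable_source hb
  set D : ℝ → ℝ := fun s => ∫ x, ρ s x ^ α * ux s x ^ 2 with hD
  set w : ℝ → ℝ := fun s => ∫ x, u s x * (a * γ * ρ s x ^ (γ - 1) * ρx s x) with hw
  set σ : ℝ → ℝ := fun s => ∫ x, ρ s x * u s x * (a * γ * rbar x ^ (γ - 2) * deriv rbar x) with hσ
  set e : ℝ → ℝ := fun t => ∫ x, ρ t x * u t x ^ 2 with he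
  set π : ℝ → ℝ := fun t => ∫ x, relPotential a γ (ρ t x) (rbar x) with hπ
  have hDi : IntegrableOn D (Ioc 0 T) := iD.integral_prod_left
  have hσi : IntegrableOn σ (Ioc 0 T) := iσ.integral_prod_left
  have hsub : ∀ t ∈ Icc 0 T, Ioc 0 t ⊆ Ioc 0 T := fun t ht => Ioc_subset_Ioc_right ht.2
  have hDI : ∀ t ∈ Icc 0 T, IntervalIntegrable D volume 0 t := fun t ht =>
    (intervalIntegrable_iff_integrableOn_Ioc_of_le ht.1).2 (hDi.mono_set (hsub t ht))
  have hσI : ∀ t ∈ Icc 0 T, IntervalIntegrable σ volume 0 t := fun t ht =>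
    (intervalIntegrable_iff_integrableOn_Ioc_of_le ht.1).2 (hσi.mono_set (hsub t ht))
  have hD0 : ∀ s, 0 ≤ D s := fun s => integral_nonneg fun x =>
    mul_nonneg (Real.rpow_nonneg (hpos s x).le _) (sq_nonneg _)
  have he0 : ∀ t, 0 ≤ e t := fun t => integral_nonneg fun x =>
    mul_nonneg (hpos t x).le (sq_nonneg _)
  have hπ0 : ∀ t, 0 ≤ π t := fun t => integral_nonneg fun x =>
    relPotential_nonneg ha hγ (hpos t x) (hmb.trans_le (hmMb x).1)
  have hbe : ∀ t ∈ Icc 0 T, e t - e 0 = -2 * (∫ s in (0 : ℝ)..t, D s) -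
      2 * ∫ s in (0 : ℝ)..t, w s := fun t ht => by
    have h1 := (hF.balance_moment 0 ht).2
    simp only [Nat.cast_zero, zero_add, pow_zero, one_mul, pow_one] at h1
    rw [integral_sub (hkin t ht) h0.kinetic] at h1
    have h2 := integral_integral_sub ht iD iw (-2) 2
    simp only [mul_one] at h1
    rw [h2] at h1
    exact h1
  have hbπ : ∀ t ∈ Icc 0 T, π t - π 0 = (∫ s in (0 : ℝ)..t, w s) -
      ∫ s in (0 : ℝ)..t, σ s := fun t ht => by
    have h1 := (hF.balance_potential hγ hb ht).2
    rw [integral_sub (hpot t ht) h0.relPotential] at h1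
    have h2 := integral_integral_sub ht iw iσ 1 1
    simp only [one_mul] at h2
    rw [h2] at h1
    exact h1
  set F : ℝ → ℝ := fun t => 1 + (e t / 2 + π t) with hFdef
  have hFeq : ∀ t ∈ Icc 0 T, F t = F 0 - ∫ s in (0 : ℝ)..t, (D s + σ s) := fun t ht => by
    rw [intervalIntegral.integral_add (hDI t ht) (hσI t ht)]
    simp only [hFdef]
    linarith [hbe t ht, hbπ t ht]
  have hFc : ContinuousOn F (Icc 0 T) := by
    have h1 : IntegrableOn (fun s => D s + σ s) (uIcc 0 T) := by
      rw [uIcc_of_le hT.le, integrableOn_Icc_iff_integrableOn_Ioc]; exact hDi.add hσi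
    have h2 := intervalIntegral.continuousOn_primitive_interval h1
    rw [uIcc_of_le hT.le] at h2
    exact (continuousOn_const.sub h2).congr hFeq
  have hFI : ∀ t ∈ Icc 0 T, IntervalIntegrable F volume 0 t := fun t ht =>
    ContinuousOn.intervalIntegrable (by
      rw [uIcc_of_le ht.1]; exact hFc.mono (Icc_subset_Icc_right ht.2))
  have hσB : ∀ s ∈ Icc 0 T, |σ s| ≤ B * F s := fun s hs =>
    hB (ρ s) (u s) (hpos s) (hkin s hs) (hpot s hs)
  have hσint : ∀ t ∈ Icc 0 T, |∫ s in (0 : ℝ)..t, σ s| ≤ B * ∫ s in (0 : ℝ)..t, F s :=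
    fun t ht => by
    rw [← intervalIntegral.integral_const_mul]
    refine intervalIntegral.norm_integral_le_of_norm_le (f := σ) ht.1
      (ae_of_all _ fun s hs => hσB s ⟨hs.1.le, hs.2.trans ht.2⟩) ((hFI t ht).const_mul B)
  have hDint : ∀ t ∈ Icc 0 T, 0 ≤ ∫ s in (0 : ℝ)..t, D s := fun t ht =>
    intervalIntegral.integral_nonneg ht.1 fun s _ => hD0 s
  have hF0 : F 0 ≤ 1 + (|E| / 2 + |E|) := by
    simp only [hFdef, he, hπ]
    linarith [h0.kinetic_le, h0.relPotential_le]
  have hgr : ∀ t ∈ Icc 0 T, F t ≤ C₁ := fun t ht => by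
    have h1 := le_exp_of_le_integral (G₀ := F 0) (B := B) hFc hB0 (fun t ht => by
      rw [hFeq t ht, intervalIntegral.integral_add (hDI t ht) (hσI t ht)]
      have := (abs_le.1 (hσint t ht)).1
      linarith [hDint t ht]) ht
    refine h1.trans (mul_le_mul hF0 (Real.exp_le_exp.2 ?_) (Real.exp_pos _).le (by positivity))
    exact mul_le_mul_of_nonneg_left (ht.2.trans hTS') hB0
  have hFint : ∀ t ∈ Icc 0 T, B * ∫ s in (0 : ℝ)..t, F s ≤ |S| * B * C₁ := fun t ht => by
    have h1 : ∫ s in (0 : ℝ)..t, F s ≤ ∫ _ in (0 : ℝ)..t, C₁ :=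
      intervalIntegral.integral_mono_on ht.1 (hFI t ht) (by simp)
        fun s hs => hgr s ⟨hs.1, hs.2.trans ht.2⟩
    rw [intervalIntegral.integral_const, sub_zero, smul_eq_mul] at h1
    have h2 : t * C₁ ≤ |S| * C₁ := mul_le_mul_of_nonneg_right (ht.2.trans hTS') hC₁0.le
    have := mul_le_mul_of_nonneg_left (h1.trans h2) hB0
    linarith
  have hX0 : 0 ≤ |S| * B * C₁ := by positivity
  refine ⟨fun t ht => ⟨hkin t ht, hpot t ht, ?_, ?_, ?_⟩, ?_⟩
  · have := hgr t ht
    have h1 := hπ0 t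
    simp only [hFdef] at this
    change e t ≤ _
    linarith
  · have := hgr t ht
    have h1 := he0 t
    simp only [hFdef] at this
    change π t ≤ _
    linarith
  · have h1 := hbπ t ht
    have h2 := (abs_le.1 ((hσint t ht).trans (hFint t ht))).1
    have h3 : π 0 ≤ E := h0.relPotential_le
    have h4 := hπ0 t
    change -∫ s in (0 : ℝ)..t, w s ≤ _
    linarith
  · have hTm : T ∈ Icc 0 T := ⟨hT.le, le_rfl⟩
    have h1 := hFeq T hTm
    rw [intervalIntegral.integral_add (hDI T hTm) (hσI T hTm)] at h1
    have h2 := (abs_le.1 ((hσint T hTm).trans (hFint T hTm))).1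
    have h3 : 0 ≤ F T := by
      have := he0 T
      have := hπ0 T
      simp only [hFdef]; positivity
    have h4 : F 0 ≤ C₁ := hgr 0 ⟨le_rfl, hT.le⟩
    change ∫ s in Ioc 0 T, D s ≤ _
    rw [← intervalIntegral.integral_of_le hT.le]
    linarith

end Energy

lemma HasACDeriv.ae_hasDerivAt {f g : ℝ → ℝ} (h : ∀ a b, HasACDeriv f g a b) :
    ∀ᵐ x, HasDerivAt f (g x) x := by
  have h1 : ∀ᵐ x, ∀ n : ℕ, x ∈ uIoo (-(n : ℝ)) n → HasDerivAt f (g x) x :=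
    ae_all_iff.2 fun n => (h _ _).ae
  filter_upwards [h1] with x hx
  obtain ⟨n, hn⟩ := exists_nat_gt |x|
  refine hx n ?_
  rw [uIoo_of_le (by linarith [abs_nonneg x])]
  exact abs_lt.1 hn

/-- A bound for the density in terms of the energy and the entropy. -/
lemma exists_density_bound {a α γ : ℝ} {rbar : ℝ → ℝ} {rm rp : ℝ} (ha : 0 < a) (hα : 1 / 2 < α)
    (hγ : 1 < γ) (hb : IsBackground rbar rm rp) (C₁ C₂ : ℝ) :
    ∃ C, ∀ r g : ℝ → ℝ, (∃ m M, 0 < m ∧ ∀ x, m ≤ r x ∧ r x ≤ M) →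
      (∀ p q, HasACDeriv r g p q) →
      Integrable (fun x => relPotential a γ (r x) (rbar x)) →
      ∫ x, relPotential a γ (r x) (rbar x) ≤ C₁ →
      Integrable (fun x => r x ^ (2 * α - 3) * g x ^ 2) →
      ∫ x, r x ^ (2 * α - 3) * g x ^ 2 ≤ C₂ → ∀ x, r x ≤ C := by
  obtain ⟨mb, Mb, hmb, hmMb⟩ := hb.bounds
  have hMb : 0 < Mb := hmb.trans_le ((hmMb 0).1.trans (hmMb 0).2)
  obtain ⟨c, hc0, hc⟩ := exists_le_relPotential ha hγ hMb
  set θ := α - 1 / 2 with hθ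
  have hθ0 : 0 < θ := by linarith
  refine ⟨((c * (1 + C₁)) ^ θ + θ / 2 * (1 + C₂)) ^ θ⁻¹, fun r g hr hg hp hp1 hq hq1 x => ?_⟩
  obtain ⟨m, M, hm, hmM⟩ := hr
  have hpos : ∀ x, 0 < r x := fun x => hm.trans_le (hmM x).1
  have hrc : Continuous r := continuous_iff_continuousAt.2 fun z =>
    (hg (z - 1) (z + 1)).continuousOn.continuousAt (by
      rw [uIcc_of_le (by linarith)]; exact Icc_mem_nhds (by linarith) (by linarith))
  have hx1 : x ≤ x + 1 := by linarith
  have hp0 : ∀ z, 0 ≤ relPotential a γ (r z) (rbar z) := fun z =>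
    relPotential_nonneg ha hγ (hpos z) (hmb.trans_le (hmMb z).1)
  have hq0 : ∀ z, 0 ≤ r z ^ (2 * α - 3) * g z ^ 2 := fun z =>
    mul_nonneg (Real.rpow_nonneg (hpos z).le _) (sq_nonneg _)
  obtain ⟨z, hz, hzmin⟩ := (isCompact_Icc (a := x) (b := x + 1)).exists_isMinOn
    (nonempty_Icc.2 hx1) hrc.continuousOn
  have hzR : r z ≤ c * (1 + C₁) := by
    calc r z = ∫ _ in x..x + 1, r z := by simp
      _ ≤ ∫ y in x..x + 1, c * (1 + relPotential a γ (r y) (rbar y)) := by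
        refine intervalIntegral.integral_mono_on hx1 (by simp) ?_ fun y hy =>
          (hzmin hy).trans (hc _ _ (hpos y) (hmb.trans_le (hmMb y).1) (hmMb y).2)
        exact ((intervalIntegrable_const).add hp.intervalIntegrable).const_mul c
      _ = c * (1 + ∫ y in x..x + 1, relPotential a γ (r y) (rbar y)) := by
        rw [intervalIntegral.integral_const_mul, intervalIntegral.integral_add
          intervalIntegrable_const hp.intervalIntegrable]
        simp
      _ ≤ c * (1 + C₁) := by
        refine mul_le_mul_of_nonneg_left (add_le_add le_rfl (le_trans ?_ hp1)) hc0
        rw [intervalIntegral.integral_of_le hx1]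
        exact setIntegral_le_integral hp (ae_of_all _ hp0)
  have hac := (hg x z).rpow hm hmM θ
  have h1 : |∫ y in x..z, θ * r y ^ (θ - 1) * g y| ≤ θ / 2 * (1 + C₂) := by
    have hI : IntervalIntegrable (fun y => θ / 2 * (1 + r y ^ (2 * α - 3) * g y ^ 2)) volume x z :=
      (intervalIntegrable_const.add hq.intervalIntegrable).const_mul _
    refine (intervalIntegral.norm_integral_le_of_norm_le
      (f := fun y => θ * r y ^ (θ - 1) * g y) hz.1 (ae_of_all _ fun y _ => ?_) hI).trans ?_
    · have e : r y ^ (2 * α - 3) = r y ^ (θ - 1) * r y ^ (θ - 1) := by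
        rw [← Real.rpow_add (hpos y), hθ]; ring_nf
      rw [e, Real.norm_eq_abs, mul_assoc, abs_mul, abs_of_pos hθ0]
      set k := r y ^ (θ - 1) * g y with hk
      have : |k| ≤ 1 / 2 * (1 + k ^ 2) := by
        nlinarith [sq_nonneg (|k| - 1), sq_abs k]
      calc θ * |k| ≤ θ * (1 / 2 * (1 + k ^ 2)) := mul_le_mul_of_nonneg_left this hθ0.le
        _ = _ := by rw [hk]; ring
    · rw [intervalIntegral.integral_const_mul, intervalIntegral.integral_add
        intervalIntegrable_const hq.intervalIntegrable]
      refine mul_le_mul_of_nonneg_left (add_le_add ?_ (le_trans ?_ hq1)) (by positivity)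
      · simp only [intervalIntegral.integral_const, smul_eq_mul, mul_one]; linarith [hz.2]
      · rw [intervalIntegral.integral_of_le hz.1]
        exact setIntegral_le_integral hq (ae_of_all _ hq0)
  rw [hac.integral_eq_sub] at h1
  have h2 : r z ^ θ ≤ (c * (1 + C₁)) ^ θ := Real.rpow_le_rpow (hpos z).le hzR hθ0.le
  have h3 : r x ^ θ ≤ (c * (1 + C₁)) ^ θ + θ / 2 * (1 + C₂) := by linarith [(abs_le.1 h1).1]
  calc r x = (r x ^ θ) ^ θ⁻¹ := (Real.rpow_rpow_inv (hpos x).le hθ0.ne').symm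
    _ ≤ _ := Real.rpow_le_rpow (Real.rpow_nonneg (hpos x).le _) h3 (inv_nonneg.2 hθ0.le)

section Flow

variable {a α γ T : ℝ} {rbar : ℝ → ℝ} {rm rp : ℝ} {ρ u ρt ut ρx ux uxx : ℝ → ℝ → ℝ}

namespace RegularFlow

lemma ae_hasDerivAt_density (hF : RegularFlow a α γ T rbar ρ u ρt ut ρx ux uxx) :
    ∀ᵐ t ∂volume.restrict (Ioc 0 T), ∀ᵐ x, HasDerivAt (ρ t) (ρx t x) x := by
  filter_upwards [hF.space_density] with t ht using HasACDeriv.ae_hasDerivAt ht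

lemma ae_deriv_density (hF : RegularFlow a α γ T rbar ρ u ρt ut ρx ux uxx) :
    ∀ᵐ z ∂stripMeasure T, ρx z.1 z.2 = deriv (ρ z.1) z.2 := by
  refine ae_eq_strip_of_ae_ae (G := fun t x => deriv (ρ t) x) hF.memLp_ρx.1
    (measurable_deriv_with_param hF.cont_density).aestronglyMeasurable ?_
  filter_upwards [hF.ae_hasDerivAt_density] with t ht
  filter_upwards [ht] with x hx using hx.deriv.symm

lemma integrable_gradient (hF : RegularFlow a α γ T rbar ρ u ρt ut ρx ux uxx) :
    Integrable (Function.uncurry fun t x => ρ t x ^ (2 * α - 3) * ρx t x ^ 2)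
      (stripMeasure T) := by
  simpa only [pow_two] using (hF.bdd_rpow (2 * α - 3)).integrable_mul hF.memLp_ρx hF.memLp_ρx

/-- The entropy estimate for a single flow. -/
theorem entropy_le (hF : RegularFlow a α γ T rbar ρ u ρt ut ρx ux uxx) (ha : 0 < a) (hα : 0 < α)
    (hγ : α ≤ γ) (hd0 : ∀ᵐ x, DifferentiableAt ℝ (ρ 0) x)
    (hi0 : Integrable fun x => ρ 0 x * effVel α ρ u 0 x ^ 2) :
    ∀ᵐ t ∂volume.restrict (Ioc 0 T), ∫ x, ρ t x ^ (2 * α - 3) * ρx t x ^ 2 ≤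
      2 * ((∫ x, ρ 0 x * effVel α ρ u 0 x ^ 2) -
        2 * ∫ s in (0 : ℝ)..t, ∫ x, u s x * (a * γ * ρ s x ^ (γ - 1) * ρx s x)) +
      2 * ∫ x, ρ t x * u t x ^ 2 := by
  obtain ⟨X, Q, hL⟩ := hF.exists_lagrangianFlow ha hα hγ
  have hd : ∀ᵐ s ∂volume.restrict (Ioc 0 T), ∀ᵐ x, DifferentiableAt ℝ (ρ s) x := by
    filter_upwards [hF.ae_hasDerivAt_density] with s hs
    filter_upwards [hs] with x hx using hx.differentiableAt
  have iw : Integrable (Function.uncurry fun s x => u s x * (a * γ * ρ s x ^ (γ - 1) * ρx s x))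
      (stripMeasure T) := by
    simpa using hF.integrable_work 0
  have hw : Integrable (Function.uncurry fun s x =>
      u s x * (a * γ * ρ s x ^ (γ - 1) * deriv (ρ s) x)) (stripMeasure T) := by
    refine iw.congr ?_
    filter_upwards [hF.ae_deriv_density] with z hz
    simp only [Function.uncurry, hz]
  have hm := hF.memLp_velocity.add ((hF.bdd_rpow (α - 2)).memLp_mul hF.memLp_ρx)
  have hv := hF.bdd_density.integrable_mul (f := fun t x => u t x + ρ t x ^ (α - 2) * ρx t x)
    (g := fun t x => u t x + ρ t x ^ (α - 2) * ρx t x) hm hm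
  have hv' : ∀ᵐ s ∂volume.restrict (Ioc 0 T),
      Integrable fun x => ρ s x * effVel α ρ u s x ^ 2 := by
    filter_upwards [hv.prod_right_ae, hF.ae_hasDerivAt_density] with s hs hx
    refine hs.congr ?_
    filter_upwards [hx] with x hx
    simp only [Function.uncurry, effVel, hx.deriv]
    ring
  have iu := (hF.bdd_density.integrable_mul hF.memLp_velocity hF.memLp_velocity).prod_right_ae
  filter_upwards [hL.integral_effVel_sq_le hd hd0 hv' hi0 hw, hv', iu,
    hF.integrable_gradient.prod_right_ae, hF.ae_hasDerivAt_density,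
    ae_restrict_mem measurableSet_Ioc] with t h1 h2 h3 h4 h5 ht
  have h3' : Integrable fun x => ρ t x * u t x ^ 2 :=
    h3.congr (ae_of_all _ fun x => by simp only [Function.uncurry]; ring)
  have h6 : ∫ s in (0 : ℝ)..t, ∫ x, u s x * (a * γ * ρ s x ^ (γ - 1) * deriv (ρ s) x) =
      ∫ s in (0 : ℝ)..t, ∫ x, u s x * (a * γ * ρ s x ^ (γ - 1) * ρx s x) := by
    refine intervalIntegral.integral_congr_ae (ae_mem_uIoc (Ioc_subset_Icc_self ht) ?_)
    filter_upwards [hF.ae_hasDerivAt_density] with s hs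
    refine integral_congr_ae ?_
    filter_upwards [hs] with x hx
    simp only [hx.deriv]
  rw [h6] at h1
  have h7 := integral_mono_ae h4 ((h2.const_mul 2).add (h3'.const_mul 2)) (by
    filter_upwards [h5] with x hx
    have hpos := hF.density_pos t x
    have e : ρ t x ^ (2 * α - 3) = ρ t x * (ρ t x ^ (α - 2)) ^ 2 := by
      rw [pow_two, ← Real.rpow_add hpos, mul_comm (ρ t x), ← Real.rpow_add_one hpos.ne']; ring_nf
    simp only [Function.uncurry, Pi.add_apply, effVel, hx.deriv]
    rw [e]
    nlinarith [mul_nonneg hpos.le (sq_nonneg (2 * u t x + ρ t x ^ (α - 2) * ρx t x))])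
  rw [integral_add' (h2.const_mul 2) (h3'.const_mul 2), integral_const_mul,
    integral_const_mul] at h7
  refine h7.trans (add_le_add ?_ le_rfl)
  linarith

/-- The estimate for the fourth moment of the velocity. -/
theorem quartic_le (hF : RegularFlow a α γ T rbar ρ u ρt ut ρx ux uxx) {C K : ℝ}
    (hγ : 1 ≤ 2 * γ - α) (hi0 : Integrable fun x => ρ 0 x * u 0 x ^ 4)
    (hK : ∀ᵐ t ∂volume.restrict (Ioc 0 T), ∀ x, ρ t x ≤ K)
    (hkin : ∀ t ∈ Icc 0 T, (Integrable fun x => ρ t x * u t x ^ 2) ∧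
      ∫ x, ρ t x * u t x ^ 2 ≤ C) {t : ℝ} (ht : t ∈ Icc 0 T) :
    (Integrable fun x => ρ t x * u t x ^ 4) ∧
      ∫ x, ρ t x * u t x ^ 4 ≤ (∫ x, ρ 0 x * u 0 x ^ 4) +
        t * (3 * a ^ 2 * K ^ (2 * γ - α - 1) * C) := by
  obtain ⟨hb1, hb2⟩ := hF.balance_moment 2 ht
  obtain ⟨hw1, hw2⟩ := hF.integral_work_cube
  have hi : Integrable fun x => ρ t x * u t x ^ 4 := by
    refine (hb1.add hi0).congr (ae_of_all _ fun x => ?_)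
    simp
  refine ⟨hi, ?_⟩
  rw [integral_sub hi hi0] at hb2
  have hle : ∫ s in (0 : ℝ)..t, ∫ x, (-((((2 : ℕ) : ℝ) + 2) * (((2 : ℕ) : ℝ) + 1)) *
      (u s x ^ 2 * ρ s x ^ α * ux s x ^ 2) - (((2 : ℕ) : ℝ) + 2) *
      (u s x ^ (2 + 1) * (a * γ * ρ s x ^ (γ - 1) * ρx s x))) ≤
      ∫ _ in (0 : ℝ)..t, 3 * a ^ 2 * K ^ (2 * γ - α - 1) * C := by
    have id := hF.integrable_dissipation 2
    have iw := hF.integrable_work 2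
    have hsum := (id.const_mul (-((((2 : ℕ) : ℝ) + 2) * (((2 : ℕ) : ℝ) + 1)))).sub
      (iw.const_mul (((2 : ℕ) : ℝ) + 2))
    refine intervalIntegral.integral_mono_ae_restrict ht.1 ?_ (by simp) ?_
    · exact (intervalIntegrable_iff_integrableOn_Ioc_of_le ht.1).2
        (IntegrableOn.mono_set (t := Ioc 0 T) hsum.integral_prod_left
          (Ioc_subset_Ioc_right ht.2))
    · rw [← restrict_Ioc_eq_restrict_Icc]
      refine ae_restrict_of_ae_restrict_of_subset (Ioc_subset_Ioc_right ht.2) ?_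
      filter_upwards [id.prod_right_ae, iw.prod_right_ae, hw1.prod_right_ae, hw2, hK,
        ae_restrict_mem measurableSet_Ioc] with s h1 h2 h3 h4 h5 hs
      obtain ⟨k1, k2⟩ := hkin s (Ioc_subset_Icc_self hs)
      have h1' : Integrable fun x => u s x ^ 2 * ρ s x ^ α * ux s x ^ 2 := h1
      have h2' : Integrable fun x => u s x ^ (2 + 1) * (a * γ * ρ s x ^ (γ - 1) * ρx s x) := h2
      have h3' : Integrable fun x => a * ρ s x ^ γ * u s x ^ 2 * ux s x := h3
      rw [integral_sub (h1'.const_mul _) (h2'.const_mul _), integral_const_mul,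
        integral_const_mul, h4, ← integral_const_mul, ← integral_const_mul, ← integral_const_mul,
        ← integral_sub (h1'.const_mul _) ((h3'.const_mul _).const_mul _)]
      have hK0 : 0 < K := (hF.density_pos s 0).trans_le (h5 0)
      calc _ ≤ ∫ x, 3 * a ^ 2 * K ^ (2 * γ - α - 1) * (ρ s x * u s x ^ 2) := by
            refine integral_mono ((h1'.const_mul _).sub ((h3'.const_mul _).const_mul _))
              (k1.const_mul _) fun x => ?_
            have hpos := hF.density_pos s x
            have e1 : ρ s x ^ (2 * γ - α) = ρ s x ^ (2 * γ - α - 1) * ρ s x := by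
              rw [← Real.rpow_add_one hpos.ne']; ring_nf
            have e2 : ρ s x ^ α * ρ s x ^ (2 * γ - α) = ρ s x ^ γ * ρ s x ^ γ := by
              rw [← Real.rpow_add hpos, ← Real.rpow_add hpos]; ring_nf
            have e3 : ρ s x ^ (2 * γ - α - 1) ≤ K ^ (2 * γ - α - 1) :=
              Real.rpow_le_rpow hpos.le (h5 x) (by linarith)
            have hA : 0 < ρ s x ^ α := Real.rpow_pos_of_pos hpos _
            set A := ρ s x ^ α
            set G := ρ s x ^ γ
            set Z := ρ s x ^ (2 * γ - α)
            have key : a * G * ux s x ≤ A * ux s x ^ 2 + a ^ 2 * Z / 4 := by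
              have : A * (A * ux s x ^ 2 + a ^ 2 * Z / 4 - a * G * ux s x) =
                  (A * ux s x - a * G / 2) ^ 2 := by
                linear_combination (a ^ 2 / 4) * e2
              have h0 : 0 ≤ A * ux s x ^ 2 + a ^ 2 * Z / 4 - a * G * ux s x :=
                nonneg_of_mul_nonneg_right (this ▸ sq_nonneg _) hA
              linarith
            have hZ : a ^ 2 * Z ≤ a ^ 2 * (K ^ (2 * γ - α - 1) * ρ s x) := by
              rw [e1]
              exact mul_le_mul_of_nonneg_left (mul_le_mul_of_nonneg_right e3 hpos.le)
                (sq_nonneg a)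
            have k3 := mul_le_mul_of_nonneg_left key (sq_nonneg (u s x))
            have k4 := mul_le_mul_of_nonneg_left hZ (sq_nonneg (u s x))
            push_cast
            nlinarith
        _ ≤ _ := by
            rw [integral_const_mul]
            refine mul_le_mul_of_nonneg_left k2 ?_
            positivity
  rw [intervalIntegral.integral_const, sub_zero, smul_eq_mul] at hle
  linarith

end RegularFlow

end Flow

section Flow

variable {a α γ T : ℝ} {rbar : ℝ → ℝ} {rm rp : ℝ} {ρ u ρt ut ρx ux uxx : ℝ → ℝ → ℝ}

lemma rpow_le_mul_of_le {r K p : ℝ} (hr : 0 < r) (hrK : r ≤ K) (hp : 1 ≤ p) :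
    r ^ p ≤ K ^ (p - 1) * r := by
  have e : r ^ p = r ^ (p - 1) * r := by rw [← Real.rpow_add_one hr.ne']; ring_nf
  rw [e]
  exact mul_le_mul_of_nonneg_right (Real.rpow_le_rpow hr.le hrK (by linarith)) hr.le

/-- Pointwise bound for the kinetic energy density. -/
theorem RegularFlow.kinetic_le (hF : RegularFlow a α γ T rbar ρ u ρt ut ρx ux uxx) (hα : α ≤ 1)
    {K C₁ C₂ C₃ : ℝ} (hK : ∀ᵐ t ∂volume.restrict (Ioc 0 T), ∀ x, ρ t x ≤ K)
    (h1 : ∀ t ∈ Icc 0 T, (Integrable fun x => ρ t x * u t x ^ 2) ∧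
      ∫ x, ρ t x * u t x ^ 2 ≤ C₁)
    (h2 : ∀ᵐ t ∂volume.restrict (Ioc 0 T), ∫ x, ρ t x ^ (2 * α - 3) * ρx t x ^ 2 ≤ C₂)
    (h3 : ∀ t ∈ Icc 0 T, (Integrable fun x => ρ t x * u t x ^ 4) ∧
      ∫ x, ρ t x * u t x ^ 4 ≤ C₃) :
    ∀ᵐ t ∂volume.restrict (Ioc 0 T), ∀ x, ρ t x * u t x ^ 2 ≤
      C₂ / 2 + K ^ (2 - 2 * α) / 2 * C₃ + K ^ (1 - α) * C₁ +
        ∫ x, ρ t x ^ α * ux t x ^ 2 := by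
  have iD : Integrable (Function.uncurry fun s x => ρ s x ^ α * ux s x ^ 2) (stripMeasure T) := by
    simpa using hF.integrable_dissipation 0
  have j1 := hF.bdd_velocity.integrable_mul hF.memLp_ρx hF.memLp_velocity
  have j2 := hF.bdd_density.integrable_mul hF.memLp_velocity hF.memLp_ux
  filter_upwards [hK, h2, iD.prod_right_ae, hF.integrable_gradient.prod_right_ae,
    j1.prod_right_ae, j2.prod_right_ae, hF.space_density, hF.space_velocity,
    ae_restrict_mem measurableSet_Ioc] with t hK h2 iD iG j1 j2 hρ hu ht x
  obtain ⟨k1, k1'⟩ := h1 t (Ioc_subset_Icc_self ht)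
  obtain ⟨k3, k3'⟩ := h3 t (Ioc_subset_Icc_self ht)
  have iD' : Integrable fun x => ρ t x ^ α * ux t x ^ 2 := iD
  have iG' : Integrable fun x => ρ t x ^ (2 * α - 3) * ρx t x ^ 2 := iG
  have hpos := hF.density_pos t
  have hac : ∀ p q, HasACDeriv (fun x => ρ t x * u t x ^ 2)
      (fun x => u t x * (ρx t x * u t x) + 2 * (ρ t x * (u t x * ux t x))) p q := fun p q =>
    ((hρ p q).mul ((hu p q).pow 2)).congr_right (ae_of_all _ fun x _ => by push_cast; ring)
  have hI : Integrable fun x => u t x * (ρx t x * u t x) + 2 * (ρ t x * (u t x * ux t x)) :=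
    Integrable.add j1 (j2.const_mul 2)
  have h4 := abs_le_integral_of_hasACDeriv hac k1 hI x
  have q₁ : Integrable fun y => 1 / 2 * (ρ t y ^ (2 * α - 3) * ρx t y ^ 2) +
      K ^ (2 - 2 * α) / 2 * (ρ t y * u t y ^ 4) := (iG'.const_mul _).add (k3.const_mul _)
  have q₂ : Integrable fun y => 1 / 2 * (ρ t y ^ (2 * α - 3) * ρx t y ^ 2) +
      K ^ (2 - 2 * α) / 2 * (ρ t y * u t y ^ 4) + K ^ (1 - α) * (ρ t y * u t y ^ 2) :=
    q₁.add (k1.const_mul _)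
  have h5 : ∫ y, |u t y * (ρx t y * u t y) + 2 * (ρ t y * (u t y * ux t y))| ≤
      ∫ y, (1 / 2 * (ρ t y ^ (2 * α - 3) * ρx t y ^ 2) +
        K ^ (2 - 2 * α) / 2 * (ρ t y * u t y ^ 4) + K ^ (1 - α) * (ρ t y * u t y ^ 2) +
        ρ t y ^ α * ux t y ^ 2) := by
    refine integral_mono hI.abs (q₂.add iD') fun y => ?_
    have hy := hpos y
    have e1 : ρ t y ^ (2 * α - 3) * ρ t y ^ (3 - 2 * α) = 1 := by
      rw [← Real.rpow_add hy]; norm_num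
    have e2 : ρ t y ^ α * ρ t y ^ (2 - α) = ρ t y * ρ t y := by
      rw [← Real.rpow_add hy, show α + (2 - α) = (1 : ℝ) + 1 by ring, Real.rpow_add_one hy.ne',
        Real.rpow_one]
    have e3 := rpow_le_mul_of_le hy (hK y) (show (1 : ℝ) ≤ 3 - 2 * α by linarith)
    have e4 := rpow_le_mul_of_le hy (hK y) (show (1 : ℝ) ≤ 2 - α by linarith)
    rw [show 3 - 2 * α - 1 = 2 - 2 * α by ring] at e3
    rw [show 2 - α - 1 = 1 - α by ring] at e4
    have hA : 0 < ρ t y ^ (2 * α - 3) := Real.rpow_pos_of_pos hy _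
    have hB : 0 < ρ t y ^ α := Real.rpow_pos_of_pos hy _
    set A := ρ t y ^ (2 * α - 3)
    set A' := ρ t y ^ (3 - 2 * α)
    set B := ρ t y ^ α
    set B' := ρ t y ^ (2 - α)
    have y1 : |u t y * (ρx t y * u t y)| ≤ 1 / 2 * (A * ρx t y ^ 2) + 1 / 2 * (A' * u t y ^ 4) := by
      have f : ∀ c : ℝ, c ^ 2 = 1 → 0 ≤ 1 / 2 * (A * ρx t y ^ 2) + 1 / 2 * (A' * u t y ^ 4) +
          c * (u t y * (ρx t y * u t y)) := fun c hc => by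
        refine nonneg_of_mul_nonneg_right (a := A) ?_ hA
        have : A * (1 / 2 * (A * ρx t y ^ 2) + 1 / 2 * (A' * u t y ^ 4) +
          c * (u t y * (ρx t y * u t y))) = 1 / 2 * (A * ρx t y + c * u t y ^ 2) ^ 2 := by
          linear_combination (u t y ^ 4 / 2) * e1 - (u t y ^ 4 / 2) * hc
        rw [this]; positivity
      rw [abs_le]
      constructor
      · linarith [f 1 (by norm_num)]
      · linarith [f (-1) (by norm_num)]
    have y2 : |2 * (ρ t y * (u t y * ux t y))| ≤ B * ux t y ^ 2 + B' * u t y ^ 2 := by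
      have f : ∀ c : ℝ, c ^ 2 = 1 → 0 ≤ B * ux t y ^ 2 + B' * u t y ^ 2 +
          c * (2 * (ρ t y * (u t y * ux t y))) := fun c hc => by
        refine nonneg_of_mul_nonneg_right (a := B) ?_ hB
        have : B * (B * ux t y ^ 2 + B' * u t y ^ 2 +
          c * (2 * (ρ t y * (u t y * ux t y)))) = (B * ux t y + c * (ρ t y * u t y)) ^ 2 := by
          linear_combination (u t y ^ 2) * e2 - (ρ t y ^ 2 * u t y ^ 2) * hc
        rw [this]; positivity
      rw [abs_le]
      constructor
      · linarith [f 1 (by norm_num)]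
      · linarith [f (-1) (by norm_num)]
    have y3 : A' * u t y ^ 4 ≤ K ^ (2 - 2 * α) * ρ t y * u t y ^ 4 :=
      mul_le_mul_of_nonneg_right e3 (by positivity)
    have y4 : B' * u t y ^ 2 ≤ K ^ (1 - α) * ρ t y * u t y ^ 2 :=
      mul_le_mul_of_nonneg_right e4 (by positivity)
    refine (abs_add_le _ _).trans ((add_le_add y1 y2).trans ?_)
    linarith
  rw [integral_add q₂ iD', integral_add q₁ (k1.const_mul _), integral_add (iG'.const_mul _) (k3.const_mul _), integral_const_mul, integral_const_mul,
    integral_const_mul] at h5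
  have hK0 : 0 < K := (hpos 0).trans_le (hK 0)
  have g1 : K ^ (2 - 2 * α) / 2 * ∫ y, ρ t y * u t y ^ 4 ≤ K ^ (2 - 2 * α) / 2 * C₃ :=
    mul_le_mul_of_nonneg_left k3' (by positivity)
  have g2 : K ^ (1 - α) * ∫ y, ρ t y * u t y ^ 2 ≤ K ^ (1 - α) * C₁ :=
    mul_le_mul_of_nonneg_left k1' (by positivity)
  have := le_abs_self (ρ t x * u t x ^ 2)
  linarith

/-- The effective velocity is bounded in terms of the initial bounds and of the final time. -/
theorem exists_effVel_bound (ha : 0 < a) (hα : 1 / 2 < α) (hα1 : α ≤ 1) (hγ : α + 1 / 2 ≤ γ)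
    (hb : IsBackground rbar rm rp) (E S : ℝ) :
    ∃ K, ∀ (T : ℝ) (ρ u ρt ut ρx ux uxx : ℝ → ℝ → ℝ), T ≤ S →
      RegularFlow a α γ T rbar ρ u ρt ut ρx ux uxx → InitialBounds a α γ rbar ρ u E →
      ∀ᵐ t ∂volume.restrict (Ioc 0 T), ∀ᵐ x, |effVel α ρ u t x| ≤ K := by
  have hγ1 : 1 < γ := by linarith
  obtain ⟨C₁, hC₁⟩ := exists_energy_bound (α := α) ha hγ1 hb E S
  set C₂ := 2 * (E + 2 * C₁) + 2 * C₁ with hC₂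
  obtain ⟨K, hK⟩ := exists_density_bound ha hα hγ1 hb C₁ C₂
  set C₃ := E + |S| * (3 * a ^ 2 * K ^ (2 * γ - α - 1) * C₁) with hC₃
  set C₄ := C₂ / 2 + K ^ (2 - 2 * α) / 2 * C₃ + K ^ (1 - α) * C₁ with hC₄
  set L := a * γ * K ^ (γ - α - 1 / 2) / 2 with hL'
  refine ⟨E + L * (|S| * |1 + C₄| + C₁), fun T ρ u ρt ut ρx ux uxx hTS hF h0 => ?_⟩
  have hT := hF.T_pos
  have hTS' : T ≤ |S| := hTS.trans (le_abs_self S)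
  obtain ⟨he, hd⟩ := hC₁ T ρ u ρt ut ρx ux uxx hTS hF h0
  have hent : ∀ᵐ t ∂volume.restrict (Ioc 0 T), ∫ x, ρ t x ^ (2 * α - 3) * ρx t x ^ 2 ≤ C₂ := by
    filter_upwards [hF.entropy_le ha (by linarith) (by linarith) h0.differentiable h0.effVel_sq,
      ae_restrict_mem measurableSet_Ioc] with t h1 ht
    obtain ⟨-, -, k1, -, k2⟩ := he t (Ioc_subset_Icc_self ht)
    linarith [h0.effVel_sq_le]
  have hden : ∀ᵐ t ∂volume.restrict (Ioc 0 T), ∀ x, ρ t x ≤ K := by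
    filter_upwards [hent, hF.integrable_gradient.prod_right_ae, hF.space_density,
      ae_restrict_mem measurableSet_Ioc] with t h1 h2 h3 ht
    obtain ⟨-, k1, -, k2, -⟩ := he t (Ioc_subset_Icc_self ht)
    obtain ⟨m, M, hm, hmM⟩ := hF.density_bounds
    exact hK (ρ t) (ρx t) ⟨m, M, hm, hmM t⟩ h3 k1 k2 h2 h1
  have hK0 : 0 < K := by
    have : NeBot (ae (volume.restrict (Ioc 0 T))) := by
      rw [ae_neBot, Ne, Measure.restrict_eq_zero, Real.volume_Ioc]
      simpa using hT
    obtain ⟨t, ht⟩ := hden.exists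
    exact (hF.density_pos t 0).trans_le (ht 0)
  have hC₁0 : 0 ≤ C₁ := (integral_nonneg fun x => mul_nonneg (hF.density_pos 0 x).le
    (sq_nonneg _)).trans (he 0 ⟨le_rfl, hT.le⟩).2.2.1
  have hquart : ∀ t ∈ Icc 0 T, (Integrable fun x => ρ t x * u t x ^ 4) ∧
      ∫ x, ρ t x * u t x ^ 4 ≤ C₃ := fun t ht => by
    obtain ⟨k1, k2⟩ := hF.quartic_le (by linarith) h0.quartic hden
      (fun t ht => ⟨(he t ht).1, (he t ht).2.2.1⟩) ht
    refine ⟨k1, k2.trans (add_le_add h0.quartic_le ?_)⟩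
    exact mul_le_mul_of_nonneg_right (ht.2.trans hTS') (by positivity)
  have hkin := hF.kinetic_le hα1 hden (fun t ht => ⟨(he t ht).1, (he t ht).2.2.1⟩) hent hquart
  have iD : Integrable (Function.uncurry fun s x => ρ s x ^ α * ux s x ^ 2) (stripMeasure T) := by
    simpa using hF.integrable_dissipation 0
  set D : ℝ → ℝ := fun s => ∫ x, ρ s x ^ α * ux s x ^ 2 with hD
  have hDi : IntegrableOn D (Ioc 0 T) := iD.integral_prod_left
  obtain ⟨X, Q, hL⟩ := hF.exists_lagrangianFlow ha (by linarith) (by linarith)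
  have hdiff : ∀ᵐ s ∂volume.restrict (Ioc 0 T), ∀ᵐ x, DifferentiableAt ℝ (ρ s) x := by
    filter_upwards [hF.ae_hasDerivAt_density] with s hs
    filter_upwards [hs] with x hx using hx.differentiableAt
  have hγ0 : 0 < γ := by linarith
  have hL0 : 0 ≤ L := by positivity
  have hcon : IntegrableOn (fun _ : ℝ => 1 + C₄) (Ioc 0 T) := by simp
  have hmain := hL.effVel_le hdiff h0.differentiable h0.effVel_le
    (k := fun s => L * (1 + C₄ + D s)) ((hcon.add hDi).const_mul L) (by
      filter_upwards [hkin, hden] with s h1 h2 x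
      have hpos := hF.density_pos s x
      have e1 : ρ s x ^ (γ - α) = ρ s x ^ (γ - α - 1 / 2) * ρ s x ^ (1 / 2 : ℝ) := by
        rw [← Real.rpow_add hpos]; ring_nf
      have e2 : ρ s x ^ (γ - α - 1 / 2) ≤ K ^ (γ - α - 1 / 2) :=
        Real.rpow_le_rpow hpos.le (h2 x) (by linarith)
      have e3 : ρ s x ^ (1 / 2 : ℝ) * ρ s x ^ (1 / 2 : ℝ) = ρ s x := by
        rw [← Real.rpow_add hpos]; norm_num
      have hq : 0 < ρ s x ^ (1 / 2 : ℝ) := Real.rpow_pos_of_pos hpos _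
      have e4 : ρ s x ^ (1 / 2 : ℝ) * |u s x| ≤ (1 + ρ s x * u s x ^ 2) / 2 := by
        have := sq_nonneg (ρ s x ^ (1 / 2 : ℝ) * |u s x| - 1)
        have e5 : (ρ s x ^ (1 / 2 : ℝ) * |u s x|) ^ 2 = ρ s x * u s x ^ 2 := by
          rw [mul_pow, sq_abs, pow_two, e3]
        nlinarith
      calc a * γ * ρ s x ^ (γ - α) * |u s x|
          = a * γ * ρ s x ^ (γ - α - 1 / 2) * (ρ s x ^ (1 / 2 : ℝ) * |u s x|) := by rw [e1]; ring
        _ ≤ a * γ * K ^ (γ - α - 1 / 2) * ((1 + ρ s x * u s x ^ 2) / 2) :=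
            mul_le_mul (mul_le_mul_of_nonneg_left e2 (by positivity)) e4 (by positivity)
              (by positivity)
        _ = L * (1 + ρ s x * u s x ^ 2) := by rw [hL']; ring
        _ ≤ L * (1 + C₄ + D s) := by
            refine mul_le_mul_of_nonneg_left ?_ hL0
            rw [add_assoc]
            exact add_le_add le_rfl (h1 x))
  filter_upwards [hmain] with t ht
  filter_upwards [ht] with x hx
  refine hx.trans (add_le_add le_rfl ?_)
  rw [integral_const_mul]
  refine mul_le_mul_of_nonneg_left ?_ hL0
  rw [integral_add hcon hDi]
  refine add_le_add ?_ hd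
  rw [setIntegral_const, Real.volume_real_Ioc_of_le hT.le, sub_zero, smul_eq_mul]
  exact (mul_le_mul_of_nonneg_left (le_abs_self (1 + C₄)) hT.le).trans
    (mul_le_mul_of_nonneg_right hTS' (abs_nonneg _))

end Flow

/-! ### Initial data -/

lemma HasWeakDeriv.congr_left {f f' g : ℝ → ℝ} (h : HasWeakDeriv f g) (e : f =ᵐ[volume] f') :
    HasWeakDeriv f' g := by
  refine ⟨h.1.congr e, h.2.1, fun ψ h1 h2 => ?_⟩
  rw [← h.2.2 ψ h1 h2]
  refine integral_congr_ae ?_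
  filter_upwards [e] with x hx
  rw [hx]

lemma HasWeakDeriv.exists_continuous {f g : ℝ → ℝ} (h : HasWeakDeriv f g) :
    ∃ r, Continuous r ∧ f =ᵐ[volume] r ∧ HasWeakDeriv r g := by
  obtain ⟨c, hc⟩ := exists_ae_eq_integral_of_weakDeriv isOpen_univ ordConnected_univ
    (h.1.locallyIntegrableOn _) (h.2.1.locallyIntegrableOn _)
    (fun ψ h1 h2 _ => h.2.2 ψ h1 h2) 0 (mem_univ 0)
  have e : f =ᵐ[volume] fun x => c + ∫ t in (0 : ℝ)..x, g t := hc.mono fun x hx => hx (mem_univ x)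
  exact ⟨_, continuous_const.add
    (intervalIntegral.continuous_primitive h.2.1.intervalIntegrable_real 0), e, h.congr_left e⟩

lemma forall_mem_of_ae_mem {f : ℝ → ℝ} (hf : Continuous f) {s : Set ℝ} (hs : IsClosed s)
    (h : ∀ᵐ x, f x ∈ s) (x : ℝ) : f x ∈ s := by
  have h1 : Dense (f ⁻¹' s) := Measure.dense_of_ae (μ := volume) h
  have h2 := h1.closure_eq
  rw [(hs.preimage hf).closure_eq] at h2
  exact (Set.ext_iff.1 h2 x).2 (mem_univ x)

theorem IsInitialData.exists_initialBounds {a α γ rm rp : ℝ} {rbar ρ₀ u₀ : ℝ → ℝ} (hγ : 1 < γ)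
    (hb : IsBackground rbar rm rp) (h₀ : IsInitialData rbar ρ₀ u₀) :
    ∃ (E : ℝ) (r w : ℝ → ℝ), Continuous r ∧ Continuous w ∧ ρ₀ =ᵐ[volume] r ∧ u₀ =ᵐ[volume] w ∧
      ∀ ρ u : ℝ → ℝ → ℝ, ρ 0 = r → u 0 = w → InitialBounds a α γ rbar ρ u E := by
  obtain ⟨g, hg, hgtop⟩ := h₀.lipschitz
  obtain ⟨r, hrc, hr, hrg⟩ := hg.exists_continuous
  obtain ⟨hu2, k, hk, hk2⟩ := h₀.velocity
  obtain ⟨w, hwc, hw, hwk⟩ := hk.exists_continuous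
  obtain ⟨hd2, l, hl, hl2⟩ := h₀.density
  obtain ⟨hb1, -, hb3⟩ := hb.memLp_deriv
  have hbc : Continuous rbar := hb.smooth.continuous
  have hrac := hrg.hasACDeriv hrc
  obtain ⟨m, M, hm, hmM⟩ : ∃ m M, 0 < m ∧ (∀ x, r x ∈ Icc m M) ∧ ∀ x, rbar x ∈ Icc m M := by
    obtain ⟨m, M, hm, h⟩ := h₀.bounds
    obtain ⟨m', M', hm', h'⟩ := hb.bounds
    have h2 : ∀ x, r x ∈ Icc m M := forall_mem_of_ae_mem hrc isClosed_Icc (by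
      filter_upwards [h, hr] with x h1 h2 using h2 ▸ h1)
    exact ⟨min m m', max M M', lt_min hm hm',
      fun x => ⟨(min_le_left _ _).trans (h2 x).1, (h2 x).2.trans (le_max_left _ _)⟩,
      fun x => ⟨(min_le_right _ _).trans (h' x).1, (h' x).2.trans (le_max_right _ _)⟩⟩
  have hpos : ∀ x, 0 < r x := fun x => hm.trans_le (hmM.1 x).1
  obtain ⟨L, hL⟩ := exists_lipschitz_enthalpy a (M := M) hγ hm
  obtain ⟨N, hN⟩ := isCompact_Icc.exists_bound_of_continuousOn
    (continuousOn_rpow_Icc hm (α - 2) (M := M))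
  have hpc : ∀ p : ℝ, Continuous fun x => r x ^ p := fun p =>
    hrc.rpow_const fun x => Or.inl (hpos x).ne'
  have hd2' : MemLp (fun x => r x - rbar x) 2 := by
    refine (memLp_congr_ae ?_).1 hd2
    filter_upwards [hr] with x hx
    rw [hx]
  have hg2 : MemLp g 2 := by
    have h1 : HasWeakDeriv r fun x => l x + deriv rbar x := by
      have e : HasWeakDeriv (fun x => r x - rbar x) l := hl.congr_left (by
        filter_upwards [hr] with x hx
        rw [hx])
      refine hasWeakDeriv_of_hasACDeriv hrc fun p q => ?_
      have := (e.hasACDeriv (hrc.sub hbc) p q).add (HasACDeriv.of_hasDerivAt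
        (fun x => (hb.smooth.differentiable (by simp) x).hasDerivAt) hb1)
      simpa using this
    exact (memLp_congr_ae (hrg.ae_eq h1)).2 (hl2.add hb3)
  have hgb : ∀ᵐ x, |g x| ≤ (eLpNorm g ∞ volume).toReal := by
    have h1 := ae_le_eLpNormEssSup (f := g) (μ := volume)
    rw [← eLpNorm_exponent_top] at h1
    filter_upwards [h1] with x hx
    have := ENNReal.toReal_mono hgtop.2.ne hx
    simpa using this
  have hw2 : MemLp w 2 := (memLp_congr_ae hw).1 hu2
  obtain ⟨U, hU⟩ : ∃ U, ∀ x, |w x| ≤ U := by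
    refine ⟨2 * (max (eLpNorm w 2 volume).toNNReal (eLpNorm k 2 volume).toNNReal : ℝ≥0),
      abs_le_of_H1 hwk hwc ?_ ?_⟩
    · rw [← ENNReal.coe_toNNReal hw2.2.ne, ENNReal.coe_le_coe]
      simp
    · rw [← ENNReal.coe_toNNReal hk2.2.ne, ENNReal.coe_le_coe]
      simp
  have hder : ∀ᵐ x, HasDerivAt r (g x) x := HasACDeriv.ae_hasDerivAt hrac
  set v : ℝ → ℝ := fun x => w x + r x ^ (α - 2) * deriv r x with hv
  have hvg : v =ᵐ[volume] fun x => w x + r x ^ (α - 2) * g x := by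
    filter_upwards [hder] with x hx
    simp only [hv, hx.deriv]
  have hv2 : MemLp v 2 := by
    refine (memLp_congr_ae hvg).2 (hw2.add ?_)
    refine hg2.of_le_mul (c := N) ((hpc _).aestronglyMeasurable.mul hg2.1)
      (ae_of_all _ fun x => ?_)
    rw [norm_mul]
    exact mul_le_mul_of_nonneg_right (hN _ (hmM.1 x)) (norm_nonneg _)
  have hbdd : ∀ {f h : ℝ → ℝ} {c : ℝ}, Integrable f → Continuous h → (∀ x, |h x| ≤ c) →
      Integrable fun x => h x * f x := fun hf hh hc =>
    hf.bdd_mul hh.aestronglyMeasurable (ae_of_all _ hc)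
  have hrM : ∀ x, |r x| ≤ M := fun x => by rw [abs_of_pos (hpos x)]; exact (hmM.1 x).2
  have i1 : Integrable fun x => r x * w x ^ 2 := hbdd hw2.integrable_sq hrc hrM
  have i2 : Integrable fun x => r x * w x ^ 4 := by
    refine (hbdd (c := U ^ 2) i1 (hwc.pow 2) fun x => ?_).congr (ae_of_all _ fun x => ?_)
    · rw [Pi.pow_apply, abs_pow]; exact pow_le_pow_left₀ (abs_nonneg _) (hU x) 2
    · simp only [Pi.pow_apply]; ring
  have i3 : Integrable fun x => relPotential a γ (r x) (rbar x) := by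
    refine (hd2'.integrable_sq.const_mul L).mono' ?_
      (ae_of_all _ fun x => (hL _ (hmM.1 x) _ (hmM.2 x)).2)
    have hbp : ∀ p : ℝ, Continuous fun x => rbar x ^ p := fun p =>
      hbc.rpow_const fun x => Or.inl (hm.trans_le (hmM.2 x).1).ne'
    exact (((continuous_const.mul (hpc γ)).sub (continuous_const.mul (hbp γ))).sub
      ((continuous_const.mul (hbp (γ - 1))).mul (hrc.sub hbc))).aestronglyMeasurable
  have i4 : Integrable fun x => r x * v x ^ 2 := hbdd hv2.integrable_sq hrc hrM
  set A₁ := ∫ x, r x * w x ^ 2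
  set A₂ := ∫ x, r x * w x ^ 4
  set A₃ := ∫ x, relPotential a γ (r x) (rbar x)
  set A₄ := ∫ x, r x * v x ^ 2
  set A₅ := U + N * (eLpNorm g ∞ volume).toReal with hA₅
  have hA₅' : ∀ᵐ x, |v x| ≤ A₅ := by
    filter_upwards [hvg, hgb] with x h1 h2
    rw [h1]
    refine (abs_add_le _ _).trans (add_le_add (hU x) ?_)
    rw [abs_mul]
    exact mul_le_mul (hN _ (hmM.1 x)) h2 (abs_nonneg _) ((norm_nonneg _).trans (hN _ (hmM.1 x)))
  have b1 := le_abs_self A₁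
  have b2 := le_abs_self A₂
  have b3 := le_abs_self A₃
  have b4 := le_abs_self A₄
  have b5 := le_abs_self A₅
  have c1 := abs_nonneg A₁
  have c2 := abs_nonneg A₂
  have c3 := abs_nonneg A₃
  have c4 := abs_nonneg A₄
  have c5 := abs_nonneg A₅
  refine ⟨|A₁| + |A₂| + |A₃| + |A₄| + |A₅|, r, w, hrc, hwc, hr, hw, fun ρ u hρ hu => ?_⟩
  have he : ∀ x, effVel α ρ u 0 x = v x := fun x => by simp only [effVel, hρ, hu, hv]
  refine ⟨?_, ?_, ?_, ?_, ?_, ?_, ?_, ?_, ?_, ?_⟩ <;> simp only [he, hρ, hu]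
  · exact i1
  · linarith
  · exact i2
  · linarith
  · exact i3
  · linarith
  · exact i4
  · linarith
  · filter_upwards [hA₅'] with x hx
    linarith
  · filter_upwards [hder] with x hx using hx.differentiableAt

/-! ### The effective velocity of a strong solution -/

section Solution

variable {a α γ T₀ rm rp : ℝ} {rbar ρ₀ u₀ φ : ℝ → ℝ} {ρ u : ℝ → ℝ → ℝ}

lemma IsStrongSolution.continuous_density_slice (hs : IsStrongSolution a α γ rbar ρ₀ u₀ T₀ ρ u)
    {t : ℝ} (ht : t ∈ Ico 0 T₀) : Continuous (ρ t) :=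
  hs.continuous_density.comp_continuous (by fun_prop : Continuous fun x => (t, x))
    fun _ => ⟨ht, mem_univ _⟩

lemma IsStrongSolution.continuous_velocity_slice (hs : IsStrongSolution a α γ rbar ρ₀ u₀ T₀ ρ u)
    {t : ℝ} (ht : t ∈ Ico 0 T₀) : Continuous (u t) :=
  hs.continuous_velocity.comp_continuous (by fun_prop : Continuous fun x => (t, x))
    fun _ => ⟨ht, mem_univ _⟩

lemma hasWeakDeriv_comp_of_visc
    (hφ : ∀ r : ℝ, 0 < r → HasDerivAt φ (visc α r / r ^ 2) r) {r g : ℝ → ℝ} {m M : ℝ}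
    (hm : 0 < m) (hr : ∀ x, m ≤ r x ∧ r x ≤ M) (hc : Continuous r)
    (hg : ∀ p q, HasACDeriv r g p q) :
    HasWeakDeriv (fun x => φ (r x)) fun x => r x ^ (α - 2) * g x := by
  have hφ' : ∀ s ∈ Icc m M, HasDerivAt φ (s ^ (α - 2)) s := fun s hs => by
    have hs0 := hm.trans_le hs.1
    refine (hφ s hs0).congr_deriv ?_
    rw [visc, Real.rpow_sub hs0, Real.rpow_two]
  refine hasWeakDeriv_of_hasACDeriv ?_ fun p q =>
    (hg p q).comp hφ' (continuousOn_rpow_Icc hm _) fun x _ => hr x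
  exact continuous_iff_continuousAt.2 fun x =>
    (hφ' (r x) (hr x)).continuousAt.comp (f := r) hc.continuousAt

lemma IsStrongSolution.exists_effectiveVelocity (hb : IsBackground rbar rm rp)
    (hs : IsStrongSolution a α γ rbar ρ₀ u₀ T₀ ρ u)
    (hφ : ∀ r : ℝ, 0 < r → HasDerivAt φ (visc α r / r ^ 2) r) :
    ∃ v, IsEffectiveVelocity φ T₀ ρ u v := by
  obtain ⟨-, g, ⟨hgm, hgw⟩, -⟩ := hs.density_H1
  obtain ⟨hb1, -, -⟩ := hb.memLp_deriv
  set w : ℝ → ℝ → ℝ := fun t x => ρ t x ^ (α - 2) * (g t x + deriv rbar x) with hw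
  have hmeas : MeasurableSet (strip T₀) := (isOpen_Ioo.prod isOpen_univ).measurableSet
  refine ⟨fun t x => u t x + w t x, w, ⟨?_, ?_⟩, ae_of_all _ fun _ => rfl⟩
  · have h1 : AEMeasurable (Function.uncurry ρ) (volume.restrict (strip T₀)) :=
      ((hs.continuous_density.mono (prod_mono Ioo_subset_Ico_self subset_rfl)).aestronglyMeasurable
        hmeas).aemeasurable
    exact (h1.pow_const (α - 2)).aestronglyMeasurable.mul
      (hgm.add (hb1.comp continuous_snd).aestronglyMeasurable)
  · filter_upwards [hgw, ae_restrict_mem measurableSet_Ioo] with t h1 ht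
    obtain ⟨T₁, h2, h3⟩ := exists_between ht.2
    obtain ⟨m, M, hm, hmM⟩ := hs.bounds T₁ ⟨ht.1.trans h2, h3⟩
    have hc := hs.continuous_density_slice (Ioo_subset_Ico_self ht)
    refine hasWeakDeriv_comp_of_visc hφ hm (hmM t ⟨ht.1, h2⟩) hc fun p q => ?_
    have := (h1.hasACDeriv (hc.sub hb.smooth.continuous) p q).add (HasACDeriv.of_hasDerivAt
      (fun x => (hb.smooth.differentiable (by simp) x).hasDerivAt) hb1)
    simpa using this

/-- The bound for the effective velocity up to a given time. -/
theorem exists_eLpNorm_effectiveVelocity_le (ha : 0 < a) (hα : 1 / 2 < α) (hα1 : α ≤ 1)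
    (hγ : α + 1 / 2 ≤ γ) (hb : IsBackground rbar rm rp) (h₀ : IsInitialData rbar ρ₀ u₀)
    (hφ : ∀ r : ℝ, 0 < r → HasDerivAt φ (visc α r / r ^ 2) r) (S : ℝ) :
    ∃ K, ∀ T₀ ρ u v, IsStrongSolution a α γ rbar ρ₀ u₀ T₀ ρ u →
      IsEffectiveVelocity φ T₀ ρ u v → ∀ T ∈ Ioo 0 T₀, T ≤ S →
      eLpNorm (Function.uncurry v) ⊤ (volume.restrict (strip T)) ≤ ENNReal.ofReal K := by
  obtain ⟨E, r, w, hrc, hwc, hr, hw, hE⟩ := h₀.exists_initialBounds (a := a) (α := α) (γ := γ)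
    (by linarith) hb
  obtain ⟨K, hK⟩ := exists_effVel_bound ha hα hα1 hγ hb E S
  refine ⟨K, fun T₀ ρ u v hs hv T hT hTS => ?_⟩
  obtain ⟨ρt, ut, ρx, ux, uxx, hF⟩ := hs.exists_regularFlow hb hT
  have h0m : (0 : ℝ) ∈ Ico 0 T₀ := ⟨le_rfl, hT.1.trans hT.2⟩
  have hcl0 : clampTime T 0 = 0 := clampTime_of_mem ⟨le_rfl, hT.1.le⟩
  have e1 : ρ 0 = r := (Continuous.ae_eq_iff_eq volume (hs.continuous_density_slice h0m) hrc).1 (by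
    filter_upwards [hs.initial, hr] with x h1 h2 using h1.1.trans h2)
  have e2 : u 0 = w := (Continuous.ae_eq_iff_eq volume (hs.continuous_velocity_slice h0m) hwc).1 (by
    filter_upwards [hs.initial, hw] with x h1 h2 using h1.2.trans h2)
  set ρ' : ℝ → ℝ → ℝ := fun t x => ρ (clampTime T t) x with hρ'
  set u' : ℝ → ℝ → ℝ := fun t x => u (clampTime T t) x with hu'
  have hbd := hK T ρ' u' ρt ut ρx ux uxx hTS hF
    (hE ρ' u' (by simp only [hρ', hcl0]; exact e1) (by simp only [hu', hcl0]; exact e2))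
  have hdm : Measurable (Function.uncurry fun t x => ρ' t x ^ (α - 2) * deriv (ρ' t) x) :=
    (hF.bdd_rpow (α - 2)).1.measurable.mul (measurable_deriv_with_param hF.cont_density)
  have hvm : Measurable (Function.uncurry (effVel α ρ' u')) := hF.cont_velocity.measurable.add hdm
  have hbd' : ∀ᵐ z ∂stripMeasure T, |effVel α ρ' u' z.1 z.2| ≤ K := by
    have hms : MeasurableSet {z : ℝ × ℝ | |effVel α ρ' u' z.1 z.2| ≤ K} :=
      measurableSet_le hvm.abs measurable_const
    rw [stripMeasure, Measure.ae_prod_iff_ae_ae hms]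
    exact hbd
  obtain ⟨W, ⟨hWm, hW⟩, hvW⟩ := hv
  have hWeq : ∀ᵐ z ∂stripMeasure T, W z.1 z.2 = ρ' z.1 z.2 ^ (α - 2) * deriv (ρ' z.1) z.2 := by
    refine ae_eq_strip_of_ae_ae (G := fun t x => ρ' t x ^ (α - 2) * deriv (ρ' t) x)
      (aestronglyMeasurable_stripMeasure hT.2 hWm) hdm.aestronglyMeasurable ?_
    obtain ⟨m, M, hm, hmM⟩ := hF.density_bounds
    filter_upwards [ae_Ioc_of_ae_Ioo hT.2 hW, hF.space_density, hF.ae_hasDerivAt_density,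
      ae_clamp_eq (T := T) ρ] with t h1 h2 h3 h4
    have h5 := hasWeakDeriv_comp_of_visc hφ hm (hmM t) (hF.cont_density_space t) h2
    change ρ' t = ρ t at h4
    simp only [h4] at h5
    filter_upwards [h1.ae_eq h5, h3] with x h6 h7
    rw [h6, h7.deriv, h4]
  rw [volume_restrict_strip, eLpNorm_exponent_top]
  refine eLpNormEssSup_le_of_ae_bound ?_
  have hvW' : ∀ᵐ z ∂stripMeasure T, v z.1 z.2 = u z.1 z.2 + W z.1 z.2 := by
    rw [← volume_restrict_strip]
    exact ae_restrict_of_ae_restrict_of_subset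
      (prod_mono (Ioo_subset_Ioo_right hT.2.le) subset_rfl) hvW
  filter_upwards [hvW', hWeq, hbd', ae_clamp_eq_strip (T := T) u] with z h1 h2 h3 h4
  change |v z.1 z.2| ≤ K
  rw [h1, h2, ← h4]
  exact h3

end Solution

end DegenerateNS

theorem proposition3p5 (a α γ ε : ℝ) (ha : 0 < a) (hα : 1 / 2 < α) (hα1 : α ≤ 1)
    (hε : 0 < ε) (hε1 : ε < 1 / 4) (hγ : α + 1 / 2 + ε ≤ γ)
    (rbar : ℝ → ℝ) (rminus rplus : ℝ) (hbar : DegenerateNS.IsBackground rbar rminus rplus)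
    (ρ₀ u₀ : ℝ → ℝ) (h₀ : DegenerateNS.IsInitialData rbar ρ₀ u₀)
    (φ : ℝ → ℝ) (hφ : ∀ r : ℝ, 0 < r → HasDerivAt φ (DegenerateNS.visc α r / r ^ 2) r) :
    ∃ C : ℝ → ℝ, Continuous C ∧
      ∀ T₀ : ℝ, 0 < T₀ → ∀ ρ u : ℝ → ℝ → ℝ,
        DegenerateNS.IsStrongSolution a α γ rbar ρ₀ u₀ T₀ ρ u →
        (∃ v : ℝ → ℝ → ℝ, DegenerateNS.IsEffectiveVelocity φ T₀ ρ u v) ∧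
        ∀ v : ℝ → ℝ → ℝ, DegenerateNS.IsEffectiveVelocity φ T₀ ρ u v →
          ∀ T ∈ Set.Ioo 0 T₀,
            MeasureTheory.eLpNorm (Function.uncurry v) ⊤
              (MeasureTheory.volume.restrict (DegenerateNS.strip T)) ≤ ENNReal.ofReal (C T) := by
  have hK := DegenerateNS.exists_eLpNorm_effectiveVelocity_le (γ := γ) ha hα hα1 (by linarith) hbar
    h₀ hφ
  obtain ⟨C, hC⟩ := exists_continuous_forall_mem_convex_of_local_const
    (t := fun T : ℝ => {c : ℝ | ∀ T₀ ρ u v,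
      DegenerateNS.IsStrongSolution a α γ rbar ρ₀ u₀ T₀ ρ u →
      DegenerateNS.IsEffectiveVelocity φ T₀ ρ u v → T ∈ Set.Ioo 0 T₀ →
      eLpNorm (Function.uncurry v) ⊤ (volume.restrict (DegenerateNS.strip T)) ≤
        ENNReal.ofReal c})
    (fun T => by
      have hup : IsUpperSet {c : ℝ | ∀ T₀ ρ u v,
          DegenerateNS.IsStrongSolution a α γ rbar ρ₀ u₀ T₀ ρ u →
          DegenerateNS.IsEffectiveVelocity φ T₀ ρ u v → T ∈ Set.Ioo 0 T₀ →
          eLpNorm (Function.uncurry v) ⊤ (volume.restrict (DegenerateNS.strip T)) ≤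
            ENNReal.ofReal c} := fun c d hcd hc T₀ ρ u v h1 h2 h3 =>
        (hc T₀ ρ u v h1 h2 h3).trans (ENNReal.ofReal_le_ofReal hcd)
      exact hup.ordConnected.convex)
    (fun T => by
      obtain ⟨K, hK⟩ := hK (T + 1)
      refine ⟨K, ?_⟩
      filter_upwards [eventually_lt_nhds (lt_add_one T)] with T' hT' T₀ ρ u v h1 h2 h3
      exact hK T₀ ρ u v h1 h2 T' h3 hT'.le)
  refine ⟨C, C.continuous, fun T₀ _ ρ u hs => ⟨hs.exists_effectiveVelocity hbar hφ, ?_⟩⟩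
  exact fun v hv T hT => hC T T₀ ρ u v hs hv hT
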